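/- Let $n \ge 5$. All quivers are finite, without loops and without oriented $2$-cycles; mutation of a quiver at a vertex $k$ adds an arrow $i\to j$ for every path $i\to k\to j$, reverses all arrows at $k$, and deletes pairs of opposite arrows until no oriented $2$-cycle is left. For a quiver $Q_0$ whose underlying graph is the Dynkin diagram $D_n$, let $\mathcal M_n$ be its mutation class, i.e. the set of all quivers obtained from $Q_0$ by finitely many mutations, up to isomorphism of quivers. Let $\mathcal P_n$ be the regular $n$-gon with one puncture in its centre. For border vertices $a,b$ let $\delta_{a,b}$ be the counterclockwise border path from $a$ to $b$ (running once around the polygon if $a=b$). The *diagonals* of $\mathcal P_n$ are the homotopy classes $M_{a,b}$, for $a\ne b$ such that $\delta_{a,b}$ has at least three vertices, of paths from $a$ to $b$ in the interior of $\mathcal P_n$, without self-crossings, which are homotopic to $\delta_{a,b}$; and, for each border vertex $a$ and each tag $\epsilon\in\{1,-1\}$, the diagonal $M_{a,a}^{\epsilon}$, drawn as a line from $a$ to the puncture. Two diagonals $M_{a,a}^{\epsilon}$, $M_{c,c}^{\epsilon'}$ cross if and only if $a\neq c$ and $\epsilon\neq\epsilon'$; any other two diagonals cross if and only if any two paths representing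 them intersect in the interior of $\mathcal P_n$, i.e. if and only if the endpoints of some lifts of them separate each other on the boundary of the universal cover (an infinite polygon with vertices the integers, $x$ lying over the border vertex $x \bmod n$, and one vertex over the puncture). A *triangulation* of $\mathcal P_n$ is a maximal set of pairwise non-crossing diagonals. Let $\mathcal T_n$ be the set of all triangulations of $\mathcal P_n$, and let $\sim$ be the equivalence relation on $\mathcal T_n$ generated by rotating a triangulation by any number of steps and by inverting all tags of a triangulation ($M_{a,a}^{\epsilon}\mapsto M_{a,a}^{-\epsilon}$ for all its diagonals of this form). The quiver $Q_\Delta$ of a triangulation $\Delta$ has the diagonals of $\Delta$ as vertices. There is an arrow $\alpha\to\beta$ whenever $\alpha$ and $\beta$ bound a common triangle of $\Delta$ (whose sides are diagonals of $\Delta$ or border edges) in which $\beta$ is obtained from $\alpha$ by rotating anticlockwise about their common vertex; if $\Delta$ contains both $M_{a,a}^{1}$ and $M_{a,a}^{-1}$, then each of these two is regarded separately as the loop at $a$ around the puncture. Finally both arrows of every oriented $2$-cycle are deleted. Then for every quiver $Q_0$ with underlying graph $D_n$, the assignment $\Delta\mapsto Q_\Delta$ induces a well-defined map $$\widetilde\epsilon_n:\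 \mathcal T_n/\!\sim\ \longrightarrow\ \mathcal M_n,$$ and this map is a bijection. In particular $\mathcal M_n$ is finite, and the number $d(n)=|\mathcal M_n|$ equals the number of triangulations of $\mathcal P_n$ up to rotation and inversion of all tags. -/

import Mathlib

/-! ### Quivers and mutation -/

/-- A quiver without loops and without oriented cycles of length two on the vertex set `V`:
`arrows i j` is the number of arrows from `i` to `j`. -/
@[ext]
structure ClusterQuiver (V : Type) where
  arrows : V → V → ℕ
  no_two_cycle : ∀ i j, arrows i j = 0 ∨ arrows j i = 0

namespace ClusterQuiver

/-- Mutation at `k`: arrows at `k` are reversed; every path `i → k → j` contributes an arrow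
`i → j`, and opposite pairs of arrows between `i` and `j` are cancelled. (The truncated subtraction
performs this cancellation.) The new vertex is again called `k`. -/
def mutate {V : Type} [DecidableEq V] (Q : ClusterQuiver V) (k : V) : ClusterQuiver V where
  arrows i j :=
    if i = k ∨ j = k then Q.arrows j i
    else (Q.arrows i j + Q.arrows i k * Q.arrows k j)
      - (Q.arrows j i + Q.arrows j k * Q.arrows k i)
  no_two_cycle i j := by
    by_cases h : i = k ∨ j = k
    · rw [if_pos h, if_pos h.symm]
      exact Q.no_two_cycle j i
    · rw [if_neg h, if_neg (fun h' => h h'.symm)]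
      omega

/-- `Q'` is obtained from `Q` by finitely many mutations. -/
def MutationEquivalent {V : Type} [DecidableEq V] (Q Q' : ClusterQuiver V) : Prop :=
  Relation.ReflTransGen (fun A B : ClusterQuiver V => ∃ k, B = A.mutate k) Q Q'

/-- Isomorphism of quivers, possibly on different vertex sets. -/
def Isomorphic {V W : Type} (Q : ClusterQuiver V) (R : ClusterQuiver W) : Prop :=
  ∃ e : V ≃ W, ∀ i j, R.arrows (e i) (e j) = Q.arrows i j

/-- The isomorphism relation on the class of all quivers. -/
def isoSetoid : Setoid (Σ V : Type, ClusterQuiver V) where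
  r Q R := Q.2.Isomorphic R.2
  iseqv :=
    { refl := fun _ => ⟨Equiv.refl _, fun _ _ => rfl⟩
      symm := by
        rintro Q R ⟨e, he⟩
        exact ⟨e.symm, fun i j => by simpa using (he (e.symm i) (e.symm j)).symm⟩
      trans := by
        rintro Q R S ⟨e, he⟩ ⟨f, hf⟩
        exact ⟨e.trans f, fun i j => by simp [hf, he]⟩ }

/-- Isomorphism classes of quivers. -/
def IsoClass : Type 1 := Quotient isoSetoid

/-- The isomorphism class of a quiver. -/
def isoClass {V : Type} (Q : ClusterQuiver V) : IsoClass := Quotient.mk isoSetoid ⟨V, Q⟩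

/-- The mutation class of `Q`: all quivers obtained from `Q` by repeated mutation,
up to isomorphism. -/
def mutationClass {V : Type} [DecidableEq V] (Q : ClusterQuiver V) : Set IsoClass :=
  {q | ∃ Q' : ClusterQuiver V, Q.MutationEquivalent Q' ∧ q = Q'.isoClass}

/-- `Q` is an orientation of the simple graph `G`. -/
def IsOrientationOf {V : Type} (Q : ClusterQuiver V) (G : SimpleGraph V) : Prop :=
  ∀ i j, (G.Adj i j → Q.arrows i j + Q.arrows j i = 1) ∧ (¬ G.Adj i j → Q.arrows i j = 0)

end ClusterQuiver

/-- The Dynkin diagram `D_n`: a path `0 — 1 — ⋯ — (n-2)` together with an edge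
`(n-3) — (n-1)`. -/
def dynkinD (n : ℕ) : SimpleGraph (Fin n) :=
  SimpleGraph.fromRel fun i j : Fin n =>
    ((i : ℕ) + 1 = j ∧ (j : ℕ) + 1 < n) ∨ ((i : ℕ) + 3 = n ∧ (j : ℕ) + 1 = n)

/-! ### The punctured polygon

The border vertices are labelled counterclockwise by `ZMod n`. The universal cover of the punctured
polygon (with the puncture added) is an infinite polygon whose vertices, in counterclockwise
order, are the integers followed by `⊤`; the integer `x` lies over the border vertex `x mod n`,
the point `⊤` lies over the puncture, and the deck transformations are the translations by multiples
of `n`. A homotopy class of paths is given by the endpoints of its lifts. -/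

/-- The diagonals (tagged edges) of the punctured `n`-gon.

* `arc a b` is the homotopy class `M_{a,b}`, `a ≠ b`, of paths in the interior that are homotopic to
  the counterclockwise border path `δ_{a,b}` from `a` to `b`; this path has at least three vertices,
  i.e. `b ≠ a + 1`.
* `radius a ε` is `M_{a,a}^{±1}`, drawn as a line between `a` and the puncture; it carries a tag iff
  `ε = true`. -/
inductive Diagonal (n : ℕ) : Type
  | arc (a b : ZMod n) (hne : b ≠ a) (hborder : b ≠ a + 1) : Diagonal n
  | radius (a : ZMod n) (ε : Bool) : Diagonal n

namespace Diagonal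

/-- The chord from `x` to `y` in the universal cover is a lift of the diagonal. The arc `M_{a,b}`
lifts to the chords from `x` over `a` to the first point over `b` after `x`; a diagonal between
the puncture and `a` lifts to the chords from `x` over `a` to `⊤`. -/
def IsLift {n : ℕ} : Diagonal n → ℤ → WithTop ℤ → Prop
  | arc a b _ _, x, y =>
      (x : ZMod n) = a ∧ ∃ z : ℤ, y = (z : WithTop ℤ) ∧ (z : ZMod n) = b ∧ x < z ∧ z < x + n
  | radius a _, x, y => (x : ZMod n) = a ∧ y = ⊤

/-- Two chords of the universal cover, from `x` to `y` and from `x'` to `y'`, intersect in the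
interior: their endpoints separate each other. -/
def ChordsCross (x : ℤ) (y : WithTop ℤ) (x' : ℤ) (y' : WithTop ℤ) : Prop :=
  (x < x' ∧ (x' : WithTop ℤ) < y ∧ y < y') ∨ (x' < x ∧ (x : WithTop ℤ) < y' ∧ y' < y)

/-- Two diagonals cross (their crossing number is not zero). Two diagonals at the puncture cross iff
they have different endpoints on the border and different tags. Otherwise the diagonals cross iff
lifts of them cross, i.e. iff any two representing paths intersect in the interior. -/
def Crosses {n : ℕ} : Diagonal n → Diagonal n → Prop
  | radius a ε, radius c ε' => a ≠ c ∧ ε ≠ ε'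
  | d, e => ∃ x y x' y', d.IsLift x y ∧ e.IsLift x' y' ∧ ChordsCross x y x' y'

/-- Rotation of a diagonal by `k` steps. -/
def rotate {n : ℕ} (k : ZMod n) : Diagonal n → Diagonal n
  | arc a b h h' => arc (a + k) (b + k) (fun e => h (add_right_cancel e))
      (fun e => h' (add_right_cancel (e.trans (add_right_comm a k 1))))
  | radius a ε => radius (a + k) ε

/-- Inversion of the tag of a diagonal at the puncture; other diagonals are unchanged. -/
def invert {n : ℕ} : Diagonal n → Diagonal n
  | arc a b h h' => arc a b h h'
  | radius a ε => radius a (!ε)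

theorem rotate_rotate_neg {n : ℕ} (k : ZMod n) (d : Diagonal n) : rotate (-k) (rotate k d) = d := by
  cases d <;> simp [rotate]

theorem invert_invert {n : ℕ} (d : Diagonal n) : invert (invert d) = d := by
  cases d <;> simp [invert]

end Diagonal

/-- A triangulation of the punctured `n`-gon: a maximal set of pairwise non-crossing diagonals. -/
structure Triangulation (n : ℕ) where
  diagonals : Set (Diagonal n)
  maximal : Maximal (fun S : Set (Diagonal n) => S.Pairwise fun d e => ¬ d.Crosses e) diagonals

/-! ### The quiver of a triangulation -/

/-- The chord from `x` to `y` in the universal cover is a lift of the diagonal `d` as it is drawn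
inside the set `Δ`: if `Δ` contains both diagonals between the puncture and `a`, then each of them
is drawn as the loop at `a` around the puncture, which lifts to the chords from `x` to `x + n`. -/
def DrawnAs {n : ℕ} (Δ : Set (Diagonal n)) (d : Diagonal n) (x : ℤ) (y : WithTop ℤ) : Prop :=
  match d with
  | .arc a b h h' => (Diagonal.arc a b h h').IsLift x y
  | .radius a ε =>
      (Diagonal.radius a (!ε) ∉ Δ ∧ (Diagonal.radius a ε).IsLift x y) ∨
      (Diagonal.radius a (!ε) ∈ Δ ∧ (x : ZMod n) = a ∧ y = ((x + n : ℤ) : WithTop ℤ))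

/-- The chord from `x` to `y` lies over a border edge or over a diagonal of `Δ`. -/
def IsSide {n : ℕ} (Δ : Set (Diagonal n)) (x : ℤ) (y : WithTop ℤ) : Prop :=
  y = ((x + 1 : ℤ) : WithTop ℤ) ∨ ∃ d ∈ Δ, DrawnAs Δ d x y

/-- `x`, `y`, `z` are, in counterclockwise order, the vertices of a triangle whose sides lie over
diagonals of `Δ` or border edges. -/
def IsTriangle {n : ℕ} (Δ : Set (Diagonal n)) (x y : ℤ) (z : WithTop ℤ) : Prop :=
  x < y ∧ (y : WithTop ℤ) < z ∧ IsSide Δ x y ∧ IsSide Δ y z ∧ IsSide Δ x z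

/-- `d` and `e` bound a common triangle, in which `e` is obtained from `d` by rotating anticlockwise
about their common vertex. The three cases are the common vertex being `x`, `z` and `y`. -/
def TriangleArrow {n : ℕ} (Δ : Set (Diagonal n)) (d e : Diagonal n) : Prop :=
  ∃ (x y : ℤ) (z : WithTop ℤ), IsTriangle Δ x y z ∧
    ((DrawnAs Δ d x y ∧ DrawnAs Δ e x z) ∨
     (DrawnAs Δ d x z ∧ DrawnAs Δ e y z) ∨
     (DrawnAs Δ d y z ∧ DrawnAs Δ e x y))

namespace Triangulation

open Classical in
/-- The quiver `Q_Δ` of a triangulation. Its vertices are the diagonals of `Δ`; there is an arrow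
`d → e` if `d` and `e` bound a common triangle in which `e` follows `d` anticlockwise, where both
arrows of an oriented cycle of length two are deleted. -/
noncomputable def quiver {n : ℕ} (Δ : Triangulation n) : ClusterQuiver Δ.diagonals where
  arrows d e :=
    if TriangleArrow Δ.diagonals (d : Diagonal n) e ∧ ¬ TriangleArrow Δ.diagonals (e : Diagonal n) d
    then 1 else 0
  no_two_cycle d e := by
    by_cases h : TriangleArrow Δ.diagonals (d : Diagonal n) e
    · right
      rw [if_neg]
      exact fun h' => h'.2 h
    · left
      rw [if_neg]
      exact fun h' => h h'.1

/-- `ε_n(Δ)`: the isomorphism class of the quiver of `Δ`. -/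
noncomputable def epsilon {n : ℕ} (Δ : Triangulation n) : ClusterQuiver.IsoClass :=
  Δ.quiver.isoClass

/-- `Δ'` is obtained from `Δ` by a rotation or by inverting all tags. -/
def RotationOrInversion {n : ℕ} (Δ Δ' : Triangulation n) : Prop :=
  (∃ k : ZMod n, Δ'.diagonals = Diagonal.rotate k '' Δ.diagonals) ∨
    Δ'.diagonals = Diagonal.invert '' Δ.diagonals

/-- The set `𝒯_n / ∼`: triangulations modulo the equivalence relation generated by rotation and by
inversion of all tags. -/
def Classes (n : ℕ) : Type :=
  Quot (RotationOrInversion (n := n))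

end Triangulation

/-! #### The quiver is invariant under rotation and inversion of all tags -/

theorem IsSide.map {n : ℕ} {φ : Diagonal n → Diagonal n} {m : ℤ}
    (hφ : ∀ (Δ : Set (Diagonal n)) d x y, DrawnAs Δ d x y →
      DrawnAs (φ '' Δ) (φ d) (x + m) (y + (m : WithTop ℤ)))
    {Δ : Set (Diagonal n)} {x : ℤ} {y : WithTop ℤ} (h : IsSide Δ x y) :
    IsSide (φ '' Δ) (x + m) (y + (m : WithTop ℤ)) := by
  rcases h with rfl | ⟨d, hd, h⟩
  · left
    rw [← WithTop.coe_add, add_right_comm]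
  · exact Or.inr ⟨φ d, ⟨d, hd, rfl⟩, hφ _ _ _ _ h⟩

theorem TriangleArrow.map {n : ℕ} {φ : Diagonal n → Diagonal n} {m : ℤ}
    (hφ : ∀ (Δ : Set (Diagonal n)) d x y, DrawnAs Δ d x y →
      DrawnAs (φ '' Δ) (φ d) (x + m) (y + (m : WithTop ℤ)))
    {Δ : Set (Diagonal n)} {d e : Diagonal n} (h : TriangleArrow Δ d e) :
    TriangleArrow (φ '' Δ) (φ d) (φ e) := by
  obtain ⟨x, y, z, ⟨hxy, hyz, h1, h2, h3⟩, h⟩ := h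
  refine ⟨x + m, y + m, z + (m : WithTop ℤ),
    ⟨by omega, ?_, h1.map hφ, h2.map hφ, h3.map hφ⟩, ?_⟩
  · induction z using WithTop.recTopCoe with
    | top => exact WithTop.coe_lt_top _
    | coe z => exact_mod_cast add_lt_add_left (WithTop.coe_lt_coe.mp hyz) m
  · rcases h with ⟨a, b⟩ | ⟨a, b⟩ | ⟨a, b⟩
    · exact Or.inl ⟨hφ _ _ _ _ a, hφ _ _ _ _ b⟩
    · exact Or.inr (Or.inl ⟨hφ _ _ _ _ a, hφ _ _ _ _ b⟩)
    · exact Or.inr (Or.inr ⟨hφ _ _ _ _ a, hφ _ _ _ _ b⟩)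

theorem DrawnAs.rotate {n : ℕ} (m : ℤ) (Δ : Set (Diagonal n)) (d : Diagonal n) (x : ℤ)
    (y : WithTop ℤ) (h : DrawnAs Δ d x y) :
    DrawnAs (Diagonal.rotate (m : ZMod n) '' Δ) (Diagonal.rotate (m : ZMod n) d) (x + m)
      (y + (m : WithTop ℤ)) := by
  have key : ∀ (a : ZMod n) (ε : Bool), Diagonal.radius (a + (m : ZMod n)) ε ∈
      Diagonal.rotate (m : ZMod n) '' Δ ↔ Diagonal.radius a ε ∈ Δ := by
    intro a ε
    constructor
    · rintro ⟨d, hd, hd'⟩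
      have := congrArg (Diagonal.rotate (-(m : ZMod n))) hd'
      rw [Diagonal.rotate_rotate_neg] at this
      rw [this] at hd
      simpa [Diagonal.rotate] using hd
    · intro h
      exact ⟨_, h, rfl⟩
  cases d with
  | arc a b h1 h2 =>
    obtain ⟨hx, z, rfl, hz, hxz, hzn⟩ := h
    exact ⟨by push_cast; rw [hx], z + m, by rw [WithTop.coe_add], by push_cast; rw [hz],
      by omega, by omega⟩
  | radius a ε =>
    rcases h with ⟨hn, hx, rfl⟩ | ⟨hn, hx, rfl⟩
    · exact Or.inl ⟨fun h => hn ((key a _).1 h), by push_cast; rw [hx], rfl⟩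
    · exact Or.inr ⟨(key a _).2 hn, by push_cast; rw [hx],
        by rw [← WithTop.coe_add, add_right_comm]⟩

theorem DrawnAs.invert {n : ℕ} (Δ : Set (Diagonal n)) (d : Diagonal n) (x : ℤ)
    (y : WithTop ℤ) (h : DrawnAs Δ d x y) :
    DrawnAs (Diagonal.invert '' Δ) (Diagonal.invert d) (x + 0) (y + ((0 : ℤ) : WithTop ℤ)) := by
  have key : ∀ (a : ZMod n) (ε : Bool), Diagonal.radius a (!ε) ∈
      Diagonal.invert '' Δ ↔ Diagonal.radius a ε ∈ Δ := by
    intro a ε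
    constructor
    · rintro ⟨d, hd, hd'⟩
      have := congrArg Diagonal.invert hd'
      rw [Diagonal.invert_invert] at this
      rw [this] at hd
      simpa [Diagonal.invert] using hd
    · intro h
      exact ⟨_, h, rfl⟩
  rw [add_zero, WithTop.coe_zero, add_zero]
  cases d with
  | arc a b h1 h2 => exact h
  | radius a ε =>
    rcases h with ⟨hn, h⟩ | ⟨hn, h⟩
    · exact Or.inl ⟨fun h => hn ((key a _).1 h), h⟩
    · exact Or.inr ⟨(key a _).2 hn, h⟩

namespace Triangulation

theorem epsilon_eq_of_image {n : ℕ} {Δ Δ' : Triangulation n} {φ ψ : Diagonal n → Diagonal n}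
    (hψφ : ∀ d, ψ (φ d) = d)
    (hφ : ∀ (Δ : Set (Diagonal n)) d e, TriangleArrow Δ d e → TriangleArrow (φ '' Δ) (φ d) (φ e))
    (hψ : ∀ (Δ : Set (Diagonal n)) d e, TriangleArrow Δ d e → TriangleArrow (ψ '' Δ) (ψ d) (ψ e))
    (h : Δ'.diagonals = φ '' Δ.diagonals) : Δ.epsilon = Δ'.epsilon := by
  have hiff : ∀ d e, TriangleArrow Δ'.diagonals (φ d) (φ e) ↔ TriangleArrow Δ.diagonals d e := by
    intro d e
    rw [h]
    refine ⟨fun h' => ?_, hφ _ _ _⟩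
    have := hψ _ _ _ h'
    rw [hψφ, hψφ, Set.image_image] at this
    simpa [hψφ] using this
  have hinj : Function.Injective φ := Function.LeftInverse.injective hψφ
  refine Quotient.sound (s := ClusterQuiver.isoSetoid)
    ⟨(Equiv.Set.image φ Δ.diagonals hinj).trans (Equiv.setCongr h.symm), fun d e => ?_⟩
  classical
  change (if TriangleArrow Δ'.diagonals (φ d) (φ e) ∧ ¬ TriangleArrow Δ'.diagonals (φ e) (φ d)
    then 1 else 0) = _
  simp only [hiff]
  rfl

theorem epsilon_eq_of_rotationOrInversion {n : ℕ} (Δ Δ' : Triangulation n)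
    (h : RotationOrInversion Δ Δ') : Δ.epsilon = Δ'.epsilon := by
  rcases h with ⟨k, h⟩ | h
  · obtain ⟨m, rfl⟩ := ZMod.intCast_surjective k
    refine epsilon_eq_of_image (Diagonal.rotate_rotate_neg (m : ZMod n))
      (fun _ _ _ => TriangleArrow.map (DrawnAs.rotate m)) (fun _ _ _ h => ?_) h
    have := TriangleArrow.map (DrawnAs.rotate (-m)) h
    rwa [Int.cast_neg] at this
  · exact epsilon_eq_of_image Diagonal.invert_invert
      (fun _ _ _ => TriangleArrow.map DrawnAs.invert)
      (fun _ _ _ => TriangleArrow.map DrawnAs.invert) h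

/-- The map induced by `ε_n` on `𝒯_n / ∼`. -/
noncomputable def epsilonTilde (n : ℕ) : Classes n → ClusterQuiver.IsoClass :=
  Quot.lift epsilon epsilon_eq_of_rotationOrInversion

end Triangulation

/-! In the universal cover a diagonal becomes the orbit of a chord under translation by `n`, and
crossing becomes a comparison of endpoints. Two lines with both tags at one vertex become two copies
of a loop of length `n`. Order arguments with non-crossing chords then give the local structure of a
triangulation: every chord bounds at most one triangle on each side, and triangles exist where they
are needed.

The first pillar is that every diagonal has exactly one replacement, and that replacing it mutates
the quiver (`exists_flip`). Away from double lines the diagonal divides a quadrilateral. There the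
arrow count is a finite truth table (`Quad.arrowCount_flip`), once it is known that no arrow inside
the quadrilateral is repeated by another triangle. The remaining flips take place inside a loop
around the puncture (`Monogon.arrowCount_flip`).

The second pillar is that flips can increase the number of border vertices joined to the puncture
until all are joined (`flip_induction`). Such a wheel is determined by its common tag, and its
quiver is an oriented `n`-cycle.

The image is the mutation class for the following reasons. The fan at one vertex has an orientation
of `D_n` as its quiver (`isLabelling_fan`). All orientations are mutation equivalent, by mutations
at sinks and sources (`orient_mutationEquivalent`). Mutations lift to flips, so every quiver of the
class comes from a triangulation. Conversely, any two triangulations are joined by flips through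
wheels, up to an inversion of tags that does not change the quiver (`epsilon_mem_mutationClass`).

Injectivity is proved in a stronger, labelled form: an identification of two quivers is induced by a
symmetry of the punctured polygon (`Rigid`). This form passes back along a flip, because both
triangulations can be flipped at the same label and replacements are unique. For the wheel it
suffices that only wheels have an oriented `n`-cycle as quiver (`isSide_top_of_cycle`). In any other
triangulation there are two lines with the same arrows, or a line without successor, or an oriented
cycle of length 3 or 4, and the last is excluded by `n ≥ 5`. -/

open Diagonal

/-! ### Chords of the universal cover -/

/-- The set of chords `S` is invariant under the deck transformations. -/
def ShiftInvariant (n : ℕ) (S : ℤ → WithTop ℤ → Prop) : Prop :=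
  ∀ (x : ℤ) (y : WithTop ℤ) (k : ℤ), S x y → S (x + k * n) (y + ((k * n : ℤ) : WithTop ℤ))

/-- The chords of `S` do not cross each other. -/
def NonCrossing (S : ℤ → WithTop ℤ → Prop) : Prop :=
  ∀ (x : ℤ) (y : WithTop ℤ) (u : ℤ) (v : WithTop ℤ),
    S x y → S u v → x < u → (u : WithTop ℤ) < y → ¬ y < v

/-- The orbit of a chord under the deck transformations. -/
def ChordOrbit (n : ℕ) (x : ℤ) (y : WithTop ℤ) (u : ℤ) (v : WithTop ℤ) : Prop :=
  ∃ k : ℤ, u = x + k * n ∧ v = y + ((k * n : ℤ) : WithTop ℤ)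

/-- Two families of chords `D` and `E` contain sides of a common triangle with sides in `S`, in
which the side in `E` follows the side in `D` anticlockwise. -/
def ChordArrow (S D E : ℤ → WithTop ℤ → Prop) : Prop :=
  ∃ (x y : ℤ) (z : WithTop ℤ), (x < y ∧ (y : WithTop ℤ) < z ∧ S x y ∧ S y z ∧ S x z) ∧
    ((D x y ∧ E x z) ∨ (D x z ∧ E y z) ∨ (D y z ∧ E x y))

open Classical in
/-- The number of arrows between two families of chords, after deleting oriented two-cycles. -/
noncomputable def arrowCount (S D E : ℤ → WithTop ℤ → Prop) : ℕ :=
  if ChordArrow S D E ∧ ¬ ChordArrow S E D then 1 else 0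

theorem ShiftInvariant.iff {n : ℕ} {S : ℤ → WithTop ℤ → Prop} (h : ShiftInvariant n S)
    (x : ℤ) (y : WithTop ℤ) (k : ℤ) :
    S (x + k * n) (y + ((k * n : ℤ) : WithTop ℤ)) ↔ S x y := by
  refine ⟨fun h' => ?_, h x y k⟩
  have := h _ _ (-k) h'
  rwa [add_assoc, add_assoc, ← WithTop.coe_add, ← add_mul, add_neg_cancel, zero_mul, add_zero,
    WithTop.coe_zero, add_zero] at this

theorem ChordOrbit.self {n : ℕ} (x : ℤ) (y : WithTop ℤ) : ChordOrbit n x y x y := ⟨0, by simp⟩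

theorem ChordOrbit.shiftInvariant {n : ℕ} (x : ℤ) (y : WithTop ℤ) :
    ShiftInvariant n (ChordOrbit n x y) := by
  rintro u v k ⟨l, rfl, rfl⟩
  exact ⟨l + k, by ring, by rw [add_assoc, ← WithTop.coe_add, ← add_mul]⟩

theorem ShiftInvariant.or {n : ℕ} {S S' : ℤ → WithTop ℤ → Prop} (h : ShiftInvariant n S)
    (h' : ShiftInvariant n S') : ShiftInvariant n (fun x y => S x y ∨ S' x y) :=
  fun x y k => Or.imp (h x y k) (h' x y k)

/-- An orbit of chords is the orbit of each of its members. -/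
theorem ChordOrbit.eq {n : ℕ} {x u : ℤ} {y v : WithTop ℤ} (h : ChordOrbit n x y u v) :
    ChordOrbit n x y = ChordOrbit n u v := by
  obtain ⟨k, rfl, rfl⟩ := h
  funext a b
  refine propext ⟨?_, ?_⟩
  · rintro ⟨l, rfl, rfl⟩
    refine ⟨l - k, by ring, ?_⟩
    rw [add_assoc, ← WithTop.coe_add]
    congr 2
    ring
  · rintro ⟨l, rfl, rfl⟩
    refine ⟨l + k, by ring, ?_⟩
    rw [add_assoc, ← WithTop.coe_add]
    congr 2
    ring

/-- The fundamental domain argument: a nonzero multiple of `n` has absolute value at least `n`. -/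
theorem eq_zero_of_mul_lt {n : ℕ} {k : ℤ} (h : k * n < n) (h' : -(n : ℤ) < k * n) : k = 0 := by
  rcases lt_trichotomy k 0 with hk | hk | hk
  · nlinarith
  · exact hk
  · nlinarith

/-! ### Triangles and arrows in a quadrilateral. -/

/-- The sides of a quadrilateral `p < q < r < s` of the universal cover belong to `S`. -/
structure Quad (n : ℕ) (S : ℤ → WithTop ℤ → Prop) (p q r : ℤ) (s : WithTop ℤ) : Prop where
  lt_pq : p < q
  lt_qr : q < r
  lt_rs : (r : WithTop ℤ) < s
  lt_rp : r < p + n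
  pq : S p q
  qr : S q r
  rs : S r s
  ps : S p s

namespace Quad

variable {n : ℕ} {S S₀ : ℤ → WithTop ℤ → Prop} {p q r : ℤ} {s : WithTop ℤ}

theorem shift (h : Quad n S p q r s) (hS : ShiftInvariant n S) (k : ℤ) :
    Quad n S (p + k * n) (q + k * n) (r + k * n) (s + ((k * n : ℤ) : WithTop ℤ)) where
  lt_pq := by linarith [h.lt_pq]
  lt_qr := by linarith [h.lt_qr]
  lt_rs := by
    have := h.lt_rs
    cases s with
    | top => exact WithTop.coe_lt_top _
    | coe s => norm_cast at this ⊢; linarith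
  lt_rp := by linarith [h.lt_rp]
  pq := hS _ _ k h.pq
  qr := hS _ _ k h.qr
  rs := hS _ _ k h.rs
  ps := hS _ _ k h.ps

theorem mono (h : Quad n S₀ p q r s) (hS : ∀ x y, S₀ x y → S x y) : Quad n S p q r s :=
  ⟨h.lt_pq, h.lt_qr, h.lt_rs, h.lt_rp, hS _ _ h.pq, hS _ _ h.qr, hS _ _ h.rs, hS _ _ h.ps⟩

/-- A second triangle below `(p, r)` would have a side crossing `(p, q)` or `(q, r)`. The following
lemmas have the same pattern: in a non-crossing family a chord bounds at most one triangle on each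
side. -/
theorem inner_pr (h : Quad n S p q r s) (hc : NonCrossing S) {y : ℤ} (h1 : p < y) (h2 : y < r)
    (h3 : S p y) (h4 : S y r) : y = q := by
  rcases lt_trichotomy y q with hy | hy | hy
  · exact (hc _ _ _ _ h.pq h4 h1 (mod_cast hy) (mod_cast h.lt_qr)).elim
  · exact hy
  · exact (hc _ _ _ _ h3 h.qr h.lt_pq (mod_cast hy) (mod_cast h2)).elim

theorem outer_pr (h : Quad n S p q r s) (hc : NonCrossing S) {z : WithTop ℤ}
    (h1 : (r : WithTop ℤ) < z) (h3 : S p z) (h4 : S r z) : z = s := by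
  have hpr := h.lt_pq.trans h.lt_qr
  rcases lt_trichotomy z s with hy | hy | hy
  · exact (hc _ _ _ _ h3 h.rs hpr h1 hy).elim
  · exact hy
  · exact (hc _ _ _ _ h.ps h4 hpr h.lt_rs hy).elim

/-- The outer triangle of `(p, r)` has its third vertex beyond `r`. A vertex to the left of `p` is
shielded by `(p, s)`. -/
theorem not_outer_pr (h : Quad n S p q r s) (hc : NonCrossing S) {x : ℤ} (h1 : x < p)
    (h4 : S x r) : False :=
  hc _ _ _ _ h4 h.ps h1 (mod_cast h.lt_pq.trans h.lt_qr) h.lt_rs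

theorem inner_qs (h : Quad n S p q r s) (hc : NonCrossing S) {y : ℤ} (h1 : q < y)
    (h2 : (y : WithTop ℤ) < s) (h3 : S q y) (h4 : S y s) : y = r := by
  rcases lt_trichotomy y r with hy | hy | hy
  · exact (hc _ _ _ _ h.qr h4 h1 (mod_cast hy) h.lt_rs).elim
  · exact hy
  · exact (hc _ _ _ _ h3 h.rs h.lt_qr (mod_cast hy) h2).elim

theorem lt_qs (h : Quad n S p q r s) : (q : WithTop ℤ) < s :=
  lt_trans (mod_cast h.lt_qr) h.lt_rs

theorem outer_qs (h : Quad n S p q r s) (hc : NonCrossing S) {x : ℤ} (h1 : x < q)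
    (h3 : S x q) (h4 : S x s) : x = p := by
  rcases lt_trichotomy x p with hy | hy | hy
  · exact (hc _ _ _ _ h3 h.ps hy (mod_cast h.lt_pq) h.lt_qs).elim
  · exact hy
  · exact (hc _ _ _ _ h.pq h4 hy (mod_cast h1) h.lt_qs).elim

theorem not_outer_qs (h : Quad n S p q r s) (hc : NonCrossing S) {z : WithTop ℤ}
    (h1 : s < z) (h3 : S q z) : False :=
  hc _ _ _ _ h.ps h3 h.lt_pq h.lt_qs h1

/-- The triangles with a side over `(p, r)`. -/
theorem triangle_pr (h : Quad n S p q r s) (hS : ShiftInvariant n S) (hc : NonCrossing S)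
    {x y : ℤ} {z : WithTop ℤ} (hxy : x < y) (hyz : (y : WithTop ℤ) < z) (h1 : S x y) (h2 : S y z)
    (h3 : S x z) :
    (ChordOrbit n p r x z → ∃ k : ℤ, x = p + k * n ∧ y = q + k * n ∧ z = (r + k * n : ℤ)) ∧
    (ChordOrbit n p r x y → ∃ k : ℤ, x = p + k * n ∧ y = r + k * n ∧
      z = s + ((k * n : ℤ) : WithTop ℤ)) ∧
    ¬ ChordOrbit n p r y z := by
  refine ⟨?_, ?_, ?_⟩
  · rintro ⟨k, rfl, rfl⟩
    exact ⟨k, rfl, (h.shift hS k).inner_pr hc hxy (mod_cast hyz) h1 h2, rfl⟩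
  · rintro ⟨k, rfl, hy⟩
    obtain rfl : y = r + k * n := mod_cast hy
    exact ⟨k, rfl, rfl, (h.shift hS k).outer_pr hc hyz h3 h2⟩
  · rintro ⟨k, rfl, rfl⟩
    exact (h.shift hS k).not_outer_pr hc hxy h3

/-- The triangles with a side over `(q, s)`. -/
theorem triangle_qs (h : Quad n S p q r s) (hS : ShiftInvariant n S) (hc : NonCrossing S)
    {x y : ℤ} {z : WithTop ℤ} (hxy : x < y) (hyz : (y : WithTop ℤ) < z) (h1 : S x y) (h2 : S y z)
    (h3 : S x z) :
    (ChordOrbit n q s x z → ∃ k : ℤ, x = q + k * n ∧ y = r + k * n ∧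
      z = s + ((k * n : ℤ) : WithTop ℤ)) ∧
    (ChordOrbit n q s y z → ∃ k : ℤ, x = p + k * n ∧ y = q + k * n ∧
      z = s + ((k * n : ℤ) : WithTop ℤ)) ∧
    ¬ ChordOrbit n q s x y := by
  refine ⟨?_, ?_, ?_⟩
  · rintro ⟨k, rfl, rfl⟩
    exact ⟨k, rfl, (h.shift hS k).inner_qs hc hxy hyz h1 h2, rfl⟩
  · rintro ⟨k, rfl, rfl⟩
    exact ⟨k, (h.shift hS k).outer_qs hc hxy h1 h3, rfl, rfl⟩
  · rintro ⟨k, rfl, hy⟩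
    exact (h.shift hS k).not_outer_qs hc (hy ▸ hyz) h3

/-- The arrows to and from the diagonal `(p, r)`. -/
theorem chordArrow_pr (h : Quad n S p q r s) (hS : ShiftInvariant n S) (hc : NonCrossing S)
    (hpr : S p r) {E : ℤ → WithTop ℤ → Prop} (hE : ShiftInvariant n E) :
    (ChordArrow S E (ChordOrbit n p r) ↔ E p q ∨ E r s) ∧
    (ChordArrow S (ChordOrbit n p r) E ↔ E q r ∨ E p s) := by
  have hpr' := h.lt_pq.trans h.lt_qr
  have hqr : (q : WithTop ℤ) < r := mod_cast h.lt_qr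
  have e1 := fun k => hE.iff p q k
  have e2 := fun k => hE.iff q r k
  have e3 := fun k => hE.iff r s k
  have e4 := fun k => hE.iff p s k
  simp only [← WithTop.coe_add] at e1 e2
  -- In a triangle `x < y < z` the arrows run `(x, y) → (x, z) → (y, z) → (x, y)`. Here the
  -- triangles are the translates of `p < q < r` and `p < r < s`.
  refine ⟨⟨?_, ?_⟩, ⟨?_, ?_⟩⟩
  · rintro ⟨x, y, z, ⟨hxy, hyz, h1, h2, h3⟩, ⟨a, b⟩ | ⟨a, b⟩ | ⟨a, b⟩⟩
    · obtain ⟨k, rfl, rfl, rfl⟩ := (h.triangle_pr hS hc hxy hyz h1 h2 h3).1 b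
      exact Or.inl ((e1 k).1 a)
    · exact ((h.triangle_pr hS hc hxy hyz h1 h2 h3).2.2 b).elim
    · obtain ⟨k, rfl, rfl, rfl⟩ := (h.triangle_pr hS hc hxy hyz h1 h2 h3).2.1 b
      exact Or.inr ((e3 k).1 a)
  · rintro (a | a)
    · exact ⟨p, q, r, ⟨h.lt_pq, hqr, h.pq, h.qr, hpr⟩, Or.inl ⟨a, ChordOrbit.self _ _⟩⟩
    · exact ⟨p, r, s, ⟨hpr', h.lt_rs, hpr, h.rs, h.ps⟩, Or.inr (Or.inr ⟨a, ChordOrbit.self _ _⟩)⟩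
  · rintro ⟨x, y, z, ⟨hxy, hyz, h1, h2, h3⟩, ⟨b, a⟩ | ⟨b, a⟩ | ⟨b, a⟩⟩
    · obtain ⟨k, rfl, rfl, rfl⟩ := (h.triangle_pr hS hc hxy hyz h1 h2 h3).2.1 b
      exact Or.inr ((e4 k).1 a)
    · obtain ⟨k, rfl, rfl, rfl⟩ := (h.triangle_pr hS hc hxy hyz h1 h2 h3).1 b
      exact Or.inl ((e2 k).1 a)
    · exact ((h.triangle_pr hS hc hxy hyz h1 h2 h3).2.2 b).elim
  · rintro (a | a)
    · exact ⟨p, q, r, ⟨h.lt_pq, hqr, h.pq, h.qr, hpr⟩, Or.inr (Or.inl ⟨ChordOrbit.self _ _, a⟩)⟩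
    · exact ⟨p, r, s, ⟨hpr', h.lt_rs, hpr, h.rs, h.ps⟩, Or.inl ⟨ChordOrbit.self _ _, a⟩⟩

/-- The arrows to and from the diagonal `(q, s)`. -/
theorem chordArrow_qs (h : Quad n S p q r s) (hS : ShiftInvariant n S) (hc : NonCrossing S)
    (hqs : S q s) {E : ℤ → WithTop ℤ → Prop} (hE : ShiftInvariant n E) :
    (ChordArrow S E (ChordOrbit n q s) ↔ E q r ∨ E p s) ∧
    (ChordArrow S (ChordOrbit n q s) E ↔ E p q ∨ E r s) := by
  have hqr : (q : WithTop ℤ) < r := mod_cast h.lt_qr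
  have e1 := fun k => hE.iff p q k
  have e2 := fun k => hE.iff q r k
  have e3 := fun k => hE.iff r s k
  have e4 := fun k => hE.iff p s k
  simp only [← WithTop.coe_add] at e1 e2
  refine ⟨⟨?_, ?_⟩, ⟨?_, ?_⟩⟩
  · rintro ⟨x, y, z, ⟨hxy, hyz, h1, h2, h3⟩, ⟨a, b⟩ | ⟨a, b⟩ | ⟨a, b⟩⟩
    · obtain ⟨k, rfl, rfl, rfl⟩ := (h.triangle_qs hS hc hxy hyz h1 h2 h3).1 b
      exact Or.inl ((e2 k).1 a)
    · obtain ⟨k, rfl, rfl, rfl⟩ := (h.triangle_qs hS hc hxy hyz h1 h2 h3).2.1 b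
      exact Or.inr ((e4 k).1 a)
    · exact ((h.triangle_qs hS hc hxy hyz h1 h2 h3).2.2 b).elim
  · rintro (a | a)
    · exact ⟨q, r, s, ⟨h.lt_qr, h.lt_rs, h.qr, h.rs, hqs⟩, Or.inl ⟨a, ChordOrbit.self _ _⟩⟩
    · exact ⟨p, q, s, ⟨h.lt_pq, h.lt_qs, h.pq, hqs, h.ps⟩, Or.inr (Or.inl ⟨a, ChordOrbit.self _ _⟩)⟩
  · rintro ⟨x, y, z, ⟨hxy, hyz, h1, h2, h3⟩, ⟨b, a⟩ | ⟨b, a⟩ | ⟨b, a⟩⟩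
    · exact ((h.triangle_qs hS hc hxy hyz h1 h2 h3).2.2 b).elim
    · obtain ⟨k, rfl, rfl, rfl⟩ := (h.triangle_qs hS hc hxy hyz h1 h2 h3).1 b
      exact Or.inr ((e3 k).1 a)
    · obtain ⟨k, rfl, rfl, rfl⟩ := (h.triangle_qs hS hc hxy hyz h1 h2 h3).2.1 b
      exact Or.inl ((e1 k).1 a)
  · rintro (a | a)
    · exact ⟨p, q, s, ⟨h.lt_pq, h.lt_qs, h.pq, hqs, h.ps⟩, Or.inr (Or.inr ⟨ChordOrbit.self _ _, a⟩)⟩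
    · exact ⟨q, r, s, ⟨h.lt_qr, h.lt_rs, h.qr, h.rs, hqs⟩, Or.inr (Or.inl ⟨ChordOrbit.self _ _, a⟩)⟩

/-- The arrows between the other diagonals, when the quadrilateral is divided by `(p, r)`. -/
theorem chordArrow_or_pr (h : Quad n S₀ p q r s) (hS₀ : ShiftInvariant n S₀)
    (hc : NonCrossing fun x y => S₀ x y ∨ ChordOrbit n p r x y)
    {E F : ℤ → WithTop ℤ → Prop} (hE : ShiftInvariant n E) (hF : ShiftInvariant n F)
    (hES : ∀ x y, E x y → S₀ x y) (hFS : ∀ x y, F x y → S₀ x y) :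
    ChordArrow (fun x y => S₀ x y ∨ ChordOrbit n p r x y) E F ↔
      ChordArrow S₀ E F ∨ (E q r ∧ F p q) ∨ (E p s ∧ F r s) := by
  have hpr' := h.lt_pq.trans h.lt_qr
  have hqr : (q : WithTop ℤ) < r := mod_cast h.lt_qr
  have h' : Quad n (fun x y => S₀ x y ∨ ChordOrbit n p r x y) p q r s := h.mono fun x y => Or.inl
  have hS := hS₀.or (ChordOrbit.shiftInvariant (n := n) p r)
  have hpr : S₀ p r ∨ ChordOrbit n p r p r := Or.inr (ChordOrbit.self _ _)
  have e1 := fun k => hF.iff p q k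
  have e2 := fun k => hE.iff q r k
  have e3 := fun k => hF.iff r s k
  have e4 := fun k => hE.iff p s k
  simp only [← WithTop.coe_add] at e1 e2
  -- Two sides of the triangle lie in `S₀` through `E` and `F`. If the third one is new, the
  -- triangle is a half of the quadrilateral; otherwise it already has all its sides in `S₀`.
  constructor
  · rintro ⟨x, y, z, ⟨hxy, hyz, h1, h2, h3⟩, ⟨a, b⟩ | ⟨a, b⟩ | ⟨a, b⟩⟩
    · rcases h2 with h2 | h2
      · exact Or.inl ⟨x, y, z, ⟨hxy, hyz, hES _ _ a, h2, hFS _ _ b⟩, Or.inl ⟨a, b⟩⟩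
      · exact ((h'.triangle_pr hS hc hxy hyz h1 (Or.inr h2) h3).2.2 h2).elim
    · rcases h1 with h1 | h1
      · exact Or.inl ⟨x, y, z, ⟨hxy, hyz, h1, hFS _ _ b, hES _ _ a⟩, Or.inr (Or.inl ⟨a, b⟩)⟩
      · obtain ⟨k, rfl, rfl, rfl⟩ := (h'.triangle_pr hS hc hxy hyz (Or.inr h1) h2 h3).2.1 h1
        exact Or.inr (Or.inr ⟨(e4 k).1 a, (e3 k).1 b⟩)
    · rcases h3 with h3 | h3
      · exact Or.inl ⟨x, y, z, ⟨hxy, hyz, hFS _ _ b, hES _ _ a, h3⟩, Or.inr (Or.inr ⟨a, b⟩)⟩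
      · obtain ⟨k, rfl, rfl, rfl⟩ := (h'.triangle_pr hS hc hxy hyz h1 h2 (Or.inr h3)).1 h3
        exact Or.inr (Or.inl ⟨(e2 k).1 a, (e1 k).1 b⟩)
  · rintro (⟨x, y, z, ⟨hxy, hyz, h1, h2, h3⟩, a⟩ | ⟨a, b⟩ | ⟨a, b⟩)
    · exact ⟨x, y, z, ⟨hxy, hyz, Or.inl h1, Or.inl h2, Or.inl h3⟩, a⟩
    · exact ⟨p, q, r, ⟨h.lt_pq, hqr, h'.pq, h'.qr, hpr⟩, Or.inr (Or.inr ⟨a, b⟩)⟩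
    · exact ⟨p, r, s, ⟨hpr', h.lt_rs, hpr, h'.rs, h'.ps⟩, Or.inr (Or.inl ⟨a, b⟩)⟩

/-- The arrows between the other diagonals, when the quadrilateral is divided by `(q, s)`. -/
theorem chordArrow_or_qs (h : Quad n S₀ p q r s) (hS₀ : ShiftInvariant n S₀)
    (hc : NonCrossing fun x y => S₀ x y ∨ ChordOrbit n q s x y)
    {E F : ℤ → WithTop ℤ → Prop} (hE : ShiftInvariant n E) (hF : ShiftInvariant n F)
    (hES : ∀ x y, E x y → S₀ x y) (hFS : ∀ x y, F x y → S₀ x y) :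
    ChordArrow (fun x y => S₀ x y ∨ ChordOrbit n q s x y) E F ↔
      ChordArrow S₀ E F ∨ (E p q ∧ F p s) ∨ (E r s ∧ F q r) := by
  have hqr : (q : WithTop ℤ) < r := mod_cast h.lt_qr
  have h' : Quad n (fun x y => S₀ x y ∨ ChordOrbit n q s x y) p q r s := h.mono fun x y => Or.inl
  have hS := hS₀.or (ChordOrbit.shiftInvariant (n := n) q s)
  have hqs : S₀ q s ∨ ChordOrbit n q s q s := Or.inr (ChordOrbit.self _ _)
  have e1 := fun k => hE.iff p q k
  have e2 := fun k => hF.iff q r k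
  have e3 := fun k => hE.iff r s k
  have e4 := fun k => hF.iff p s k
  simp only [← WithTop.coe_add] at e1 e2
  constructor
  · rintro ⟨x, y, z, ⟨hxy, hyz, h1, h2, h3⟩, ⟨a, b⟩ | ⟨a, b⟩ | ⟨a, b⟩⟩
    · rcases h2 with h2 | h2
      · exact Or.inl ⟨x, y, z, ⟨hxy, hyz, hES _ _ a, h2, hFS _ _ b⟩, Or.inl ⟨a, b⟩⟩
      · obtain ⟨k, rfl, rfl, rfl⟩ := (h'.triangle_qs hS hc hxy hyz h1 (Or.inr h2) h3).2.1 h2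
        exact Or.inr (Or.inl ⟨(e1 k).1 a, (e4 k).1 b⟩)
    · rcases h1 with h1 | h1
      · exact Or.inl ⟨x, y, z, ⟨hxy, hyz, h1, hFS _ _ b, hES _ _ a⟩, Or.inr (Or.inl ⟨a, b⟩)⟩
      · exact ((h'.triangle_qs hS hc hxy hyz (Or.inr h1) h2 h3).2.2 h1).elim
    · rcases h3 with h3 | h3
      · exact Or.inl ⟨x, y, z, ⟨hxy, hyz, hFS _ _ b, hES _ _ a, h3⟩, Or.inr (Or.inr ⟨a, b⟩)⟩
      · obtain ⟨k, rfl, rfl, rfl⟩ := (h'.triangle_qs hS hc hxy hyz h1 h2 (Or.inr h3)).1 h3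
        exact Or.inr (Or.inr ⟨(e3 k).1 a, (e2 k).1 b⟩)
  · rintro (⟨x, y, z, ⟨hxy, hyz, h1, h2, h3⟩, a⟩ | ⟨a, b⟩ | ⟨a, b⟩)
    · exact ⟨x, y, z, ⟨hxy, hyz, Or.inl h1, Or.inl h2, Or.inl h3⟩, a⟩
    · exact ⟨p, q, s, ⟨h.lt_pq, h.lt_qs, h'.pq, hqs, h'.ps⟩, Or.inl ⟨a, b⟩⟩
    · exact ⟨q, r, s, ⟨h.lt_qr, h.lt_rs, h'.qr, h'.rs, hqs⟩, Or.inr (Or.inr ⟨a, b⟩)⟩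

end Quad

/-! ### Families that consist of one orbit of chords. -/

theorem ChordOrbit.exists_shift {n : ℕ} {a x u : ℤ} {b y v : WithTop ℤ}
    (h : ChordOrbit n a b x y) (h' : ChordOrbit n a b u v) :
    ∃ k : ℤ, u = x + k * n ∧ v = y + ((k * n : ℤ) : WithTop ℤ) := by
  rw [h.eq] at h'
  exact h'

/-- The family of chords `E` is an orbit under the deck transformations. -/
def IsChordOrbit (n : ℕ) (E : ℤ → WithTop ℤ → Prop) : Prop := ∃ x y, E = ChordOrbit n x y

namespace IsChordOrbit

variable {n : ℕ} {E : ℤ → WithTop ℤ → Prop}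

theorem shiftInvariant (h : IsChordOrbit n E) : ShiftInvariant n E := by
  obtain ⟨x, y, rfl⟩ := h
  exact ChordOrbit.shiftInvariant x y

theorem exists_shift (h : IsChordOrbit n E) {x u : ℤ} {y v : WithTop ℤ} (h1 : E x y)
    (h2 : E u v) : ∃ k : ℤ, u = x + k * n ∧ v = y + ((k * n : ℤ) : WithTop ℤ) := by
  obtain ⟨a, b, rfl⟩ := h
  exact h1.exists_shift h2

/-- Two chords of the orbit whose starting points differ by less than `n` are equal. -/
theorem eq_of_lt (h : IsChordOrbit n E) {x u : ℤ} {y v : WithTop ℤ} (h1 : E x y)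
    (h2 : E u v) (h3 : u < x + n) (h4 : x < u + n) : u = x ∧ v = y := by
  obtain ⟨k, rfl, rfl⟩ := h.exists_shift h1 h2
  obtain rfl : k = 0 := eq_zero_of_mul_lt (by linarith) (by linarith)
  simp

end IsChordOrbit

/-! ### The mutation rule for a flip in a quadrilateral. -/

/-- The chords of `S` have length at most `n`. -/
def ShortChords (n : ℕ) (S : ℤ → WithTop ℤ → Prop) : Prop :=
  ∀ x z : ℤ, S x z → z ≤ x + n

open Classical in
theorem arrowCount_congr {S D E : ℤ → WithTop ℤ → Prop} {P Q : Prop} (h : ChordArrow S D E ↔ P)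
    (h' : ChordArrow S E D ↔ Q) : arrowCount S D E = if P ∧ ¬ Q then 1 else 0 := by
  unfold arrowCount
  simp only [h, h']

theorem exactly_one_or_none {a b c d : Prop} (e1 : ¬ (a ∧ b)) (e2 : ¬ (a ∧ c)) (e3 : ¬ (a ∧ d))
    (e4 : ¬ (b ∧ c)) (e5 : ¬ (b ∧ d)) (e6 : ¬ (c ∧ d)) :
    (a ∧ ¬ b ∧ ¬ c ∧ ¬ d) ∨ (b ∧ ¬ a ∧ ¬ c ∧ ¬ d) ∨ (c ∧ ¬ a ∧ ¬ b ∧ ¬ d) ∨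
      (d ∧ ¬ a ∧ ¬ b ∧ ¬ c) ∨ (¬ a ∧ ¬ b ∧ ¬ c ∧ ¬ d) := by
  by_cases a <;> by_cases b <;> by_cases c <;> by_cases d <;> simp_all

open Classical in
/-- The truth table behind the mutation rule for a flip in a quadrilateral: `u` and `v` are the
positions of two diagonals among its sides, `X` and `Y` indicate arrows between them in other
triangles. -/
theorem flip_count {X Y u1 u2 u3 u4 v1 v2 v3 v4 : Prop}
    (e1 : ¬ (u1 ∧ u2)) (e2 : ¬ (u1 ∧ u3)) (e3 : ¬ (u1 ∧ u4))
    (e4 : ¬ (u2 ∧ u3)) (e5 : ¬ (u2 ∧ u4)) (e6 : ¬ (u3 ∧ u4))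
    (f1 : ¬ (v1 ∧ v2)) (f2 : ¬ (v1 ∧ v3)) (f3 : ¬ (v1 ∧ v4))
    (f4 : ¬ (v2 ∧ v3)) (f5 : ¬ (v2 ∧ v4)) (f6 : ¬ (v3 ∧ v4))
    (d1 : u2 → v1 → ¬ X) (d2 : v2 → u1 → ¬ Y) (d3 : u4 → v3 → ¬ X) (d4 : v4 → u3 → ¬ Y)
    (d5 : u1 → v4 → ¬ X) (d6 : v1 → u4 → ¬ Y) (d7 : u3 → v2 → ¬ X) (d8 : v3 → u2 → ¬ Y) :
    (if (X ∨ (u1 ∧ v4) ∨ (u3 ∧ v2)) ∧ ¬ (Y ∨ (v1 ∧ u4) ∨ (v3 ∧ u2)) then 1 else 0) =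
    ((if (X ∨ (u2 ∧ v1) ∨ (u4 ∧ v3)) ∧ ¬ (Y ∨ (v2 ∧ u1) ∨ (v4 ∧ u3)) then 1 else 0) +
      (if (u1 ∨ u3) ∧ ¬ (u2 ∨ u4) then 1 else 0) * (if (v2 ∨ v4) ∧ ¬ (v1 ∨ v3) then 1 else 0)) -
    ((if (Y ∨ (v2 ∧ u1) ∨ (v4 ∧ u3)) ∧ ¬ (X ∨ (u2 ∧ v1) ∨ (u4 ∧ v3)) then 1 else 0) +
      (if (v1 ∨ v3) ∧ ¬ (v2 ∨ v4) then 1 else 0) * (if (u2 ∨ u4) ∧ ¬ (u1 ∨ u3) then 1 else 0)) := by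
  -- Each of the two diagonals is one of the four sides or none of them, which makes 25 positions.
  -- The hypotheses `d1` to `d8` exclude arrows that would have to be counted twice; arrows in the
  -- opposite direction may occur and cancel.
  rcases exactly_one_or_none e1 e2 e3 e4 e5 e6 with
    ⟨g1, g2, g3, g4⟩ | ⟨g1, g2, g3, g4⟩ | ⟨g1, g2, g3, g4⟩ | ⟨g1, g2, g3, g4⟩ | ⟨g1, g2, g3, g4⟩ <;>
  rcases exactly_one_or_none f1 f2 f3 f4 f5 f6 with
    ⟨k1, k2, k3, k4⟩ | ⟨k1, k2, k3, k4⟩ | ⟨k1, k2, k3, k4⟩ | ⟨k1, k2, k3, k4⟩ | ⟨k1, k2, k3, k4⟩ <;>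
  simp only [g1, g2, g3, g4, k1, k2, k3, k4, true_imp_iff, false_imp_iff] at d1 d2 d3 d4 d5 d6 d7 d8 <;>
  by_cases hX : X <;> by_cases hY : Y <;>
  simp [g1, g2, g3, g4, k1, k2, k3, k4, hX, hY] at d1 d2 d3 d4 d5 d6 d7 d8 ⊢

namespace Quad

variable {n : ℕ} {S₀ : ℤ → WithTop ℤ → Prop} {p q r : ℤ} {s : WithTop ℤ}

/-- `ChordArrow` is only a truth value, so an arrow inside the quadrilateral must not be repeated by
a triangle elsewhere. A triangle with this arrow is a translate of `p < q < r` and has a side over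
`(p, r)`, which is not in `S₀`. The other positions of the two sides contradict `r < p + n`. -/
theorem not_chordArrow_qr_pq (h : Quad n S₀ p q r s) (hS : ShiftInvariant n S₀)
    (hpr : ¬ S₀ p r) {E F : ℤ → WithTop ℤ → Prop} (hE : IsChordOrbit n E) (hF : IsChordOrbit n F)
    (hE' : E q r) (hF' : F p q) : ¬ ChordArrow S₀ E F := by
  have h1 := h.lt_pq
  have h2 := h.lt_qr
  have h3 := h.lt_rp
  rintro ⟨x, y, z, ⟨hxy, hyz, -, -, hxz⟩, ⟨a, b⟩ | ⟨a, b⟩ | ⟨a, b⟩⟩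
  · obtain ⟨k, rfl, -⟩ := hE.exists_shift hE' a
    obtain ⟨l, hl, -⟩ := hF.exists_shift hF' b
    have := eq_zero_of_mul_lt (n := n) (k := l - k) (by linarith) (by linarith)
    obtain rfl : l = k := by linarith
    linarith
  · obtain ⟨k, -, rfl⟩ := hE.exists_shift hE' a
    obtain ⟨l, -, hl⟩ := hF.exists_shift hF' b
    norm_cast at hl
    have := eq_zero_of_mul_lt (n := n) (k := l - k) (by linarith) (by linarith)
    obtain rfl : l = k := by linarith
    linarith
  · obtain ⟨k, hk, rfl⟩ := hE.exists_shift hE' a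
    obtain ⟨l, rfl, hl⟩ := hF.exists_shift hF' b
    norm_cast at hl
    have := eq_zero_of_mul_lt (n := n) (k := l - k) (by linarith) (by linarith)
    obtain rfl : l = k := by linarith
    exact hpr ((hS.iff _ _ l).1 hxz)

/-- The same question for the arrow in the other half. Since `s` may equal `p + n`, the endpoints
alone do not exclude a triangle that wraps around the puncture; the bound on the length of its
longest side does. -/
theorem not_chordArrow_ps_rs (h : Quad n S₀ p q r s) (hS : ShiftInvariant n S₀)
    (hlen : ShortChords n S₀)
    (hpr : ¬ S₀ p r) {E F : ℤ → WithTop ℤ → Prop} (hE : IsChordOrbit n E) (hF : IsChordOrbit n F)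
    (hE' : E p s) (hF' : F r s) : ¬ ChordArrow S₀ E F := by
  have h1 := h.lt_pq
  have h2 := h.lt_qr
  have h3 := h.lt_rp
  have h4 := h.lt_rs
  have h5 := h.ps
  rintro ⟨x, y, z, ⟨hxy, hyz, hxy', -, hxz⟩, ⟨a, b⟩ | ⟨a, b⟩ | ⟨a, b⟩⟩
  · obtain ⟨k, rfl, -⟩ := hE.exists_shift hE' a
    obtain ⟨l, hl, -⟩ := hF.exists_shift hF' b
    have := eq_zero_of_mul_lt (n := n) (k := l - k) (by linarith) (by linarith)
    obtain rfl : l = k := by linarith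
    linarith
  · obtain ⟨k, rfl, rfl⟩ := hE.exists_shift hE' a
    obtain ⟨l, rfl, -⟩ := hF.exists_shift hF' b
    have := hlen _ _ hxy'
    have := eq_zero_of_mul_lt (n := n) (k := l - k) (by linarith) (by linarith)
    obtain rfl : l = k := by linarith
    exact hpr ((hS.iff _ _ l).1 (mod_cast hxy'))
  · obtain ⟨k, rfl, rfl⟩ := hE.exists_shift hE' a
    obtain ⟨l, rfl, hl⟩ := hF.exists_shift hF' b
    cases s with
    | top =>
      rw [WithTop.top_add] at hl
      exact (WithTop.coe_ne_top hl).elim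
    | coe s =>
      norm_cast at *
      have := hlen _ _ h5
      have := hlen _ _ hxz
      have := eq_zero_of_mul_lt (n := n) (k := k - l - 1) (by linarith) (by linarith)
      obtain rfl : k = l + 1 := by linarith
      linarith

theorem not_chordArrow_pq_ps (h : Quad n S₀ p q r s) (hS : ShiftInvariant n S₀)
    (hlen : ShortChords n S₀)
    (hqs : ¬ S₀ q s) {E F : ℤ → WithTop ℤ → Prop} (hE : IsChordOrbit n E) (hF : IsChordOrbit n F)
    (hE' : E p q) (hF' : F p s) : ¬ ChordArrow S₀ E F := by
  have h1 := h.lt_pq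
  have h2 := h.lt_qr
  have h3 := h.lt_rp
  have h4 := h.lt_rs
  have h5 := h.ps
  rintro ⟨x, y, z, ⟨hxy, hyz, -, hyz', hxz⟩, ⟨a, b⟩ | ⟨a, b⟩ | ⟨a, b⟩⟩
  · obtain ⟨k, rfl, hk⟩ := hE.exists_shift hE' a
    obtain ⟨l, hl, rfl⟩ := hF.exists_shift hF' b
    norm_cast at hk
    have := eq_zero_of_mul_lt (n := n) (k := l - k) (by linarith) (by linarith)
    obtain rfl : l = k := by linarith
    subst hk
    exact hqs ((hS.iff _ _ l).1 hyz')
  · obtain ⟨k, rfl, rfl⟩ := hE.exists_shift hE' a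
    obtain ⟨l, rfl, hl⟩ := hF.exists_shift hF' b
    cases s with
    | top =>
      rw [WithTop.top_add] at hl
      exact (WithTop.coe_ne_top hl).elim
    | coe s =>
      norm_cast at *
      have := hlen _ _ h5
      have := eq_zero_of_mul_lt (n := n) (k := k - l) (by linarith) (by linarith)
      obtain rfl : k = l := by linarith
      linarith
  · obtain ⟨k, rfl, rfl⟩ := hE.exists_shift hE' a
    obtain ⟨l, rfl, hl⟩ := hF.exists_shift hF' b
    cases s with
    | top =>
      rw [WithTop.top_add] at hl
      exact (WithTop.coe_ne_top hl).elim
    | coe s =>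
      norm_cast at *
      have := hlen _ _ h5
      have := hlen _ _ hxz
      have := eq_zero_of_mul_lt (n := n) (k := k - l - 1) (by linarith) (by linarith)
      obtain rfl : k = l + 1 := by linarith
      linarith

theorem not_chordArrow_rs_qr (h : Quad n S₀ p q r s) (hS : ShiftInvariant n S₀)
    (hlen : ShortChords n S₀)
    (hqs : ¬ S₀ q s) {E F : ℤ → WithTop ℤ → Prop} (hE : IsChordOrbit n E) (hF : IsChordOrbit n F)
    (hE' : E r s) (hF' : F q r) : ¬ ChordArrow S₀ E F := by
  have h1 := h.lt_pq
  have h2 := h.lt_qr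
  have h3 := h.lt_rp
  have h4 := h.lt_rs
  have h5 := h.ps
  rintro ⟨x, y, z, ⟨hxy, hyz, -, hyz', hxz⟩, ⟨a, b⟩ | ⟨a, b⟩ | ⟨a, b⟩⟩
  · obtain ⟨k, rfl, -⟩ := hE.exists_shift hE' a
    obtain ⟨l, hl, -⟩ := hF.exists_shift hF' b
    have := eq_zero_of_mul_lt (n := n) (k := l - k) (by linarith) (by linarith)
    obtain rfl : l = k := by linarith
    linarith
  · obtain ⟨k, rfl, rfl⟩ := hE.exists_shift hE' a
    obtain ⟨l, rfl, hl⟩ := hF.exists_shift hF' b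
    cases s with
    | top =>
      rw [WithTop.top_add] at hl
      exact (WithTop.top_ne_coe hl).elim
    | coe s =>
      norm_cast at *
      have := hlen _ _ h5
      have := eq_zero_of_mul_lt (n := n) (k := k - l) (by linarith) (by linarith)
      obtain rfl : k = l := by linarith
      linarith
  · obtain ⟨k, rfl, rfl⟩ := hE.exists_shift hE' a
    obtain ⟨l, rfl, hl⟩ := hF.exists_shift hF' b
    norm_cast at hl
    have := eq_zero_of_mul_lt (n := n) (k := l - k) (by linarith) (by linarith)
    obtain rfl : l = k := by linarith
    exact hqs ((hS.iff _ _ l).1 hxz)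

/-- An orbit of chords contains at most one side of the quadrilateral. -/
theorem exclusive (h : Quad n S₀ p q r s) {E : ℤ → WithTop ℤ → Prop} (hE : IsChordOrbit n E) :
    ¬ (E p q ∧ E q r) ∧ ¬ (E p q ∧ E r s) ∧ ¬ (E p q ∧ E p s) ∧ ¬ (E q r ∧ E r s) ∧
      ¬ (E q r ∧ E p s) ∧ ¬ (E r s ∧ E p s) := by
  have h1 := h.lt_pq
  have h2 := h.lt_qr
  have h3 := h.lt_rp
  refine ⟨?_, ?_, ?_, ?_, ?_, ?_⟩ <;> rintro ⟨a, b⟩ <;>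
    have := hE.eq_of_lt a b (by omega) (by omega)
  · omega
  · omega
  · have h4 := h.lt_qs
    rw [this.2] at h4
    exact lt_irrefl _ h4
  · omega
  · omega
  · omega

/-- A flip in a quadrilateral mutates the arrows. -/
theorem arrowCount_flip (h : Quad n S₀ p q r s) (hS₀ : ShiftInvariant n S₀)
    (hlen : ShortChords n S₀)
    (hpr : ¬ S₀ p r) (hqs : ¬ S₀ q s)
    (hc : NonCrossing fun x y => S₀ x y ∨ ChordOrbit n p r x y)
    (hc' : NonCrossing fun x y => S₀ x y ∨ ChordOrbit n q s x y)
    {E F : ℤ → WithTop ℤ → Prop} (hE : IsChordOrbit n E) (hF : IsChordOrbit n F)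
    (hES : ∀ x y, E x y → S₀ x y) (hFS : ∀ x y, F x y → S₀ x y)
    {S S' D D' : ℤ → WithTop ℤ → Prop} (hS : S = fun x y => S₀ x y ∨ ChordOrbit n p r x y)
    (hS' : S' = fun x y => S₀ x y ∨ ChordOrbit n q s x y) (hD : D = ChordOrbit n p r)
    (hD' : D' = ChordOrbit n q s) :
    arrowCount S' D' E = arrowCount S E D ∧ arrowCount S' E D' = arrowCount S D E ∧
    arrowCount S' E F = (arrowCount S E F + arrowCount S E D * arrowCount S D F)
      - (arrowCount S F E + arrowCount S F D * arrowCount S D E) := by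
  have hES' := hE.shiftInvariant
  have hFS' := hF.shiftInvariant
  have hs := hS₀.or (ChordOrbit.shiftInvariant (n := n) p r)
  have hs' := hS₀.or (ChordOrbit.shiftInvariant (n := n) q s)
  rw [← hS] at hs hc
  rw [← hS'] at hs' hc'
  have hm : ∀ x y, S₀ x y → S x y := fun x y h => by rw [hS]; exact Or.inl h
  have hm' : ∀ x y, S₀ x y → S' x y := fun x y h => by rw [hS']; exact Or.inl h
  have hprS : S p r := by rw [hS]; exact Or.inr (ChordOrbit.self _ _)
  have hqsS : S' q s := by rw [hS']; exact Or.inr (ChordOrbit.self _ _)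
  obtain ⟨a1, a2⟩ := (h.mono hm).chordArrow_pr hs hc hprS hES'
  obtain ⟨a3, a4⟩ := (h.mono hm).chordArrow_pr hs hc hprS hFS'
  obtain ⟨b1, b2⟩ := (h.mono hm').chordArrow_qs hs' hc' hqsS hES'
  rw [hS] at hc
  rw [hS'] at hc'
  have c1 := h.chordArrow_or_pr hS₀ hc hES' hFS' hES hFS
  have c2 := h.chordArrow_or_pr hS₀ hc hFS' hES' hFS hES
  have c3 := h.chordArrow_or_qs hS₀ hc' hES' hFS' hES hFS
  have c4 := h.chordArrow_or_qs hS₀ hc' hFS' hES' hFS hES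
  rw [← hS] at c1 c2
  rw [← hS'] at c3 c4
  have d1 := h.not_chordArrow_qr_pq hS₀ hpr hE hF
  have d2 := h.not_chordArrow_qr_pq hS₀ hpr hF hE
  have d3 := h.not_chordArrow_ps_rs hS₀ hlen hpr hE hF
  have d4 := h.not_chordArrow_ps_rs hS₀ hlen hpr hF hE
  have d5 := h.not_chordArrow_pq_ps hS₀ hlen hqs hE hF
  have d6 := h.not_chordArrow_pq_ps hS₀ hlen hqs hF hE
  have d7 := h.not_chordArrow_rs_qr hS₀ hlen hqs hE hF
  have d8 := h.not_chordArrow_rs_qr hS₀ hlen hqs hF hE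
  obtain ⟨e1, e2, e3, e4, e5, e6⟩ := h.exclusive hE
  obtain ⟨f1, f2, f3, f4, f5, f6⟩ := h.exclusive hF
  rw [hD, hD']
  rw [arrowCount_congr b2 b1, arrowCount_congr a1 a2, arrowCount_congr b1 b2, arrowCount_congr a2 a1,
    arrowCount_congr c3 c4, arrowCount_congr c1 c2, arrowCount_congr c2 c1, arrowCount_congr a4 a3,
    arrowCount_congr a3 a4]
  refine ⟨rfl, rfl, ?_⟩
  -- From here on only truth values matter: which sides of the quadrilateral `E` and `F` contain,
  -- and which arrows `S₀` already has between them.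
  clear a1 a2 a3 a4 b1 b2 c1 c2 c3 c4 hc hc' hm hm' hs hs' hES hFS hES' hFS'
  generalize ChordArrow S₀ E F = X at *
  generalize ChordArrow S₀ F E = Y at *
  generalize E p q = u1 at *
  generalize E q r = u2 at *
  generalize E r s = u3 at *
  generalize E p s = u4 at *
  generalize F p q = v1 at *
  generalize F q r = v2 at *
  generalize F r s = v3 at *
  generalize F p s = v4 at *
  convert flip_count e1 e2 e3 e4 e5 e6 f1 f2 f3 f4 f5 f6 d1 d2 d3 d4 d5 d6 d7 d8

end Quad

theorem arrowCount_self (S D : ℤ → WithTop ℤ → Prop) : arrowCount S D D = 0 := by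
  unfold arrowCount
  rw [if_neg]
  exact fun h => h.2 h.1

theorem arrowCount_eq_zero {S D E : ℤ → WithTop ℤ → Prop} (h : ChordArrow S E D) :
    arrowCount S D E = 0 := by
  unfold arrowCount
  rw [if_neg]
  exact fun h' => h'.2 h

theorem arrowCount_eq_zero_or (S D E : ℤ → WithTop ℤ → Prop) :
    arrowCount S D E = 0 ∨ arrowCount S E D = 0 := by
  by_cases h : ChordArrow S D E
  · exact Or.inr (arrowCount_eq_zero h)
  · left
    unfold arrowCount
    rw [if_neg]
    exact fun h' => h h'.1

/-! ### The mutation rule for a flip inside a loop. -/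

/-- The loop from `a` to `a + n` around the puncture and the inner triangle `a < y < a + n` with
the other two sides in `S`, all of whose chords are shorter than the loop. -/
structure Monogon (n : ℕ) (S : ℤ → WithTop ℤ → Prop) (a y : ℤ) : Prop where
  lt_ay : a < y
  lt_ya : y < a + n
  short : ∀ x v, S x v → ∃ z : ℤ, v = z ∧ x < z ∧ z < x + n
  ay : S a y
  ya : S y (a + n : ℤ)

namespace Monogon

variable {n : ℕ} {S₀ : ℤ → WithTop ℤ → Prop} {a y : ℤ}

/-- The triangles with a side over the loop. -/
theorem triangle_loop (h : Monogon n S₀ a y) (hS : ShiftInvariant n S₀)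
    (hc : NonCrossing fun x v => S₀ x v ∨ ChordOrbit n a (a + n : ℤ) x v)
    {x w : ℤ} {z : WithTop ℤ} (hxy : x < w) (hyz : (w : WithTop ℤ) < z)
    (h1 : S₀ x w ∨ ChordOrbit n a (a + n : ℤ) x w) (h2 : S₀ w z ∨ ChordOrbit n a (a + n : ℤ) w z)
    (h3 : S₀ x z ∨ ChordOrbit n a (a + n : ℤ) x z) :
    S₀ x w ∧ S₀ w z ∧ (ChordOrbit n a (a + n : ℤ) x z →
      ∃ k : ℤ, x = a + k * n ∧ w = y + k * n ∧ z = (a + n + k * n : ℤ)) ∧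
    ¬ ChordOrbit n a (a + n : ℤ) x w ∧ ¬ ChordOrbit n a (a + n : ℤ) w z := by
  -- No triangle has a side longer than `n`, so the loop, whose length is `n`, can only be the
  -- longest side.
  have hz : ∃ z' : ℤ, z = z' ∧ z' ≤ x + n := by
    rcases h3 with h3 | ⟨k, rfl, rfl⟩
    · obtain ⟨z', rfl, -, h⟩ := h.short _ _ h3
      exact ⟨z', rfl, h.le⟩
    · exact ⟨a + n + k * n, rfl, by linarith⟩
  obtain ⟨z, rfl, hz⟩ := hz
  have hyz' : w < z := mod_cast hyz
  have h1' : ¬ ChordOrbit n a (a + n : ℤ) x w := by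
    rintro ⟨k, rfl, hk⟩
    norm_cast at hk
    linarith
  have h2' : ¬ ChordOrbit n a (a + n : ℤ) w z := by
    rintro ⟨k, rfl, hk⟩
    norm_cast at hk
    linarith
  have h1 := h1.resolve_right h1'
  have h2 := h2.resolve_right h2'
  refine ⟨h1, h2, ?_, h1', h2'⟩
  rintro ⟨k, rfl, hk⟩
  norm_cast at hk
  have e1 := hS _ _ k h.ay
  have e2 := hS _ _ k h.ya
  norm_cast at e1 e2
  subst hk
  refine ⟨k, rfl, ?_, by norm_cast⟩
  have := h.lt_ay
  have := h.lt_ya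
  rcases lt_trichotomy w (y + k * n) with hw | hw | hw
  · exact (hc _ _ _ _ (Or.inl e1) (Or.inl h2) hxy (mod_cast hw) (mod_cast (by linarith))).elim
  · exact hw
  · exact (hc _ _ _ _ (Or.inl h1) (Or.inl e2) (by linarith) (mod_cast hw) (mod_cast hyz')).elim

/-- The arrows to and from the loop. -/
theorem chordArrow_loop (h : Monogon n S₀ a y) (hS : ShiftInvariant n S₀)
    (hc : NonCrossing fun x v => S₀ x v ∨ ChordOrbit n a (a + n : ℤ) x v)
    {E : ℤ → WithTop ℤ → Prop} (hE : ShiftInvariant n E) :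
    (ChordArrow (fun x v => S₀ x v ∨ ChordOrbit n a (a + n : ℤ) x v) E
      (ChordOrbit n a (a + n : ℤ)) ↔ E a y) ∧
    (ChordArrow (fun x v => S₀ x v ∨ ChordOrbit n a (a + n : ℤ) x v)
      (ChordOrbit n a (a + n : ℤ)) E ↔ E y (a + n : ℤ)) := by
  have e1 := fun k => hE.iff a y k
  have e2 := fun k => hE.iff y (a + n : ℤ) k
  simp only [← WithTop.coe_add] at e1 e2
  have t : a < y ∧ (y : WithTop ℤ) < (a + n : ℤ) := ⟨h.lt_ay, mod_cast h.lt_ya⟩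
  refine ⟨⟨?_, fun b => ⟨a, y, (a + n : ℤ), ⟨t.1, t.2, Or.inl h.ay, Or.inl h.ya,
    Or.inr (ChordOrbit.self _ _)⟩, Or.inl ⟨b, ChordOrbit.self _ _⟩⟩⟩,
    ?_, fun b => ⟨a, y, (a + n : ℤ), ⟨t.1, t.2, Or.inl h.ay, Or.inl h.ya,
    Or.inr (ChordOrbit.self _ _)⟩, Or.inr (Or.inl ⟨ChordOrbit.self _ _, b⟩)⟩⟩
  · rintro ⟨x, w, z, ⟨hxy, hyz, h1, h2, h3⟩, b⟩
    obtain ⟨-, -, t1, t2, t3⟩ := h.triangle_loop hS hc hxy hyz h1 h2 h3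
    rcases b with ⟨b, c⟩ | ⟨b, c⟩ | ⟨b, c⟩
    · obtain ⟨k, rfl, rfl, rfl⟩ := t1 c
      exact (e1 k).1 b
    · exact (t3 c).elim
    · exact (t2 c).elim
  · rintro ⟨x, w, z, ⟨hxy, hyz, h1, h2, h3⟩, b⟩
    obtain ⟨-, -, t1, t2, t3⟩ := h.triangle_loop hS hc hxy hyz h1 h2 h3
    rcases b with ⟨c, b⟩ | ⟨c, b⟩ | ⟨c, b⟩
    · exact (t2 c).elim
    · obtain ⟨k, rfl, rfl, rfl⟩ := t1 c
      exact (e2 k).1 b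
    · exact (t3 c).elim

theorem chordArrow_or_loop (h : Monogon n S₀ a y) (hS : ShiftInvariant n S₀)
    (hc : NonCrossing fun x v => S₀ x v ∨ ChordOrbit n a (a + n : ℤ) x v)
    {E F : ℤ → WithTop ℤ → Prop} (hE : ShiftInvariant n E) (hF : ShiftInvariant n F)
    (hES : ∀ x y, E x y → S₀ x y) (hFS : ∀ x y, F x y → S₀ x y) :
    ChordArrow (fun x v => S₀ x v ∨ ChordOrbit n a (a + n : ℤ) x v) E F ↔
      ChordArrow S₀ E F ∨ (E y (a + n : ℤ) ∧ F a y) := by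
  have e1 := fun k => hF.iff a y k
  have e2 := fun k => hE.iff y (a + n : ℤ) k
  simp only [← WithTop.coe_add] at e1 e2
  constructor
  · rintro ⟨x, w, z, ⟨hxy, hyz, h1, h2, h3⟩, b⟩
    obtain ⟨t4, t5, t1, t2, t3⟩ := h.triangle_loop hS hc hxy hyz h1 h2 h3
    rcases h3 with h3 | h3
    · exact Or.inl ⟨x, w, z, ⟨hxy, hyz, t4, t5, h3⟩, b⟩
    · obtain ⟨k, rfl, rfl, rfl⟩ := t1 h3
      have hnot : ¬ S₀ (a + k * n) (a + n + k * n : ℤ) := fun h' => by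
        obtain ⟨z, hz, -, hz'⟩ := h.short _ _ h'
        norm_cast at hz
        linarith
      rcases b with ⟨b, c⟩ | ⟨b, c⟩ | ⟨b, c⟩
      · exact (hnot (hFS _ _ c)).elim
      · exact (hnot (hES _ _ b)).elim
      · exact Or.inr ⟨(e2 k).1 b, (e1 k).1 c⟩
  · rintro (⟨x, y, z, ⟨hxy, hyz, h1, h2, h3⟩, b⟩ | ⟨b, c⟩)
    · exact ⟨x, y, z, ⟨hxy, hyz, Or.inl h1, Or.inl h2, Or.inl h3⟩, b⟩
    · exact ⟨a, y, (a + n : ℤ), ⟨h.lt_ay, mod_cast h.lt_ya, Or.inl h.ay, Or.inl h.ya,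
        Or.inr (ChordOrbit.self _ _)⟩, Or.inr (Or.inr ⟨b, c⟩)⟩

theorem chordOrbit_top {x u : ℤ} {v : WithTop ℤ} :
    ChordOrbit n x ⊤ u v ↔ (∃ k : ℤ, u = x + k * n) ∧ v = ⊤ := by
  constructor
  · rintro ⟨k, rfl, rfl⟩
    exact ⟨⟨k, rfl⟩, rfl⟩
  · rintro ⟨⟨k, rfl⟩, rfl⟩
    exact ⟨k, rfl, rfl⟩

/-- The triangles at the puncture when exactly two lines end there. -/
theorem triangle_top (h : Monogon n S₀ a y) {x w : ℤ} (h1 : S₀ x w)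
    (h2 : ChordOrbit n a ⊤ w ⊤ ∨ ChordOrbit n y ⊤ w ⊤)
    (h3 : ChordOrbit n a ⊤ x ⊤ ∨ ChordOrbit n y ⊤ x ⊤) :
    ∃ k : ℤ, (x = a + k * n ∧ w = y + k * n) ∨ (x = y + k * n ∧ w = a + n + k * n) := by
  obtain ⟨w', hw, hxw, hwx⟩ := h.short _ _ h1
  norm_cast at hw
  subst hw
  simp only [chordOrbit_top, and_true] at h2 h3
  have h4 := h.lt_ay
  have h5 := h.lt_ya
  rcases h2 with ⟨k, rfl⟩ | ⟨k, rfl⟩ <;> rcases h3 with ⟨l, rfl⟩ | ⟨l, rfl⟩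
  · have := eq_zero_of_mul_lt (n := n) (k := k - l) (by linarith) (by linarith)
    obtain rfl : k = l := by linarith
    linarith
  · refine ⟨l, Or.inr ⟨rfl, ?_⟩⟩
    have := eq_zero_of_mul_lt (n := n) (k := k - l - 1) (by linarith) (by linarith)
    obtain rfl : k = l + 1 := by linarith
    ring
  · refine ⟨l, Or.inl ⟨rfl, ?_⟩⟩
    have := eq_zero_of_mul_lt (n := n) (k := k - l) (by linarith) (by linarith)
    obtain rfl : k = l := by linarith
    ring
  · have := eq_zero_of_mul_lt (n := n) (k := k - l) (by linarith) (by linarith)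
    obtain rfl : k = l := by linarith
    linarith

/-- `S₀` together with the lines from `a` and from `y` to the puncture. -/
def withLines (n : ℕ) (S₀ : ℤ → WithTop ℤ → Prop) (a y : ℤ) (x : ℤ) (v : WithTop ℤ) : Prop :=
  S₀ x v ∨ ChordOrbit n a ⊤ x v ∨ ChordOrbit n y ⊤ x v

theorem withLines_coe {x z : ℤ} : withLines n S₀ a y x z ↔ S₀ x z := by
  simp [withLines, chordOrbit_top]

theorem withLines_top (h : Monogon n S₀ a y) {x : ℤ} :
    withLines n S₀ a y x ⊤ ↔ ChordOrbit n a ⊤ x ⊤ ∨ ChordOrbit n y ⊤ x ⊤ := by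
  refine ⟨fun h' => h'.resolve_left fun h'' => ?_, Or.inr⟩
  obtain ⟨z, hz, -⟩ := h.short _ _ h''
  simp at hz

/-- Of any two sides of a triangle one ends at the last vertex `z`. If both lie in `S₀`, then `z` is
not over the puncture and the lines play no role. -/
theorem chordArrow_withLines (h : Monogon n S₀ a y) {E F : ℤ → WithTop ℤ → Prop}
    (hES : ∀ x y, E x y → S₀ x y) (hFS : ∀ x y, F x y → S₀ x y) :
    ChordArrow (withLines n S₀ a y) E F ↔ ChordArrow S₀ E F := by
  constructor
  · rintro ⟨x, w, z, ⟨hxy, hyz, h1, h2, h3⟩, b⟩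
    have hz : ∃ z' : ℤ, z = z' := by
      rcases b with ⟨b, c⟩ | ⟨b, c⟩ | ⟨b, c⟩
      · exact (h.short _ _ (hFS _ _ c)).imp fun _ h => h.1
      · exact (h.short _ _ (hFS _ _ c)).imp fun _ h => h.1
      · exact (h.short _ _ (hES _ _ b)).imp fun _ h => h.1
    obtain ⟨z, rfl⟩ := hz
    exact ⟨x, w, z, ⟨hxy, hyz, withLines_coe.1 h1, withLines_coe.1 h2, withLines_coe.1 h3⟩, b⟩
  · rintro ⟨x, y, z, ⟨hxy, hyz, h1, h2, h3⟩, b⟩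
    exact ⟨x, y, z, ⟨hxy, hyz, Or.inl h1, Or.inl h2, Or.inl h3⟩, b⟩

/-- The triangles at the puncture are `a < y < ⊤` and `y < a + n < ⊤`, up to translation. Seen from
an arc, the line at `a` has the arrows of the old loop and the line at `y` has them reversed, as
mutation at one of two twin vertices requires. -/
theorem chordArrow_line (h : Monogon n S₀ a y) {E : ℤ → WithTop ℤ → Prop}
    (hE : ShiftInvariant n E) (hES : ∀ x y, E x y → S₀ x y) :
    (ChordArrow (withLines n S₀ a y) E (ChordOrbit n a ⊤) ↔ E a y) ∧
    (ChordArrow (withLines n S₀ a y) (ChordOrbit n a ⊤) E ↔ E y (a + n : ℤ)) ∧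
    (ChordArrow (withLines n S₀ a y) E (ChordOrbit n y ⊤) ↔ E y (a + n : ℤ)) ∧
    (ChordArrow (withLines n S₀ a y) (ChordOrbit n y ⊤) E ↔ E a y) := by
  have e1 := fun k => hE.iff a y k
  have e2 := fun k => hE.iff y (a + n : ℤ) k
  simp only [← WithTop.coe_add] at e1 e2
  have h4 := h.lt_ay
  have h5 := h.lt_ya
  have T : ∀ (x w : ℤ) (z : WithTop ℤ), withLines n S₀ a y x w → withLines n S₀ a y w z → withLines n S₀ a y x z →
      z = ⊤ → ∃ k : ℤ, (x = a + k * n ∧ w = y + k * n) ∨ (x = y + k * n ∧ w = a + n + k * n) := by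
    rintro x w z h1 h2 h3 rfl
    exact h.triangle_top (withLines_coe.1 h1) (h.withLines_top.1 h2) (h.withLines_top.1 h3)
  have hnt : ∀ x, ¬ E x ⊤ := fun x hx => by
    obtain ⟨z, hz, -⟩ := h.short _ _ (hES _ _ hx)
    simp at hz
  have X1 : ∀ b, withLines n S₀ a y b ⊤ → ∀ {D}, ChordArrow (withLines n S₀ a y) E D →
      D = ChordOrbit n b ⊤ → ∃ k : ℤ, (E a y ∧ b = a + k * n) ∨ (E y (a + n : ℤ) ∧ b = y + k * n) := by
    rintro b hb _ ⟨x, w, z, ⟨hxy, hyz, h1, h2, h3⟩, c⟩ rfl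
    rcases c with ⟨c, d⟩ | ⟨c, d⟩ | ⟨c, d⟩
    · obtain ⟨⟨l, rfl⟩, rfl⟩ := chordOrbit_top.1 d
      obtain ⟨k, ⟨hx, rfl⟩ | ⟨hx, rfl⟩⟩ := T _ _ _ h1 h2 h3 rfl
      · rw [hx] at c
        exact ⟨k - l, Or.inl ⟨(e1 k).1 c, by linarith⟩⟩
      · rw [hx] at c
        exact ⟨k - l, Or.inr ⟨(e2 k).1 c, by linarith⟩⟩
    · obtain ⟨-, rfl⟩ := chordOrbit_top.1 d
      exact (hnt _ c).elim
    · obtain ⟨-, hd⟩ := chordOrbit_top.1 d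
      simp at hd
  have X2 : ∀ b, withLines n S₀ a y b ⊤ → ∀ {D}, ChordArrow (withLines n S₀ a y) D E →
      D = ChordOrbit n b ⊤ → ∃ k : ℤ, (E a y ∧ b = y + k * n) ∨ (E y (a + n : ℤ) ∧ b = a + k * n) := by
    rintro b hb _ ⟨x, w, z, ⟨hxy, hyz, h1, h2, h3⟩, c⟩ rfl
    rcases c with ⟨c, d⟩ | ⟨c, d⟩ | ⟨c, d⟩
    · obtain ⟨-, hd⟩ := chordOrbit_top.1 c
      simp at hd
    · obtain ⟨-, rfl⟩ := chordOrbit_top.1 c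
      exact (hnt _ d).elim
    · obtain ⟨⟨l, rfl⟩, rfl⟩ := chordOrbit_top.1 c
      obtain ⟨k, ⟨rfl, hx⟩ | ⟨rfl, hx⟩⟩ := T _ _ _ h1 h2 h3 rfl
      · rw [hx] at d
        exact ⟨k - l, Or.inl ⟨(e1 k).1 d, by linarith⟩⟩
      · rw [hx] at d
        exact ⟨k - l + 1, Or.inr ⟨(e2 k).1 d, by linarith⟩⟩
  have ne : ∀ k : ℤ, a ≠ y + k * n := fun k hk => by
    have := eq_zero_of_mul_lt (n := n) (k := k) (by linarith) (by linarith)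
    subst this
    linarith
  have ne' : ∀ k : ℤ, y ≠ a + k * n := fun k hk => by
    have := eq_zero_of_mul_lt (n := n) (k := k) (by linarith) (by linarith)
    subst this
    linarith
  have ha : withLines n S₀ a y a ⊤ := Or.inr (Or.inl (ChordOrbit.self _ _))
  have hy : withLines n S₀ a y y ⊤ := Or.inr (Or.inr (ChordOrbit.self _ _))
  have oa : ChordOrbit n a ⊤ (a + n : ℤ) ⊤ := ⟨1, by ring, rfl⟩
  have ha' : withLines n S₀ a y (a + n : ℤ) ⊤ := Or.inr (Or.inl oa)
  have t1 := WithTop.coe_lt_top y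
  have t2 := WithTop.coe_lt_top (a + n : ℤ)
  refine ⟨⟨fun c => ?_, fun c => ⟨a, y, ⊤, ⟨h4, t1, Or.inl h.ay, hy, ha⟩,
      Or.inl ⟨c, ChordOrbit.self _ _⟩⟩⟩,
    ⟨fun c => ?_, fun c => ⟨y, a + n, ⊤, ⟨h5, t2, Or.inl h.ya, ha', hy⟩,
      Or.inr (Or.inr ⟨oa, c⟩)⟩⟩,
    ⟨fun c => ?_, fun c => ⟨y, a + n, ⊤, ⟨h5, t2, Or.inl h.ya, ha', hy⟩,
      Or.inl ⟨c, ChordOrbit.self _ _⟩⟩⟩,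
    ⟨fun c => ?_, fun c => ⟨a, y, ⊤, ⟨h4, t1, Or.inl h.ay, hy, ha⟩,
      Or.inr (Or.inr ⟨ChordOrbit.self _ _, c⟩)⟩⟩⟩
  · obtain ⟨k, ⟨h, -⟩ | ⟨-, h⟩⟩ := X1 a ha c rfl
    · exact h
    · exact (ne _ h).elim
  · obtain ⟨k, ⟨-, h⟩ | ⟨h, -⟩⟩ := X2 a ha c rfl
    · exact (ne _ h).elim
    · exact h
  · obtain ⟨k, ⟨-, h⟩ | ⟨h, -⟩⟩ := X1 y hy c rfl
    · exact (ne' _ h).elim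
    · exact h
  · obtain ⟨k, ⟨h, -⟩ | ⟨-, h⟩⟩ := X2 y hy c rfl
    · exact h
    · exact (ne' _ h).elim

/-- The two lines share both triangles at the puncture, with opposite directions. Their arrows
cancel, in agreement with the absence of arrows between the twins before the flip. -/
theorem chordArrow_lines (h : Monogon n S₀ a y) :
    ChordArrow (withLines n S₀ a y) (ChordOrbit n a ⊤) (ChordOrbit n y ⊤) ∧
    ChordArrow (withLines n S₀ a y) (ChordOrbit n y ⊤) (ChordOrbit n a ⊤) := by
  have ha : withLines n S₀ a y a ⊤ := Or.inr (Or.inl (ChordOrbit.self _ _))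
  have hy : withLines n S₀ a y y ⊤ := Or.inr (Or.inr (ChordOrbit.self _ _))
  have oa : ChordOrbit n a ⊤ (a + n : ℤ) ⊤ := ⟨1, by ring, rfl⟩
  have ha' : withLines n S₀ a y (a + n : ℤ) ⊤ := Or.inr (Or.inl oa)
  exact ⟨⟨a, y, ⊤, ⟨h.lt_ay, WithTop.coe_lt_top _, Or.inl h.ay, hy, ha⟩,
      Or.inr (Or.inl ⟨ChordOrbit.self _ _, ChordOrbit.self _ _⟩)⟩,
    ⟨y, a + n, ⊤, ⟨h.lt_ya, WithTop.coe_lt_top _, Or.inl h.ya, ha', hy⟩,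
      Or.inr (Or.inl ⟨ChordOrbit.self _ _, oa⟩)⟩⟩

/-- This is the arrow that mutation cancels, so it must not be repeated elsewhere. A triangle
repeating it would have its third side over the loop, but the chords of `S₀` are shorter than `n`.
-/
theorem not_chordArrow_ya_ay (h : Monogon n S₀ a y) {E F : ℤ → WithTop ℤ → Prop}
    (hE : IsChordOrbit n E) (hF : IsChordOrbit n F)
    (hE' : E y (a + n : ℤ)) (hF' : F a y) : ¬ ChordArrow S₀ E F := by
  have h4 := h.lt_ay
  have h5 := h.lt_ya
  rintro ⟨x, w, z, ⟨hxy, hyz, -, -, hxz⟩, ⟨b, c⟩ | ⟨b, c⟩ | ⟨b, c⟩⟩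
  · obtain ⟨k, rfl, -⟩ := hE.exists_shift hE' b
    obtain ⟨l, hl, -⟩ := hF.exists_shift hF' c
    have := eq_zero_of_mul_lt (n := n) (k := k - l) (by linarith) (by linarith)
    obtain rfl : l = k := by linarith
    linarith
  · obtain ⟨k, -, rfl⟩ := hE.exists_shift hE' b
    obtain ⟨l, -, hl⟩ := hF.exists_shift hF' c
    norm_cast at hl
    have := eq_zero_of_mul_lt (n := n) (k := k + 1 - l) (by linarith) (by linarith)
    obtain rfl : l = k + 1 := by linarith
    linarith
  · obtain ⟨k, rfl, rfl⟩ := hE.exists_shift hE' b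
    obtain ⟨l, rfl, hl⟩ := hF.exists_shift hF' c
    norm_cast at hl
    have := eq_zero_of_mul_lt (n := n) (k := l - k) (by linarith) (by linarith)
    obtain rfl : l = k := by linarith
    obtain ⟨z, hz, -, hz'⟩ := h.short _ _ hxz
    norm_cast at hz
    linarith

open Classical in
/-- The truth table behind the mutation rule for a flip in a monogon. -/
theorem flip_count {X Y u1 u2 v1 v2 : Prop} (e : ¬ (u1 ∧ u2)) (f : ¬ (v1 ∧ v2))
    (d1 : u2 → v1 → ¬ X) (d2 : v2 → u1 → ¬ Y) :
    (if X ∧ ¬ Y then 1 else 0) =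
    ((if (X ∨ (u2 ∧ v1)) ∧ ¬ (Y ∨ (v2 ∧ u1)) then 1 else 0) +
      (if u1 ∧ ¬ u2 then 1 else 0) * (if v2 ∧ ¬ v1 then 1 else 0)) -
    ((if (Y ∨ (v2 ∧ u1)) ∧ ¬ (X ∨ (u2 ∧ v1)) then 1 else 0) +
      (if v1 ∧ ¬ v2 then 1 else 0) * (if u2 ∧ ¬ u1 then 1 else 0)) := by
  by_cases hX : X <;> by_cases hY : Y <;> by_cases u1 <;> by_cases u2 <;> by_cases v1 <;>
    by_cases v2 <;> simp_all

theorem exclusive (h : Monogon n S₀ a y) {E : ℤ → WithTop ℤ → Prop} (hE : IsChordOrbit n E) :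
    ¬ (E a y ∧ E y (a + n : ℤ)) := by
  rintro ⟨b, c⟩
  have h4 := h.lt_ay
  have h5 := h.lt_ya
  have := hE.eq_of_lt b c (by linarith) (by linarith)
  linarith [this.1]

/-- A flip in a monogon mutates the arrows. -/
theorem arrowCount_flip (h : Monogon n S₀ a y) (hS₀ : ShiftInvariant n S₀)
    (hc : NonCrossing fun x v => S₀ x v ∨ ChordOrbit n a (a + n : ℤ) x v)
    {E F : ℤ → WithTop ℤ → Prop} (hE : IsChordOrbit n E) (hF : IsChordOrbit n F)
    (hES : ∀ x y, E x y → S₀ x y) (hFS : ∀ x y, F x y → S₀ x y)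
    {S S' L A Y : ℤ → WithTop ℤ → Prop} (hL : L = ChordOrbit n a (a + n : ℤ))
    (hS : S = fun x y => S₀ x y ∨ ChordOrbit n a (a + n : ℤ) x y)
    (hS' : S' = withLines n S₀ a y) (hA : A = ChordOrbit n a ⊤) (hY : Y = ChordOrbit n y ⊤) :
    (arrowCount S' E A = arrowCount S E L ∧ arrowCount S' A E = arrowCount S L E ∧
      arrowCount S' Y E = arrowCount S E L ∧ arrowCount S' E Y = arrowCount S L E) ∧
    arrowCount S' E F = (arrowCount S E F + arrowCount S E L * arrowCount S L F)
      - (arrowCount S F E + arrowCount S F L * arrowCount S L E) := by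
  have hES' := hE.shiftInvariant
  have hFS' := hF.shiftInvariant
  obtain ⟨a1, a2⟩ := h.chordArrow_loop hS₀ hc hES'
  obtain ⟨a3, a4⟩ := h.chordArrow_loop hS₀ hc hFS'
  obtain ⟨b1, b2, b3, b4⟩ := h.chordArrow_line hES' hES
  have c1 := h.chordArrow_or_loop hS₀ hc hES' hFS' hES hFS
  have c2 := h.chordArrow_or_loop hS₀ hc hFS' hES' hFS hES
  have c3 := h.chordArrow_withLines hES hFS
  have c4 := h.chordArrow_withLines hFS hES
  subst hL hS hS' hA hY
  rw [arrowCount_congr b1 b2, arrowCount_congr b2 b1, arrowCount_congr b3 b4,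
    arrowCount_congr b4 b3, arrowCount_congr a1 a2, arrowCount_congr a2 a1,
    arrowCount_congr c3 c4, arrowCount_congr c1 c2, arrowCount_congr c2 c1, arrowCount_congr a4 a3,
    arrowCount_congr a3 a4]
  refine ⟨⟨rfl, rfl, rfl, rfl⟩, ?_⟩
  convert flip_count (h.exclusive hE) (h.exclusive hF) (h.not_chordArrow_ya_ay hE hF)
    (h.not_chordArrow_ya_ay hF hE)

end Monogon

/-! ### Diagonals and their lifts. -/

theorem ZMod.intCast_eq_iff_exists {n : ℕ} {x y : ℤ} :
    (y : ZMod n) = x ↔ ∃ k : ℤ, y = x + k * n := by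
  rw [eq_comm, ZMod.intCast_eq_intCast_iff_dvd_sub]
  constructor
  · rintro ⟨k, hk⟩
    exact ⟨k, by linarith⟩
  · rintro ⟨k, rfl⟩
    exact ⟨k, by ring⟩

theorem eq_of_intCast_eq {n : ℕ} {x y : ℤ} (h : (y : ZMod n) = x) (h1 : y < x + n)
    (h2 : x < y + n) : y = x := by
  obtain ⟨k, rfl⟩ := ZMod.intCast_eq_iff_exists.1 h
  obtain rfl : k = 0 := eq_zero_of_mul_lt (by linarith) (by linarith)
  simp

theorem ZMod.exists_intCast_eq {n : ℕ} (hn : n ≠ 0) (c : ZMod n) (x : ℤ) :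
    ∃ z : ℤ, x ≤ z ∧ z < x + n ∧ (z : ZMod n) = c := by
  obtain ⟨y, rfl⟩ := ZMod.intCast_surjective c
  have h : (0 : ℤ) < n := by omega
  refine ⟨x + (y - x) % n, ?_, ?_, ?_⟩
  · linarith [Int.emod_nonneg (y - x) h.ne']
  · linarith [Int.emod_lt_of_pos (y - x) h]
  · rw [ZMod.intCast_eq_iff_exists]
    exact ⟨-((y - x) / n), by linarith [Int.emod_add_mul_ediv (y - x) n]⟩

namespace Diagonal

variable {n : ℕ}

/-- The arc over the chord from `x` to `z`. -/
def ofChord (x z : ℤ) (h : x + 2 ≤ z) (h' : z < x + n) : Diagonal n :=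
  arc x z (fun e => by have := eq_of_intCast_eq e h' (by linarith); omega)
    (fun e => by
      have := eq_of_intCast_eq (n := n) (x := x + 1) (y := z) (by exact_mod_cast e) (by linarith)
        (by linarith)
      omega)

theorem exists_ofChord (hn : n ≠ 0) (a b : ZMod n) (h : b ≠ a) (h' : b ≠ a + 1) (x : ℤ)
    (hx : (x : ZMod n) = a) :
    ∃ z, ∃ (h1 : x + 2 ≤ z) (h2 : z < x + n), arc a b h h' = ofChord x z h1 h2 := by
  obtain ⟨z, h1, h2, rfl⟩ := ZMod.exists_intCast_eq hn b x
  subst hx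
  have h3 : z ≠ x := by rintro rfl; exact h rfl
  have h4 : z ≠ x + 1 := by rintro rfl; exact h' (by push_cast; rfl)
  exact ⟨z, by omega, h2, rfl⟩

theorem isLift_ofChord {x z : ℤ} (h : x + 2 ≤ z) (h' : z < x + n) {u : ℤ} {v : WithTop ℤ} :
    (ofChord x z h h').IsLift u v ↔ ChordOrbit n x z u v := by
  constructor
  · rintro ⟨h1, t, rfl, h2, h3, h4⟩
    obtain ⟨k, rfl⟩ := ZMod.intCast_eq_iff_exists.1 h1
    obtain ⟨l, rfl⟩ := ZMod.intCast_eq_iff_exists.1 h2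
    have := eq_zero_of_mul_lt (n := n) (k := l - k) (by linarith) (by linarith)
    obtain rfl : l = k := by linarith
    exact ⟨l, rfl, by norm_cast⟩
  · rintro ⟨k, rfl, rfl⟩
    exact ⟨ZMod.intCast_eq_iff_exists.2 ⟨k, rfl⟩, z + k * n, by norm_cast,
      ZMod.intCast_eq_iff_exists.2 ⟨k, rfl⟩, by linarith, by linarith⟩

theorem isLift_radius {x : ℤ} {ε : Bool} {u : ℤ} {v : WithTop ℤ} :
    (radius (x : ZMod n) ε).IsLift u v ↔ ChordOrbit n x ⊤ u v := by
  rw [Monogon.chordOrbit_top]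
  exact and_congr ZMod.intCast_eq_iff_exists Iff.rfl

theorem crosses_radius {a c : ZMod n} {ε ε' : Bool} :
    (radius a ε).Crosses (radius c ε') ↔ a ≠ c ∧ ε ≠ ε' := Iff.rfl

theorem crosses_arc_left {a b : ZMod n} {h h'} {e : Diagonal n} :
    (arc a b h h').Crosses e ↔
      ∃ x y x' y', (arc a b h h').IsLift x y ∧ e.IsLift x' y' ∧ ChordsCross x y x' y' := by
  cases e <;> exact Iff.rfl

theorem crosses_arc_right {a b : ZMod n} {h h'} {e : Diagonal n} :
    e.Crosses (arc a b h h') ↔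
      ∃ x y x' y', e.IsLift x y ∧ (arc a b h h').IsLift x' y' ∧ ChordsCross x y x' y' := by
  cases e <;> exact Iff.rfl

theorem ChordsCross.symm {x x' : ℤ} {y y' : WithTop ℤ} (h : ChordsCross x y x' y') :
    ChordsCross x' y' x y := Or.symm h

theorem Crosses.symm {d e : Diagonal n} (h : d.Crosses e) : e.Crosses d := by
  cases d with
  | arc a b h1 h2 =>
    obtain ⟨x, y, x', y', h3, h4, h5⟩ := crosses_arc_left.1 h
    exact crosses_arc_right.2 ⟨x', y', x, y, h4, h3, h5.symm⟩
  | radius a ε =>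
    cases e with
    | arc =>
      obtain ⟨x, y, x', y', h3, h4, h5⟩ := crosses_arc_right.1 h
      exact crosses_arc_left.2 ⟨x', y', x, y, h4, h3, h5.symm⟩
    | radius => exact ⟨h.1.symm, h.2.symm⟩

/-- Crossing lifts of two diagonals, not both of which end at the puncture, show that they cross. -/
theorem crosses_of_isLift {d e : Diagonal n} {x u : ℤ} {y v : WithTop ℤ} (hd : d.IsLift x y)
    (he : e.IsLift u v) (h : ChordsCross x y u v) : d.Crosses e := by
  cases d with
  | arc => exact crosses_arc_left.2 ⟨x, y, u, v, hd, he, h⟩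
  | radius =>
    cases e with
    | arc => exact crosses_arc_right.2 ⟨x, y, u, v, hd, he, h⟩
    | radius =>
      obtain ⟨-, rfl⟩ := hd
      obtain ⟨-, rfl⟩ := he
      rcases h with h | h
      · exact (lt_irrefl _ h.2.2).elim
      · exact (lt_irrefl _ h.2.2).elim

theorem isChordOrbit_isLift (hn : n ≠ 0) (d : Diagonal n) : IsChordOrbit n d.IsLift := by
  cases d with
  | arc a b h h' =>
    obtain ⟨x, rfl⟩ := ZMod.intCast_surjective a
    obtain ⟨z, h1, h2, h3⟩ := exists_ofChord hn _ b h h' x rfl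
    exact ⟨x, z, by rw [h3]; funext u v; exact propext (isLift_ofChord h1 h2)⟩
  | radius a ε =>
    obtain ⟨x, rfl⟩ := ZMod.intCast_surjective a
    exact ⟨x, ⊤, by funext u v; exact propext isLift_radius⟩

theorem ChordsCross.shift {x u : ℤ} {y v : WithTop ℤ} (h : ChordsCross x y u v) (m : ℤ) :
    ChordsCross (x + m) (y + (m : WithTop ℤ)) (u + m) (v + (m : WithTop ℤ)) := by
  have aux : ∀ {x u : ℤ} {y v : WithTop ℤ}, x < u → (u : WithTop ℤ) < y → y < v →
      x + m < u + m ∧ ((u + m : ℤ) : WithTop ℤ) < y + (m : WithTop ℤ) ∧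
      y + (m : WithTop ℤ) < v + (m : WithTop ℤ) := by
    intro x u y v h1 h2 h3
    cases y with
    | top => exact (not_top_lt h3).elim
    | coe y =>
      cases v with
      | top => norm_cast at *; exact ⟨by linarith, by linarith, WithTop.coe_lt_top _⟩
      | coe v => norm_cast at *; exact ⟨by linarith, by linarith, by linarith⟩
  exact h.imp (fun h => aux h.1 h.2.1 h.2.2) (fun h => aux h.1 h.2.1 h.2.2)

/-- Crossing diagonals either end both at the puncture, or have crossing lifts. The lift of one of
them can be prescribed. -/
theorem Crosses.exists_isLift (hn : n ≠ 0) {d e : Diagonal n} (h : d.Crosses e) {x : ℤ}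
    {y : WithTop ℤ} (hd : d.IsLift x y) :
    (∃ a c ε, d = radius a ε ∧ e = radius c (!ε) ∧ a ≠ c) ∨
      ∃ u v, e.IsLift u v ∧ ChordsCross x y u v := by
  have aux : (∃ x' y' u v, d.IsLift x' y' ∧ e.IsLift u v ∧ ChordsCross x' y' u v) →
      ∃ u v, e.IsLift u v ∧ ChordsCross x y u v := by
    rintro ⟨x', y', u, v, h1, h2, h3⟩
    obtain ⟨k, rfl, rfl⟩ := (isChordOrbit_isLift hn d).exists_shift h1 hd
    exact ⟨_, _, (isChordOrbit_isLift hn e).shiftInvariant _ _ k h2, h3.shift _⟩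
  cases d with
  | arc => exact Or.inr (aux (crosses_arc_left.1 h))
  | radius a ε =>
    cases e with
    | arc => exact Or.inr (aux (crosses_arc_right.1 h))
    | radius c ε' => exact Or.inl ⟨a, c, ε, rfl, by rw [Bool.eq_not_iff.2 h.2.symm], h.1⟩

theorem eq_ofChord_of_isLift {d : Diagonal n} {x z : ℤ} (hd : d.IsLift x z) (h : x + 2 ≤ z)
    (h' : z < x + n) : d = ofChord x z h h' := by
  cases d with
  | arc a b h1 h2 =>
    obtain ⟨rfl, t, ht, rfl, -⟩ := hd
    norm_cast at ht
    subst ht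
    rfl
  | radius a ε => exact (WithTop.coe_ne_top hd.2).elim

theorem eq_radius_of_isLift {d : Diagonal n} {x : ℤ} (hd : d.IsLift x ⊤) :
    ∃ ε, d = radius (x : ZMod n) ε := by
  cases d with
  | arc a b h1 h2 =>
    obtain ⟨rfl, t, ht, -⟩ := hd
    exact (WithTop.top_ne_coe ht).elim
  | radius a ε => exact ⟨ε, by rw [hd.1]⟩

end Diagonal

/-! ### How the diagonals of a set are drawn, and the sides they give. -/

section DrawnAs

variable {n : ℕ} {Δ : Set (Diagonal n)}

theorem drawnAs_ofChord {x z : ℤ} (h : x + 2 ≤ z) (h' : z < x + n) :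
    DrawnAs Δ (ofChord x z h h') = ChordOrbit n x z := by
  funext u v
  exact propext (isLift_ofChord h h')

theorem drawnAs_radius_of_notMem {x : ℤ} {ε : Bool} (h : radius (x : ZMod n) (!ε) ∉ Δ) :
    DrawnAs Δ (radius (x : ZMod n) ε) = ChordOrbit n x ⊤ := by
  funext u v
  refine propext (Iff.trans ?_ (isLift_radius (ε := ε)))
  simp [DrawnAs, h]

theorem drawnAs_radius_of_mem {x : ℤ} {ε : Bool} (h : radius (x : ZMod n) (!ε) ∈ Δ) :
    DrawnAs Δ (radius (x : ZMod n) ε) = ChordOrbit n x (x + n : ℤ) := by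
  funext u v
  refine propext ?_
  simp only [DrawnAs, h, not_true_eq_false, false_and, false_or, true_and, ChordOrbit]
  rw [ZMod.intCast_eq_iff_exists, ← exists_and_right]
  refine exists_congr fun k => and_congr_right fun hu => ?_
  rw [hu, ← WithTop.coe_add, add_right_comm]

theorem isChordOrbit_drawnAs (hn : n ≠ 0) (d : Diagonal n) : IsChordOrbit n (DrawnAs Δ d) := by
  cases d with
  | arc a b h h' =>
    obtain ⟨x, rfl⟩ := ZMod.intCast_surjective a
    obtain ⟨z, h1, h2, h3⟩ := exists_ofChord hn _ b h h' x rfl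
    exact ⟨x, z, by rw [h3, drawnAs_ofChord]⟩
  | radius a ε =>
    obtain ⟨x, rfl⟩ := ZMod.intCast_surjective a
    by_cases h : radius (x : ZMod n) (!ε) ∈ Δ
    · exact ⟨x, _, drawnAs_radius_of_mem h⟩
    · exact ⟨x, _, drawnAs_radius_of_notMem h⟩

/-- The four kinds of sides. -/
theorem IsSide.cases {x : ℤ} {v : WithTop ℤ} (h : IsSide Δ x v) :
    v = (x + 1 : ℤ) ∨
    (∃ z, ∃ (h1 : x + 2 ≤ z) (h2 : z < x + n), v = z ∧ ofChord x z h1 h2 ∈ Δ) ∨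
    (v = ⊤ ∧ ∃ ε, radius (x : ZMod n) ε ∈ Δ ∧ radius (x : ZMod n) (!ε) ∉ Δ) ∨
    (v = (x + n : ℤ) ∧ ∀ ε, radius (x : ZMod n) ε ∈ Δ) := by
  rcases h with h | ⟨d, hd, h⟩
  · exact Or.inl h
  right
  cases d with
  | arc a b h1 h2 =>
    obtain ⟨rfl, y, rfl, rfl, h3, h4⟩ := h
    left
    have h5 : y ≠ x + 1 := by rintro rfl; exact h2 (by push_cast; rfl)
    exact ⟨y, by omega, h4, rfl, hd⟩
  | radius a ε =>
    right
    rcases h with ⟨h, rfl, rfl⟩ | ⟨h, rfl, rfl⟩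
    · exact Or.inl ⟨rfl, ε, hd, h⟩
    · refine Or.inr ⟨rfl, fun ε' => ?_⟩
      by_cases h' : ε' = ε
      · rwa [h']
      · rwa [Bool.eq_not_iff.2 h']

theorem isSide_ofChord {x z : ℤ} {h : x + 2 ≤ z} {h' : z < x + n} (hd : ofChord x z h h' ∈ Δ) :
    IsSide Δ x z :=
  Or.inr ⟨_, hd, by rw [drawnAs_ofChord]; exact ChordOrbit.self _ _⟩

theorem isSide_top {x : ℤ} {ε : Bool} (h : radius (x : ZMod n) ε ∈ Δ)
    (h' : radius (x : ZMod n) (!ε) ∉ Δ) : IsSide Δ x ⊤ :=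
  Or.inr ⟨_, h, by rw [drawnAs_radius_of_notMem h']; exact ChordOrbit.self _ _⟩

theorem isSide_loop {x : ℤ} (h : ∀ ε, radius (x : ZMod n) ε ∈ Δ) : IsSide Δ x (x + n : ℤ) :=
  Or.inr ⟨_, h true, by rw [drawnAs_radius_of_mem (h _)]; exact ChordOrbit.self _ _⟩

theorem isSide_shiftInvariant (hn : n ≠ 0) : ShiftInvariant n (IsSide Δ) := by
  rintro x y k (rfl | ⟨d, hd, h⟩)
  · left
    norm_cast
    ring_nf
  · exact Or.inr ⟨d, hd, (isChordOrbit_drawnAs hn d).shiftInvariant _ _ k h⟩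

theorem isSide_lt (hn : n ≠ 0) {x : ℤ} {v : WithTop ℤ} (h : IsSide Δ x v) :
    (x : WithTop ℤ) < v := by
  rcases h.cases with rfl | ⟨z, h1, h2, rfl, -⟩ | ⟨rfl, -⟩ | ⟨rfl, -⟩
  · exact mod_cast lt_add_one x
  · exact mod_cast (by linarith)
  · exact WithTop.coe_lt_top _
  · exact mod_cast (by omega)

theorem isSide_shortChords (hn : n ≠ 0) : ShortChords n (IsSide Δ) := by
  intro x z h
  rcases h.cases with h | ⟨t, h1, h2, h, -⟩ | ⟨h, -⟩ | ⟨h, -⟩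
  · norm_cast at h
    omega
  · norm_cast at h
    omega
  · exact (WithTop.coe_ne_top h).elim
  · norm_cast at h
    omega

/-- A diagonal which does not cross those drawn along a side has no lift crossing this side. -/
theorem IsSide.not_chordsCross {u : ℤ} {v : WithTop ℤ} (h : IsSide Δ u v)
    {e : Diagonal n} (he : ∀ d ∈ Δ, DrawnAs Δ d u v → ¬ d.Crosses e) {a : ℤ} {b : WithTop ℤ}
    (hab : e.IsLift a b) : ¬ ChordsCross u v a b := by
  intro hc
  rcases h.cases with rfl | ⟨z, h1, h2, rfl, hd⟩ | ⟨rfl, ε, h1, h2⟩ | ⟨rfl, h1⟩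
  · rcases hc with ⟨c1, c2, c3⟩ | ⟨c1, c2, c3⟩
    · norm_cast at c2
      omega
    · cases b with
      | top => exact not_top_lt c3
      | coe b =>
        norm_cast at c2 c3
        omega
  · refine he _ hd (by rw [drawnAs_ofChord]; exact ChordOrbit.self _ _) ?_
    exact crosses_of_isLift ((isLift_ofChord h1 h2).2 (ChordOrbit.self _ _)) hab hc
  · refine he _ h1 (by rw [drawnAs_radius_of_notMem h2]; exact ChordOrbit.self _ _) ?_
    exact crosses_of_isLift (isLift_radius.2 (ChordOrbit.self _ _)) hab hc
  -- The loop stands for two lines. An arc crossing it crosses the line at one of its ends `u`, `u +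
  -- n`. A line crossing it ends at another border vertex, hence crosses the line at `u` with the
  -- opposite tag.
  · have h2 : ∀ ε, ¬ (radius (u : ZMod n) ε).Crosses e := fun ε => he _ (h1 ε) (by
      rw [drawnAs_radius_of_mem (h1 _)]; exact ChordOrbit.self _ _)
    cases e with
    | arc a' b' h3 h4 =>
      have h5 := hab
      obtain ⟨-, b, rfl, -, h6, h7⟩ := h5
      rcases hc with ⟨c1, c2, c3⟩ | ⟨c1, c2, c3⟩
      · refine h2 true (crosses_of_isLift (isLift_radius.2 ⟨1, rfl, rfl⟩) hab (Or.inr ?_))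
        norm_cast at *
        rw [one_mul]
        exact ⟨c2, mod_cast c3, WithTop.coe_lt_top _⟩
      · exact h2 true (crosses_of_isLift (isLift_radius.2 (ChordOrbit.self _ _)) hab
          (Or.inr ⟨c1, c2, WithTop.coe_lt_top _⟩))
    | radius c ε =>
      obtain ⟨rfl, rfl⟩ := hab
      rcases hc with ⟨c1, c2, c3⟩ | ⟨c1, c2, c3⟩
      · refine h2 (!ε) ⟨fun h => ?_, by simp⟩
        norm_cast at c2
        have := eq_of_intCast_eq h (by linarith) (by linarith)
        omega
      · exact not_top_lt c3

end DrawnAs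

/-! ### Triangles and lines to the puncture in a triangulation. -/

namespace Triangulation

variable {n : ℕ} (Δ : Triangulation n)

/-- Maximality speaks of distinct diagonals only. An arc does not cross itself because its lifts are
shorter than `n` and differ by multiples of `n`. -/
theorem not_crosses {d e : Diagonal n} (hd : d ∈ Δ.diagonals) (he : e ∈ Δ.diagonals) :
    ¬ d.Crosses e := by
  by_cases h : d = e
  · subst h
    cases d with
    | radius a ε => exact fun h => h.1 rfl
    | arc a b h1 h2 =>
      rw [crosses_arc_left]
      rintro ⟨x, y, x', y', ⟨rfl, z, rfl, hz, h3, h4⟩, ⟨h5, z', rfl, h6, h7, h8⟩, h9⟩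
      obtain ⟨k, rfl⟩ := ZMod.intCast_eq_iff_exists.1 h5
      rw [← hz] at h6
      obtain ⟨l, rfl⟩ := ZMod.intCast_eq_iff_exists.1 h6
      have := eq_zero_of_mul_lt (n := n) (k := l - k) (by linarith) (by linarith)
      obtain rfl : l = k := by linarith
      rcases h9 with ⟨h9, h10, h11⟩ | ⟨h9, h10, h11⟩ <;> norm_cast at h10 h11
      · have := eq_zero_of_mul_lt (n := n) (k := l) (by linarith) (by linarith)
        subst this
        linarith
      · have := eq_zero_of_mul_lt (n := n) (k := l) (by linarith) (by linarith)
        subst this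
        linarith
  · exact Δ.maximal.prop hd he h

theorem mem_of_not_crosses {d : Diagonal n} (h : ∀ e ∈ Δ.diagonals, ¬ e.Crosses d) :
    d ∈ Δ.diagonals := by
  refine Δ.maximal.mem_of_prop_insert ?_
  rw [Set.pairwise_insert]
  exact ⟨Δ.maximal.prop, fun e he _ => ⟨fun h' => h e he h'.symm, h e he⟩⟩

theorem exists_crosses {d : Diagonal n} (h : d ∉ Δ.diagonals) :
    ∃ e ∈ Δ.diagonals, e.Crosses d := by
  by_contra! h'
  exact h (Δ.mem_of_not_crosses h')

/-- If the second chord is a loop, it is replaced by the line at its starting point, which crosses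
the first chord as well. A loop in the first place is covered by `IsSide.not_chordsCross`. -/
theorem nonCrossing : NonCrossing (IsSide Δ.diagonals) := by
  intro x v u w h1 h2 h3 h4 h5
  have key : ∀ ε, radius (u : ZMod n) ε ∈ Δ.diagonals → ¬ ChordsCross x v u ⊤ := fun ε hε =>
    h1.not_chordsCross (fun d hd _ => Δ.not_crosses hd hε) (isLift_radius.2 (ChordOrbit.self _ _))
  have hv : v ≠ ⊤ := (h5.trans_le le_top).ne
  rcases h2.cases with rfl | ⟨z, h6, h7, rfl, hd⟩ | ⟨rfl, ε, h6, -⟩ | ⟨rfl, h6⟩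
  · cases v with
    | top => exact hv rfl
    | coe v =>
      norm_cast at h4 h5
      omega
  · exact h1.not_chordsCross (fun e he _ => Δ.not_crosses he hd)
      ((isLift_ofChord h6 h7).2 (ChordOrbit.self _ _)) (Or.inl ⟨h3, h4, h5⟩)
  · exact key ε h6 (Or.inl ⟨h3, h4, h5⟩)
  · exact key true (h6 true) (Or.inl ⟨h3, h4, hv.lt_top⟩)

/-- Maximality in terms of chords. The only lifts that are not drawn are the lines of a double pair.
If such a line at `a` crosses `(x, z)`, so does the loop `(a, a + n)`, because `z < x + n < a + n`.
-/
theorem isSide_of_not_chordsCross (hn : n ≠ 0) {x z : ℤ} (h : x < z) (h' : z < x + n)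
    (hc : ∀ u v, IsSide Δ.diagonals u v → ¬ ChordsCross u v x z) :
    IsSide Δ.diagonals x z := by
  by_cases h1 : z = x + 1
  · subst h1
    exact Or.inl rfl
  have h2 : x + 2 ≤ z := by omega
  refine isSide_ofChord (h := h2) (h' := h') (Δ.mem_of_not_crosses fun e he hcr => ?_)
  have aux : ∀ a b, e.IsLift a b → ChordsCross a b x z → False := by
    intro a b hab hab'
    by_cases hdr : DrawnAs Δ.diagonals e a b
    · exact hc a b (Or.inr ⟨e, he, hdr⟩) hab'
    · cases e with
      | arc => exact hdr hab
      | radius c ε =>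
        obtain ⟨rfl, rfl⟩ := hab
        by_cases hm : radius (a : ZMod n) (!ε) ∈ Δ.diagonals
        · refine hc a (a + n : ℤ) (Or.inr ⟨_, he, ?_⟩) ?_
          · rw [drawnAs_radius_of_mem hm]
            exact ChordOrbit.self _ _
          · rcases hab' with ⟨h3, h4, h5⟩ | ⟨h3, h4, h5⟩
            · exact (not_top_lt h5).elim
            · refine Or.inr ⟨h3, h4, ?_⟩
              norm_cast
              linarith
        · rw [drawnAs_radius_of_notMem hm] at hdr
          exact hdr (ChordOrbit.self _ _)
  obtain ⟨a, c, ε, h3, -⟩ | ⟨a, b, h3, h4⟩ := hcr.symm.exists_isLift hn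
    ((isLift_ofChord h2 h').2 (ChordOrbit.self _ _))
  · simp [ofChord] at h3
  · exact aux a b h3 h4.symm

/-- An arc crossing a line at `x` has a lift passing over `x`. Hence only tags can obstruct such a
line, and a suitable tag always exists. -/
theorem exists_radius_of_not_inside {x : ℤ}
    (h : ∀ u v : ℤ, IsSide Δ.diagonals u v → u < x → v ≤ x) (hn : n ≠ 0) :
    ∃ ε, radius (x : ZMod n) ε ∈ Δ.diagonals := by
  have harc : ∀ a b h1 h2 ε, arc a b h1 h2 ∈ Δ.diagonals →
      ¬ (arc a b h1 h2).Crosses (radius (x : ZMod n) ε) := by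
    intro a b h1 h2 ε hd hc
    obtain ⟨u, v, x', y', h3, h4, h5⟩ := crosses_arc_left.1 hc
    obtain ⟨k, rfl, rfl⟩ := isLift_radius.1 h4
    obtain ⟨t, rfl⟩ : ∃ t : ℤ, v = t := ⟨h3.2.choose, h3.2.choose_spec.1⟩
    have h6 := (isChordOrbit_drawnAs (Δ := Δ.diagonals) hn (arc a b h1 h2)).shiftInvariant _ _ (-k) h3
    have h7 := h (u + (-k : ℤ) * n) (t + (-k : ℤ) * n) (Or.inr ⟨_, hd, mod_cast h6⟩)
    rcases h5 with ⟨h8, h9, -⟩ | ⟨h8, h9, h10⟩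
    · norm_cast at h9
      linarith [h7 (by linarith)]
    · exact not_top_lt h10
  by_cases hex : ∃ c ε, radius c ε ∈ Δ.diagonals ∧ c ≠ (x : ZMod n)
  · obtain ⟨c, ε, hc, hcx⟩ := hex
    -- The tag of an existing line at `c` is reused. A line obstructing it also ends at `c`, so both
    -- tags occur there, and a lift of their loop passes over `x`.
    refine ⟨ε, Δ.mem_of_not_crosses fun e he => ?_⟩
    cases e with
    | arc a b h1 h2 => exact harc _ _ _ _ _ he
    | radius c' ε' =>
      rintro ⟨h1, h2⟩
      have h3 : c = c' := by
        by_contra h3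
        exact Δ.not_crosses hc he ⟨h3, h2.symm⟩
      subst h3
      obtain ⟨z, hz1, hz2, rfl⟩ := ZMod.exists_intCast_eq hn c (x - n)
      have h4 : IsSide Δ.diagonals z (z + n : ℤ) := isSide_loop fun ε'' => by
        by_cases h5 : ε'' = ε
        · rwa [h5]
        · rwa [Bool.eq_not_iff.2 h5, ← Bool.eq_not_iff.2 h2]
      have h5 : z ≠ x - n := by
        rintro rfl
        apply hcx
        push_cast
        rw [ZMod.natCast_self, sub_zero]
      have := h _ _ h4 (by linarith)
      omega
  · push Not at hex
    refine ⟨true, Δ.mem_of_not_crosses fun e he => ?_⟩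
    cases e with
    | arc a b h1 h2 => exact harc _ _ _ _ _ he
    | radius c ε => exact fun h => h.1 (hex _ _ he)

/-- Nothing passes over the starting point of a longest side: by non-crossing it would contain that
side and be longer. -/
theorem exists_radius (hn : n ≠ 0) : ∃ (x : ℤ) (ε : Bool), radius (x : ZMod n) ε ∈ Δ.diagonals := by
  obtain ⟨l, ⟨x, hx⟩, hl⟩ := Int.exists_greatest_of_bdd
    (P := fun l => ∃ x : ℤ, IsSide Δ.diagonals x (x + l : ℤ))
    ⟨n, fun l ⟨x, hx⟩ => by linarith [isSide_shortChords hn _ _ hx]⟩ ⟨1, 0, Or.inl rfl⟩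
  have h0 := isSide_lt hn hx
  norm_cast at h0
  refine ⟨x, Δ.exists_radius_of_not_inside (fun u v huv hu => ?_) hn⟩
  by_contra! hv
  have h1 : x + l ≤ v := by
    by_contra! h1
    exact Δ.nonCrossing _ _ _ _ huv hx hu (mod_cast hv) (mod_cast h1)
  have := hl (v - u) ⟨u, by rwa [add_sub_cancel]⟩
  linarith

/-- Every side which is not a border edge bounds a triangle on its inner side. -/
theorem exists_inner (hn : n ≠ 0) {x z : ℤ} (h : IsSide Δ.diagonals x z) (hxz : x + 2 ≤ z) :
    ∃ y, x < y ∧ y < z ∧ IsSide Δ.diagonals x y ∧ IsSide Δ.diagonals y z := by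
  -- The farthest neighbour of `x` below `z`. A side crossing `(y, z)` would cross `(x, y)` or `(x,
  -- z)`, or would start at `x` and end between `y` and `z`.
  obtain ⟨y, ⟨hyz, hy⟩, hmax⟩ := Int.exists_greatest_of_bdd
    (P := fun y => y < z ∧ IsSide Δ.diagonals x y)
    ⟨z, fun l hl => hl.1.le⟩ ⟨x + 1, by linarith, Or.inl rfl⟩
  have hxy : x < y := mod_cast isSide_lt hn hy
  have hlen := isSide_shortChords hn _ _ h
  refine ⟨y, hxy, hyz, hy, Δ.isSide_of_not_chordsCross hn hyz (by linarith) ?_⟩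
  rintro u v huv (⟨h1, h2, h3⟩ | ⟨h1, h2, h3⟩)
  · have h4 : x ≤ u := by
      by_contra! h4
      exact Δ.nonCrossing _ _ _ _ huv h h4 (lt_trans (mod_cast hxy) h2) h3
    rcases h4.eq_or_lt with rfl | h4
    · cases v with
      | top => exact not_top_lt h3
      | coe v =>
        norm_cast at h2 h3
        linarith [hmax v ⟨h3, huv⟩]
    · exact Δ.nonCrossing _ _ _ _ hy huv h4 (mod_cast h1) h2
  · exact Δ.nonCrossing _ _ _ _ h huv (hxy.trans h1) h2 h3

/-- Every arc or border edge bounds a triangle on its outer side. -/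
theorem exists_outer (hn : n ≠ 0) {x y : ℤ} (h : IsSide Δ.diagonals x y) (hxy : y < x + n) :
    (∃ w : WithTop ℤ, (y : WithTop ℤ) < w ∧ IsSide Δ.diagonals x w ∧ IsSide Δ.diagonals y w) ∨
    ∃ w : ℤ, w < x ∧ IsSide Δ.diagonals w x ∧ IsSide Δ.diagonals w y := by
  have nc := Δ.nonCrossing
  have hxy' : x < y := mod_cast isSide_lt hn h
  by_cases hex : ∃ u v : ℤ, u ≤ x ∧ y ≤ v ∧ y - x < v - u ∧ IsSide Δ.diagonals u v
  -- Take a shortest side properly containing `(x, y)`. The third vertex of its inner triangle is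
  -- not strictly between `x` and `y`, and by minimality one of the two other sides of this triangle
  -- is `(x, y)`.
  · obtain ⟨l, ⟨u, v, h1, h2, h3, h4, rfl⟩, hl⟩ := Int.exists_least_of_bdd
      (P := fun l => ∃ u v : ℤ, u ≤ x ∧ y ≤ v ∧ y - x < v - u ∧ IsSide Δ.diagonals u v ∧ l = v - u)
      ⟨y - x, fun l ⟨u, v, h1, h2, h3, h4, h5⟩ => by linarith⟩
      (by obtain ⟨u, v, h1, h2, h3, h4⟩ := hex; exact ⟨_, u, v, h1, h2, h3, h4, rfl⟩)
    obtain ⟨m, h5, h6, h7, h8⟩ := Δ.exists_inner hn h4 (by linarith)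
    have h9 : m ≤ x ∨ y ≤ m := by
      by_contra! h9
      rcases h1.eq_or_lt with rfl | h1
      · exact nc _ _ _ _ h h8 h9.1 (mod_cast h9.2) (mod_cast (by omega))
      · exact nc _ _ _ _ h7 h h1 (mod_cast h9.1) (mod_cast h9.2)
    rcases h9 with h9 | h9
    · have : ¬ y - x < v - m := fun h10 => by
        have := hl (v - m) ⟨m, v, h9, h2, h10, h8, rfl⟩
        linarith
      obtain rfl : m = x := by omega
      obtain rfl : v = y := by omega
      exact Or.inr ⟨u, h5, h7, h4⟩
    · have : ¬ y - x < m - u := fun h10 => by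
        have := hl (m - u) ⟨u, m, h1, h9, h10, h7, rfl⟩
        linarith
      obtain rfl : u = x := by omega
      obtain rfl : m = y := by omega
      exact Or.inl ⟨v, mod_cast h6, h4, h8⟩
  -- Nothing contains `(x, y)`, so both ends are joined to the puncture. They carry single lines,
  -- since the loop of a double pair would contain `(x, y)`.
  · push Not at hex
    left
    refine ⟨⊤, WithTop.coe_lt_top _, ?_, ?_⟩
    · obtain ⟨ε, hε⟩ := Δ.exists_radius_of_not_inside (x := x) (fun u v huv hu => by
        by_contra! hv
        by_cases h1 : y ≤ v
        · exact hex u v hu.le h1 (by linarith) huv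
        · exact nc _ _ _ _ huv h hu (mod_cast hv) (mod_cast (by omega))) hn
      refine isSide_top hε fun hε' => ?_
      exact hex x (x + n) le_rfl hxy.le (by linarith) (isSide_loop fun ε' => by
        by_cases h5 : ε' = ε
        · rwa [h5]
        · rwa [Bool.eq_not_iff.2 h5])
    · obtain ⟨ε, hε⟩ := Δ.exists_radius_of_not_inside (x := y) (fun u v huv hu => by
        by_contra! hv
        by_cases h1 : u ≤ x
        · exact hex u v h1 hv.le (by linarith) huv
        · exact nc _ _ _ _ h huv (by omega) (mod_cast hu) (mod_cast hv)) hn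
      refine isSide_top hε fun hε' => ?_
      have h6 := isSide_shiftInvariant hn _ _ (-1) (isSide_loop (Δ := Δ.diagonals) (x := y) fun ε' => by
        by_cases h5 : ε' = ε
        · rwa [h5]
        · rwa [Bool.eq_not_iff.2 h5])
      norm_cast at h6
      have : y + (n : ℤ) + Int.negSucc 0 * n = y := by
        rw [Int.negSucc_eq]
        ring
      rw [this] at h6
      have h7 : Int.negSucc 0 * (n : ℤ) = - n := by
        rw [Int.negSucc_eq]
        ring
      rw [h7] at h6
      exact hex _ _ (by linarith) le_rfl (by linarith) h6

/-- A side crossing `(p, q)` would cross one of the two lines or be a line between them. -/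
theorem isSide_of_consecutive (hn : n ≠ 0) {p q : ℤ} (hpq : p < q) (hqp : q < p + n)
    (hp : IsSide Δ.diagonals p ⊤) (hq : IsSide Δ.diagonals q ⊤)
    (h : ∀ m, p < m → m < q → ¬ IsSide Δ.diagonals m ⊤) : IsSide Δ.diagonals p q := by
  have nc := Δ.nonCrossing
  refine Δ.isSide_of_not_chordsCross hn hpq hqp ?_
  rintro u v huv (⟨h1, h2, h3⟩ | ⟨h1, h2, h3⟩)
  · exact nc _ _ _ _ huv hp h1 h2 (h3.trans (WithTop.coe_lt_top _))
  · by_cases hv : v = ⊤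
    · subst hv
      exact h u h1 (mod_cast h2) huv
    · exact nc _ _ _ _ huv hq (mod_cast h2) h3 (WithTop.lt_top_iff_ne_top.2 hv)

/-- Next to a line from `q` to the puncture there is another one, unless both tags occur at `q`. -/
theorem exists_other_line (hn : n ≠ 0) {q : ℤ} (hq : IsSide Δ.diagonals q ⊤) :
    ∃ r, q < r ∧ r < q + n ∧ IsSide Δ.diagonals r ⊤ := by
  rcases hq.cases with h | ⟨z, -, -, h, -⟩ | ⟨-, ε, h1, h2⟩ | ⟨h, -⟩
  · exact (WithTop.top_ne_coe h).elim
  · exact (WithTop.top_ne_coe h).elim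
  -- The line with the other tag is missing, so something crosses it. Arcs do not distinguish tags
  -- and would cross the existing line too; hence it is a line ending elsewhere.
  · obtain ⟨e, he, hc⟩ := Δ.exists_crosses h2
    cases e with
    | arc a b h3 h4 =>
      obtain ⟨x, y, x', y', h5, h6, h7⟩ := crosses_arc_left.1 hc
      exact (Δ.not_crosses he h1 (crosses_arc_left.2 ⟨x, y, x', y', h5, h6, h7⟩)).elim
    | radius c ε' =>
      obtain ⟨h3, h4⟩ := hc
      obtain rfl : ε' = ε := by simpa using h4
      obtain ⟨r, h5, h6, rfl⟩ := ZMod.exists_intCast_eq hn c q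
      have h7 : r ≠ q := fun h => h3 (by rw [h])
      refine ⟨r, by omega, h6, isSide_top he fun h8 => ?_⟩
      exact Δ.not_crosses h1 h8 ⟨h3.symm, by simp⟩
  · exact (WithTop.top_ne_coe h).elim

theorem exists_next_line (hn : n ≠ 0) {q : ℤ} (hq : IsSide Δ.diagonals q ⊤) :
    ∃ r, q < r ∧ r < q + n ∧ IsSide Δ.diagonals r ⊤ ∧ IsSide Δ.diagonals q r ∧
      ∀ m, q < m → m < r → ¬ IsSide Δ.diagonals m ⊤ := by
  obtain ⟨r', h1, h2, h3⟩ := Δ.exists_other_line hn hq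
  obtain ⟨r, ⟨h4, h5⟩, h6⟩ := Int.exists_least_of_bdd
    (P := fun r => q < r ∧ IsSide Δ.diagonals r ⊤) ⟨q, fun r h => h.1.le⟩ ⟨r', h1, h3⟩
  have h7 := h6 r' ⟨h1, h3⟩
  have h8 : ∀ m, q < m → m < r → ¬ IsSide Δ.diagonals m ⊤ := fun m hm hm' h =>
    (h6 m ⟨hm, h⟩).not_gt hm'
  exact ⟨r, h4, by linarith, h5, Δ.isSide_of_consecutive hn h4 (by linarith) hq h5 h8, h8⟩

theorem exists_prev_line (hn : n ≠ 0) {q : ℤ} (hq : IsSide Δ.diagonals q ⊤) :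
    ∃ p, p < q ∧ q < p + n ∧ IsSide Δ.diagonals p ⊤ ∧ IsSide Δ.diagonals p q ∧
      ∀ m, p < m → m < q → ¬ IsSide Δ.diagonals m ⊤ := by
  obtain ⟨r', h1, h2, h3⟩ := Δ.exists_other_line hn hq
  have h3' : IsSide Δ.diagonals (r' - n) ⊤ := by
    have := isSide_shiftInvariant hn _ _ (-1) h3
    have e : r' + -1 * (n : ℤ) = r' - n := by ring
    rwa [e, WithTop.top_add] at this
  obtain ⟨r, ⟨h4, h5⟩, h6⟩ := Int.exists_greatest_of_bdd
    (P := fun r => r < q ∧ IsSide Δ.diagonals r ⊤) ⟨q, fun r h => h.1.le⟩ ⟨r' - n, by linarith, h3'⟩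
  have h7 := h6 (r' - n) ⟨by linarith, h3'⟩
  have h8 : ∀ m, r < m → m < q → ¬ IsSide Δ.diagonals m ⊤ := fun m hm hm' h =>
    (h6 m ⟨hm', h⟩).not_gt hm
  exact ⟨r, h4, by linarith, h5, Δ.isSide_of_consecutive hn h4 (by linarith) h5 hq h8, h8⟩

end Triangulation

/-! ### Exchanges of diagonals, and flips in quadrilaterals. -/

namespace Quad

variable {n : ℕ} {S : ℤ → WithTop ℤ → Prop} {p q r : ℤ} {s : WithTop ℤ}

/-- A chord crossing `(p, r)` but not the sides of the quadrilateral is `(q, s)`. -/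
theorem eq_qs (h : Quad n S p q r s) {u : ℤ} {v : WithTop ℤ} (hc : ChordsCross p r u v)
    (hs : ∀ x y, S x y → (x = p ∧ y = q ∨ x = q ∧ y = r ∨ x = r ∧ y = s ∨ x = p ∧ y = s) →
      ¬ ChordsCross x y u v) : u = q ∧ v = s := by
  have c1 := hs _ _ h.pq (by simp)
  have c2 := hs _ _ h.qr (by simp)
  have c3 := hs _ _ h.rs (by simp)
  have c4 := hs _ _ h.ps (by simp)
  have h1 := h.lt_pq
  have h2 := h.lt_qr
  have h3 := h.lt_rs
  rcases hc with ⟨h4, h5, h6⟩ | ⟨h4, h5, h6⟩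
  · have h5' : u < r := mod_cast h5
    obtain rfl : u = q := by
      rcases lt_trichotomy u q with h7 | h7 | h7
      · exact (c1 (Or.inl ⟨h4, mod_cast h7, lt_trans (mod_cast h2) h6⟩)).elim
      · exact h7
      · exact (c2 (Or.inl ⟨h7, h5, h6⟩)).elim
    refine ⟨rfl, ?_⟩
    rcases lt_trichotomy v s with h7 | h7 | h7
    · exact (c3 (Or.inr ⟨h5', h6, h7⟩)).elim
    · exact h7
    · exact (c4 (Or.inl ⟨h4, lt_trans h5 h3, h7⟩)).elim
  · exact (c4 (Or.inr ⟨h4, h5, lt_trans h6 h3⟩)).elim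

/-- A chord crossing `(q, s)` but not the sides of the quadrilateral is `(p, r)`. -/
theorem eq_pr (h : Quad n S p q r s) {u : ℤ} {v : WithTop ℤ} (hc : ChordsCross q s u v)
    (hs : ∀ x y, S x y → (x = p ∧ y = q ∨ x = q ∧ y = r ∨ x = r ∧ y = s ∨ x = p ∧ y = s) →
      ¬ ChordsCross x y u v) : u = p ∧ v = r := by
  have c1 := hs _ _ h.pq (by simp)
  have c2 := hs _ _ h.qr (by simp)
  have c3 := hs _ _ h.rs (by simp)
  have c4 := hs _ _ h.ps (by simp)
  have h1 := h.lt_pq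
  have h2 := h.lt_qr
  have h3 := h.lt_rs
  rcases hc with ⟨h4, h5, h6⟩ | ⟨h4, h5, h6⟩
  · exact (c4 (Or.inl ⟨h1.trans h4, h5, h6⟩)).elim
  · obtain rfl : u = p := by
      rcases lt_trichotomy u p with h7 | h7 | h7
      · exact (c4 (Or.inr ⟨h7, lt_trans (mod_cast h1) h5, h6⟩)).elim
      · exact h7
      · exact (c1 (Or.inl ⟨h7, mod_cast h4, h5⟩)).elim
    refine ⟨rfl, ?_⟩
    rcases lt_trichotomy v r with h7 | h7 | h7
    · exact (c2 (Or.inr ⟨h4, h5, h7⟩)).elim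
    · exact h7
    · exact (c3 (Or.inr ⟨h4.trans h2, h7, h6⟩)).elim

end Quad

namespace Triangulation

variable {n : ℕ}

/-- The number of arrows of the quiver of `Δ` from `d` to `e`. -/
noncomputable def arrow (Δ : Triangulation n) (d e : Diagonal n) : ℕ :=
  arrowCount (IsSide Δ.diagonals) (DrawnAs Δ.diagonals d) (DrawnAs Δ.diagonals e)

/-- `Δ'` arises from `Δ` by exchanging `d` for `d'`, and there is no third diagonal that could
replace `d`. -/
structure IsExchange (Δ Δ' : Triangulation n) (d d' : Diagonal n) : Prop where
  mem : d ∈ Δ.diagonals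
  notMem : d' ∉ Δ.diagonals
  eq : Δ'.diagonals = insert d' (Δ.diagonals \ {d})
  unique : ∀ e, (∀ x ∈ Δ.diagonals, x ≠ d → ¬ x.Crosses e) → e ∈ Δ.diagonals ∨ e = d'

/-- `Δ'` arises from `Δ` by exchanging `d` for `d'`, and the quiver of `Δ'` is the mutation at `d`
of the quiver of `Δ`. -/
structure IsFlip (Δ Δ' : Triangulation n) (d d' : Diagonal n) : Prop
    extends IsExchange Δ Δ' d d' where
  arrow_left : ∀ e ∈ Δ.diagonals, e ≠ d → Δ'.arrow d' e = Δ.arrow e d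
  arrow_right : ∀ e ∈ Δ.diagonals, e ≠ d → Δ'.arrow e d' = Δ.arrow d e
  arrow : ∀ e ∈ Δ.diagonals, e ≠ d → ∀ f ∈ Δ.diagonals, f ≠ d →
    Δ'.arrow e f = (Δ.arrow e f + Δ.arrow e d * Δ.arrow d f)
      - (Δ.arrow f e + Δ.arrow f d * Δ.arrow d e)

theorem IsExchange.mem_and_ne_iff {Δ Δ' : Triangulation n} {d d' : Diagonal n}
    (h : IsExchange Δ Δ' d d') (x : Diagonal n) :
    x ∈ Δ'.diagonals ∧ x ≠ d' ↔ x ∈ Δ.diagonals ∧ x ≠ d := by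
  rw [h.eq, Set.mem_insert_iff, Set.mem_sdiff, Set.mem_singleton_iff]
  refine ⟨fun h' => h'.1.resolve_left h'.2, fun h' => ⟨Or.inr h', ?_⟩⟩
  rintro rfl
  exact h.notMem h'.1

theorem IsExchange.mem_right {Δ Δ' : Triangulation n} {d d' : Diagonal n}
    (h : IsExchange Δ Δ' d d') : d' ∈ Δ'.diagonals := by
  rw [h.eq]
  exact Set.mem_insert _ _

theorem IsExchange.symm {Δ Δ' : Triangulation n} {d d' : Diagonal n} (h : IsExchange Δ Δ' d d') :
    IsExchange Δ' Δ d' d := by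
  have hne : d ≠ d' := fun e => h.notMem (e ▸ h.mem)
  have hmem := h.mem_and_ne_iff
  refine ⟨h.mem_right, ?_, ?_, ?_⟩
  · rw [h.eq]
    simp [hne]
  · ext x
    rw [Set.mem_insert_iff, Set.mem_sdiff, Set.mem_singleton_iff, hmem]
    by_cases hx : x = d
    · simp [hx, h.mem]
    · simp [hx]
  · intro e he
    by_cases hx : e = d
    · exact Or.inr hx
    left
    rw [h.eq]
    rcases h.unique e (fun x hx hx' => he x ((hmem x).2 ⟨hx, hx'⟩).1 ((hmem x).2 ⟨hx, hx'⟩).2)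
      with h1 | h1
    · exact Or.inr ⟨h1, hx⟩
    · exact Or.inl h1

/-- Mutation at a vertex is an involution. With truncated subtraction this depends on the absence of
two-cycles: one of the two opposite arrow counts vanishes. -/
theorem IsFlip.symm {Δ Δ' : Triangulation n} {d d' : Diagonal n} (h : IsFlip Δ Δ' d d') :
    IsFlip Δ' Δ d' d := by
  have hmem := h.mem_and_ne_iff
  refine ⟨h.toIsExchange.symm, ?_, ?_, ?_⟩
  · intro e he he'
    obtain ⟨h1, h2⟩ := (hmem e).1 ⟨he, he'⟩
    exact (h.arrow_right e h1 h2).symm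
  · intro e he he'
    obtain ⟨h1, h2⟩ := (hmem e).1 ⟨he, he'⟩
    exact (h.arrow_left e h1 h2).symm
  · intro e he he' f hf hf'
    obtain ⟨h1, h2⟩ := (hmem e).1 ⟨he, he'⟩
    obtain ⟨h3, h4⟩ := (hmem f).1 ⟨hf, hf'⟩
    rw [h.arrow e h1 h2 f h3 h4, h.arrow f h3 h4 e h1 h2, h.arrow_left e h1 h2,
      h.arrow_left f h3 h4, h.arrow_right e h1 h2, h.arrow_right f h3 h4,
      Nat.mul_comm (Δ.arrow d e), Nat.mul_comm (Δ.arrow d f)]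
    have : Δ.arrow e f = 0 ∨ Δ.arrow f e = 0 := arrowCount_eq_zero_or _ _ _
    generalize Δ.arrow e d * Δ.arrow d f = A at *
    generalize Δ.arrow f d * Δ.arrow d e = B at *
    omega

/-- The exchange of a diagonal which can be replaced in just one way. -/
theorem exists_exchange (Δ : Triangulation n) {d d' : Diagonal n} (hd : d ∈ Δ.diagonals)
    (hd' : d' ∉ Δ.diagonals) (hc : ∀ e ∈ Δ.diagonals, e ≠ d → ¬ e.Crosses d')
    (hu : ∀ e, (∀ x ∈ Δ.diagonals, x ≠ d → ¬ x.Crosses e) → e ∈ Δ.diagonals ∨ e = d') :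
    ∃ Δ' : Triangulation n, IsExchange Δ Δ' d d' := by
  have hdd' : d.Crosses d' := by
    obtain ⟨e, he, hed⟩ := Δ.exists_crosses hd'
    by_cases h : e = d
    · rwa [← h]
    · exact (hc e he h hed).elim
  refine ⟨⟨insert d' (Δ.diagonals \ {d}), ?_, ?_⟩, hd, hd', rfl, hu⟩
  · change Set.Pairwise _ _
    rw [Set.pairwise_insert]
    exact ⟨Δ.maximal.prop.mono Set.sdiff_subset,
      fun e he _ => ⟨fun h => hc e he.1 he.2 h.symm, hc e he.1 he.2⟩⟩
  · intro T hT hsub e he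
    by_contra hne
    rcases hu e (fun x hx hxd => hT (hsub (Or.inr ⟨hx, hxd⟩)) he (by
      rintro rfl; exact hne (Or.inr ⟨hx, hxd⟩))) with h | rfl
    · obtain rfl : e = d := by
        by_contra h'
        exact hne (Or.inr ⟨h, h'⟩)
      exact hT he (hsub (Or.inl rfl)) (by rintro rfl; exact hd' h) hdd'
    · exact hne (Or.inl rfl)

/-- The border edges and the chords over diagonals of `Δ` other than `d`. -/
def SideExcept (Δ : Triangulation n) (d : Diagonal n) (x : ℤ) (v : WithTop ℤ) : Prop :=
  v = ((x + 1 : ℤ) : WithTop ℤ) ∨ ∃ e ∈ Δ.diagonals, e ≠ d ∧ DrawnAs Δ.diagonals e x v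

theorem sideExcept_shiftInvariant (hn : n ≠ 0) (Δ : Triangulation n) (d : Diagonal n) :
    ShiftInvariant n (Δ.SideExcept d) := by
  rintro x y k (rfl | ⟨e, he, hed, h⟩)
  · left
    norm_cast
    ring_nf
  · exact Or.inr ⟨e, he, hed, (isChordOrbit_drawnAs hn e).shiftInvariant _ _ k h⟩

theorem isSide_iff_sideExcept {Δ : Triangulation n} {d : Diagonal n} (hd : d ∈ Δ.diagonals) {x : ℤ}
    {v : WithTop ℤ} :
    IsSide Δ.diagonals x v ↔ Δ.SideExcept d x v ∨ DrawnAs Δ.diagonals d x v := by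
  constructor
  · rintro (h | ⟨e, he, h⟩)
    · exact Or.inl (Or.inl h)
    · by_cases hed : e = d
      · exact Or.inr (hed ▸ h)
      · exact Or.inl (Or.inr ⟨e, he, hed, h⟩)
  · rintro ((h | ⟨e, he, -, h⟩) | h)
    · exact Or.inl h
    · exact Or.inr ⟨e, he, h⟩
    · exact Or.inr ⟨d, hd, h⟩

/-- The drawing of a diagonal depends on the triangulation only through the presence of its partner
with the other tag. So nothing is redrawn if neither `d` nor `d'` is such a partner. -/
theorem drawnAs_exchange {Δ Δ' : Triangulation n} {d d' : Diagonal n}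
    (h : IsExchange Δ Δ' d d')
    (hr : ∀ a ε, radius a ε ∈ Δ.diagonals → radius a ε ≠ d →
      radius a (!ε) ≠ d ∧ radius a (!ε) ≠ d') {e : Diagonal n} (he : e ∈ Δ.diagonals)
    (hed : e ≠ d) : DrawnAs Δ'.diagonals e = DrawnAs Δ.diagonals e := by
  cases e with
  | arc => rfl
  | radius a ε =>
    obtain ⟨h1, h2⟩ := hr a ε he hed
    have : radius a (!ε) ∈ Δ'.diagonals ↔ radius a (!ε) ∈ Δ.diagonals := by
      rw [h.eq]
      simp [h1, h2]
    funext x y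
    simp only [DrawnAs, this]

theorem sideExcept_exchange {Δ Δ' : Triangulation n} {d d' : Diagonal n}
    (h : IsExchange Δ Δ' d d')
    (hdr : ∀ e ∈ Δ.diagonals, e ≠ d → DrawnAs Δ'.diagonals e = DrawnAs Δ.diagonals e) :
    Δ'.SideExcept d' = Δ.SideExcept d := by
  funext x v
  refine propext (or_congr_right (exists_congr fun e => ?_))
  rw [← and_assoc, ← and_assoc, h.mem_and_ne_iff]
  exact and_congr_right fun h' => by rw [hdr e h'.1 h'.2]

/-- An exchange in a quadrilateral is a flip. -/
theorem isFlip_of_quad (hn : n ≠ 0) {Δ Δ' : Triangulation n} {d d' : Diagonal n}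
    (h : IsExchange Δ Δ' d d')
    (hdr : ∀ e ∈ Δ.diagonals, e ≠ d → DrawnAs Δ'.diagonals e = DrawnAs Δ.diagonals e)
    {p q r : ℤ} {s : WithTop ℤ} (hQ : Quad n (Δ.SideExcept d) p q r s)
    (hD : DrawnAs Δ.diagonals d = ChordOrbit n p r)
    (hD' : DrawnAs Δ'.diagonals d' = ChordOrbit n q s) : IsFlip Δ Δ' d d' := by
  have hd := h.mem
  have hd2 := h.mem_right
  have hS : IsSide Δ.diagonals = fun x y => Δ.SideExcept d x y ∨ ChordOrbit n p r x y := by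
    funext x y
    rw [isSide_iff_sideExcept hd, hD]
  have hS' : IsSide Δ'.diagonals = fun x y => Δ.SideExcept d x y ∨ ChordOrbit n q s x y := by
    funext x y
    rw [isSide_iff_sideExcept hd2, hD', sideExcept_exchange h hdr]
  have nc := Δ.nonCrossing
  have nc' := Δ'.nonCrossing
  rw [hS] at nc
  rw [hS'] at nc'
  -- The chords `(p, r)` and `(q, s)` cross, so neither can belong to what the two triangulations
  -- have in common.
  have hpr : ¬ Δ.SideExcept d p r := fun h' => nc' _ _ _ _ (Or.inl h')
    (Or.inr (ChordOrbit.self _ _)) hQ.lt_pq (mod_cast hQ.lt_qr) hQ.lt_rs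
  have hqs : ¬ Δ.SideExcept d q s := fun h' => nc _ _ _ _ (Or.inr (ChordOrbit.self _ _))
    (Or.inl h') hQ.lt_pq (mod_cast hQ.lt_qr) hQ.lt_rs
  have hlen : ShortChords n (Δ.SideExcept d) := fun x z hxz =>
    isSide_shortChords (Δ := Δ.diagonals) hn x z ((isSide_iff_sideExcept hd).2 (Or.inl hxz))
  have key : ∀ e ∈ Δ.diagonals, e ≠ d → ∀ f ∈ Δ.diagonals, f ≠ d → _ := fun e he hed f hf hfd =>
    hQ.arrowCount_flip (Δ.sideExcept_shiftInvariant hn d) hlen hpr hqs nc nc'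
      (isChordOrbit_drawnAs (Δ := Δ.diagonals) hn e) (isChordOrbit_drawnAs (Δ := Δ.diagonals) hn f)
      (fun x y hxy => Or.inr ⟨e, he, hed, hxy⟩) (fun x y hxy => Or.inr ⟨f, hf, hfd, hxy⟩)
      hS hS' hD hD'
  refine ⟨h, fun e he hed => ?_, fun e he hed => ?_, fun e he hed f hf hfd => ?_⟩
  · unfold Triangulation.arrow
    rw [hdr e he hed]
    exact (key e he hed e he hed).1
  · unfold Triangulation.arrow
    rw [hdr e he hed]
    exact (key e he hed e he hed).2.1
  · unfold Triangulation.arrow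
    rw [hdr e he hed, hdr f hf hfd]
    exact (key e he hed f hf hfd).2.2

end Triangulation

theorem Quad.le_pr {n : ℕ} {S : ℤ → WithTop ℤ → Prop} {p q r : ℤ} {s : WithTop ℤ}
    (h : Quad n S p q r s) : p + 2 ≤ r := by
  have := h.lt_pq
  have := h.lt_qr
  omega

namespace Triangulation

variable {n : ℕ} (Δ : Triangulation n)

/-- No side of the quadrilateral is a translate of its diagonal: the starting points lie in a window
shorter than `n`, and chords with the same starting point have different ends. -/
theorem quad_sideExcept (hn : n ≠ 0) {d : Diagonal n} (hd : d ∈ Δ.diagonals) {p q r : ℤ}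
    {s : WithTop ℤ} (hQ : Quad n (IsSide Δ.diagonals) p q r s)
    (h : DrawnAs Δ.diagonals d p r ∨ DrawnAs Δ.diagonals d q s) :
    Quad n (Δ.SideExcept d) p q r s := by
  have hO := isChordOrbit_drawnAs (Δ := Δ.diagonals) hn d
  have h1 := hQ.lt_pq
  have h2 := hQ.lt_qr
  have h3 := hQ.lt_rp
  have h4 := hQ.lt_rs
  have h5 := hQ.lt_qs
  have key : ∀ x v, IsSide Δ.diagonals x v → ¬ DrawnAs Δ.diagonals d x v → Δ.SideExcept d x v :=
    fun x v hxv hxv' => ((isSide_iff_sideExcept hd).1 hxv).resolve_right hxv'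
  refine ⟨h1, h2, h4, h3, key _ _ hQ.pq fun h' => ?_, key _ _ hQ.qr fun h' => ?_,
    key _ _ hQ.rs fun h' => ?_, key _ _ hQ.ps fun h' => ?_⟩ <;> rcases h with h | h <;>
    have h6 := hO.eq_of_lt h' h (by linarith) (by linarith)
  · have := h6.2
    norm_cast at this
    omega
  · omega
  · omega
  · exact h4.ne h6.2.symm
  · omega
  · omega
  · exact h4.ne h6.2
  · omega

/-- The flip of the diagonal `(p, r)` of a quadrilateral `p < q < r < s`. -/
theorem exists_flip_pr (hn : n ≠ 0) {p q r : ℤ} {s : WithTop ℤ}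
    (hQ : Quad n (IsSide Δ.diagonals) p q r s)
    (hd : ofChord p r hQ.le_pr hQ.lt_rp ∈ Δ.diagonals) :
    ∃ Δ' d', IsFlip Δ Δ' (ofChord p r hQ.le_pr hQ.lt_rp) d' ∧ d'.IsLift q s := by
  have hD := drawnAs_ofChord (Δ := Δ.diagonals) hQ.le_pr hQ.lt_rp
  have hL := (isLift_ofChord hQ.le_pr hQ.lt_rp).2 (ChordOrbit.self (n := n) p r)
  have hdarc : ∀ a ε, radius a ε ≠ ofChord p r hQ.le_pr hQ.lt_rp := by simp [ofChord]
  have h1 := hQ.lt_pq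
  have h2 := hQ.lt_qr
  have h3 := hQ.lt_rp
  have h4 := hQ.lt_rs
  have hcross : ChordsCross p r q s := Or.inl ⟨h1, mod_cast h2, h4⟩
  generalize hdd : ofChord p r hQ.le_pr hQ.lt_rp = d at *
  have hQ' := Δ.quad_sideExcept hn hd hQ (Or.inl (by rw [hD]; exact ChordOrbit.self _ _))
  have hu : ∀ e, (∀ x ∈ Δ.diagonals, x ≠ d → ¬ x.Crosses e) → e ∈ Δ.diagonals ∨ e.IsLift q s := by
    intro e he
    by_cases hm : e ∈ Δ.diagonals
    · exact Or.inl hm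
    right
    obtain ⟨f, hf, hfe⟩ := Δ.exists_crosses hm
    obtain rfl : f = d := by
      by_contra hfd
      exact he f hf hfd hfe
    obtain ⟨a, c, ε, h5, -⟩ | ⟨u, v, h5, h6⟩ := hfe.exists_isLift hn hL
    · exact (hdarc _ _ h5.symm).elim
    · obtain ⟨rfl, rfl⟩ := hQ.eq_qs h6 fun x y hxy hor =>
        IsSide.not_chordsCross hxy (fun g hg hgx => he g hg fun hgf => by
          rw [hgf, hD] at hgx
          obtain ⟨k, hk, hk'⟩ := hgx
          rcases hor with ⟨rfl, rfl⟩ | ⟨rfl, rfl⟩ | ⟨rfl, rfl⟩ | ⟨rfl, rfl⟩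
          · obtain rfl : k = 0 := eq_zero_of_mul_lt (n := n) (by linarith) (by linarith)
            norm_cast at hk'
            linarith
          · obtain rfl : k = 0 := eq_zero_of_mul_lt (n := n) (by linarith) (by linarith)
            linarith
          · obtain rfl : k = 0 := eq_zero_of_mul_lt (n := n) (by linarith) (by linarith)
            linarith
          · obtain rfl : k = 0 := eq_zero_of_mul_lt (n := n) (by linarith) (by linarith)
            rw [hk'] at h4
            simp at h4) h5
      exact h5
  have hc : ∀ e ∈ Δ.diagonals, e ≠ d → ∀ u v, e.IsLift u v → ¬ ChordsCross q s u v := by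
    intro e he hed u v huv hx
    obtain ⟨rfl, rfl⟩ := hQ.eq_pr hx fun x y hxy _ =>
      IsSide.not_chordsCross hxy (fun g hg _ => Δ.not_crosses hg he) huv
    exact hed ((eq_ofChord_of_isLift huv hQ.le_pr hQ.lt_rp).trans hdd)
  have hnm : ∀ e : Diagonal n, e.IsLift q s → e ∉ Δ.diagonals := fun e he hm =>
    Δ.not_crosses hd hm (crosses_of_isLift hL he hcross)
  -- For finite `s` the chord determines the diagonal. For `s = ⊤` it leaves the tag open, and the
  -- tag is forced to be that of the line at `p`.
  obtain ⟨d', hd', hdu, hrad, hdr⟩ : ∃ d' : Diagonal n, d'.IsLift q s ∧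
      (∀ e, (∀ x ∈ Δ.diagonals, x ≠ d → ¬ x.Crosses e) → e.IsLift q s → e = d') ∧
      (∀ a c ε, radius a ε ∈ Δ.diagonals → d' = radius c (!ε) → a = c) ∧
      (∀ D : Set (Diagonal n), D = insert d' (Δ.diagonals \ {d}) →
        DrawnAs D d' = ChordOrbit n q s) := by
    cases s with
    | top =>
      rcases hQ.ps.cases with h | ⟨z, -, -, h, -⟩ | ⟨-, ε, h5, h6⟩ | ⟨h, -⟩
      · exact (WithTop.top_ne_coe h).elim
      · exact (WithTop.top_ne_coe h).elim
      · refine ⟨radius (q : ZMod n) ε, ⟨rfl, rfl⟩, ?_, ?_, ?_⟩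
        · intro e he hq
          obtain ⟨ε', rfl⟩ := eq_radius_of_isLift hq
          by_contra hne
          refine he _ h5 (hdarc _ _) ⟨fun h => ?_, fun h => hne (by rw [h])⟩
          have := eq_of_intCast_eq h.symm (by linarith) (by linarith)
          omega
        · intro a c ε' ha hc
          injection hc with hc1 hc2
          by_contra hac
          refine Δ.not_crosses h5 ha ⟨fun h => ?_, by rw [hc2]; simp⟩
          rw [← h] at ha
          rw [hc2] at h6
          simp at h6
          exact h6 ha
        · rintro D rfl
          refine drawnAs_radius_of_notMem ?_
          rintro (h | h)
          · simp at h
          · exact hnm (radius (q : ZMod n) (!ε)) ⟨rfl, rfl⟩ h.1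
      · exact (WithTop.top_ne_coe h).elim
    | coe s =>
      have h5 := isSide_shortChords hn _ _ hQ.ps
      norm_cast at h4
      have h6 : q + 2 ≤ s := by omega
      have h7 : s < q + n := by linarith
      exact ⟨ofChord q s h6 h7, (isLift_ofChord h6 h7).2 (ChordOrbit.self _ _),
        fun e _ he => eq_ofChord_of_isLift he _ _, fun a c ε _ h => by simp [ofChord] at h,
        fun D _ => drawnAs_ofChord h6 h7⟩
  have hu' : ∀ e, (∀ x ∈ Δ.diagonals, x ≠ d → ¬ x.Crosses e) → e ∈ Δ.diagonals ∨ e = d' :=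
    fun e he => (hu e he).imp_right (hdu e he)
  obtain ⟨Δ', hΔ'⟩ := Δ.exists_exchange hd (hnm d' hd') (fun e he hed hcr => by
    obtain ⟨a, c, ε, rfl, h6, h7⟩ | ⟨u, v, h5, h6⟩ := hcr.symm.exists_isLift hn hd'
    · exact h7 (hrad c a (!ε) (by rwa [← h6]) (by simp)).symm
    · exact hc e he hed u v h5 h6) hu'
  refine ⟨Δ', d', isFlip_of_quad hn hΔ' (fun e he hed => ?_) hQ' hD
    (hdr _ hΔ'.eq), hd'⟩
  refine drawnAs_exchange hΔ' (fun a ε ha _ => ⟨hdarc _ _, fun h => ?_⟩) he hed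
  rw [← h] at hd'
  obtain ⟨rfl, rfl⟩ := hd'
  exact hnm (radius (q : ZMod n) ε) ⟨rfl, rfl⟩ ha

/-- The flip of the diagonal `(q, s)` of a quadrilateral `p < q < r < s`. -/
theorem exists_flip_qs (hn : n ≠ 0) {p q r : ℤ} {s : WithTop ℤ}
    (hQ : Quad n (IsSide Δ.diagonals) p q r s) {d : Diagonal n} (hd : d ∈ Δ.diagonals)
    (hL : d.IsLift q s) (hD : DrawnAs Δ.diagonals d = ChordOrbit n q s) :
    ∃ Δ' d', IsFlip Δ Δ' d d' := by
  have h1 := hQ.lt_pq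
  have h2 := hQ.lt_qr
  have h3 := hQ.lt_rp
  have h4 := hQ.lt_rs
  have hcross : ChordsCross p r q s := Or.inl ⟨h1, mod_cast h2, h4⟩
  have hQ' := Δ.quad_sideExcept hn hd hQ (Or.inr (by rw [hD]; exact ChordOrbit.self _ _))
  have hL' := (isLift_ofChord hQ.le_pr hQ.lt_rp).2 (ChordOrbit.self (n := n) p r)
  have hD' := fun D => drawnAs_ofChord (Δ := D) hQ.le_pr hQ.lt_rp
  have hdarc : ∀ a ε, radius a ε ≠ ofChord p r hQ.le_pr hQ.lt_rp := by simp [ofChord]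
  have hnm : ofChord p r hQ.le_pr hQ.lt_rp ∉ Δ.diagonals := fun hm =>
    Δ.not_crosses hm hd (crosses_of_isLift hL' hL hcross)
  have hnot : ∀ a ε, radius a ε ∈ Δ.diagonals → radius a (!ε) = d → False := by
    rintro a ε ha rfl
    obtain ⟨rfl, rfl⟩ := hL
    rw [drawnAs_radius_of_mem (by simpa using ha)] at hD
    have := ChordOrbit.self (n := n) q ⊤
    rw [← hD] at this
    obtain ⟨k, -, h⟩ := this
    norm_cast at h
  have hu : ∀ e, (∀ x ∈ Δ.diagonals, x ≠ d → ¬ x.Crosses e) →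
      e ∈ Δ.diagonals ∨ e = ofChord p r hQ.le_pr hQ.lt_rp := by
    intro e he
    by_cases hm : e ∈ Δ.diagonals
    · exact Or.inl hm
    right
    obtain ⟨f, hf, hfe⟩ := Δ.exists_crosses hm
    obtain rfl : f = d := by
      by_contra hfd
      exact he f hf hfd hfe
    obtain ⟨a, c, ε, rfl, rfl, hac⟩ | ⟨u, v, h5, h6⟩ := hfe.exists_isLift hn hL
    -- Could a line of the opposite tag replace the line `d`? The lines at `p` and `r` have the tag
    -- of `d` and stay, so it would have to end at both of them, but these are different border
    -- vertices.
    · obtain ⟨rfl, rfl⟩ := hL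
      have key : ∀ x : ℤ, IsSide Δ.diagonals x ⊤ → (q : ZMod n) ≠ x → (x : ZMod n) = c := by
        intro x hx hqx
        rcases hx.cases with h | ⟨z, -, -, h, -⟩ | ⟨-, ε', h5, h6⟩ | ⟨h, -⟩
        · exact (WithTop.top_ne_coe h).elim
        · exact (WithTop.top_ne_coe h).elim
        · by_contra hxc
          have h7 := he _ h5 (by simp [hqx.symm])
          rw [crosses_radius] at h7
          have h8 := Δ.not_crosses hf h5
          rw [crosses_radius] at h8
          have h9 : ε' = !ε := by
            by_contra h9
            exact h7 ⟨hxc, h9⟩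
          exact h8 ⟨hqx, by simp [h9]⟩
        · exact (WithTop.top_ne_coe h).elim
      have e1 := key p hQ.ps fun h => by
        have := eq_of_intCast_eq h (by linarith) (by linarith)
        omega
      have e2 := key r hQ.rs fun h => by
        have := eq_of_intCast_eq h (by linarith) (by linarith)
        omega
      have := eq_of_intCast_eq (e2.trans e1.symm) (by linarith) (by linarith)
      omega
    · obtain ⟨rfl, rfl⟩ := hQ.eq_pr h6 fun x y hxy hor =>
        IsSide.not_chordsCross hxy (fun g hg hgx => he g hg fun hgf => by
          rw [hgf, hD] at hgx
          obtain ⟨k, hk, hk'⟩ := hgx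
          rcases hor with ⟨rfl, rfl⟩ | ⟨rfl, rfl⟩ | ⟨rfl, rfl⟩ | ⟨rfl, rfl⟩
          · obtain rfl : k = 0 := eq_zero_of_mul_lt (n := n) (by linarith) (by linarith)
            linarith
          · obtain rfl : k = 0 := eq_zero_of_mul_lt (n := n) (by linarith) (by linarith)
            rw [hk'] at h4
            simp at h4
          · obtain rfl : k = 0 := eq_zero_of_mul_lt (n := n) (by linarith) (by linarith)
            linarith
          · obtain rfl : k = 0 := eq_zero_of_mul_lt (n := n) (by linarith) (by linarith)
            linarith) h5
      exact eq_ofChord_of_isLift h5 _ _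
  have hc : ∀ e ∈ Δ.diagonals, e ≠ d → ¬ e.Crosses (ofChord p r hQ.le_pr hQ.lt_rp) := by
    intro e he hed hcr
    obtain ⟨a, c, ε, h5, -⟩ | ⟨u, v, h5, h6⟩ := hcr.symm.exists_isLift hn hL'
    · exact hdarc _ _ h5.symm
    · obtain ⟨rfl, rfl⟩ := hQ.eq_qs h6 fun x y hxy _ =>
        IsSide.not_chordsCross hxy (fun g hg _ => Δ.not_crosses hg he) h5
      cases v with
      | top =>
        obtain ⟨ε, rfl⟩ := eq_radius_of_isLift h5
        obtain ⟨ε', rfl⟩ := eq_radius_of_isLift hL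
        have h7 : ε ≠ ε' := fun h => hed (by rw [h])
        exact hnot _ _ he (by rw [← Bool.eq_not_iff.2 h7.symm])
      | coe s =>
        have h7 := isSide_shortChords hn _ _ hQ.ps
        norm_cast at h4
        exact hed ((eq_ofChord_of_isLift h5 (by omega) (by linarith)).trans
          (eq_ofChord_of_isLift hL (by omega) (by linarith)).symm)
  obtain ⟨Δ', hΔ'⟩ := Δ.exists_exchange hd hnm hc hu
  have hdr : ∀ e ∈ Δ.diagonals, e ≠ d → DrawnAs Δ'.diagonals e = DrawnAs Δ.diagonals e :=
    fun e he hed => drawnAs_exchange hΔ' (fun a ε ha _ => ⟨hnot a ε ha, hdarc _ _⟩) he hed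
  -- The reverse exchange replaces `(p, r)` by `(q, s)`; its flip is computed and then inverted.
  refine ⟨Δ', _, (isFlip_of_quad hn hΔ'.symm (fun e he hed => ?_) ?_ (hD' _) hD).symm⟩
  · obtain ⟨h5, h6⟩ := (hΔ'.mem_and_ne_iff e).1 ⟨he, hed⟩
    exact (hdr e h5 h6).symm
  · rwa [sideExcept_exchange hΔ' hdr]

end Triangulation

/-! ### Flips between a double line and two single lines. -/

namespace Triangulation

variable {n : ℕ} (Δ : Triangulation n)

/-- The border edges and the chords over arcs of `Δ`. -/
def ArcSide (x : ℤ) (v : WithTop ℤ) : Prop :=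
  v = ((x + 1 : ℤ) : WithTop ℤ) ∨
    ∃ a b h h', arc a b h h' ∈ Δ.diagonals ∧ (arc a b h h' : Diagonal n).IsLift x v

theorem arcSide_shiftInvariant (hn : n ≠ 0) : ShiftInvariant n Δ.ArcSide := by
  rintro x y k (rfl | ⟨a, b, h, h', hm, hl⟩)
  · left
    norm_cast
    ring_nf
  · exact Or.inr ⟨a, b, h, h', hm, (isChordOrbit_isLift hn _).shiftInvariant _ _ k hl⟩

theorem ArcSide.short {Δ : Triangulation n} (hn : 2 ≤ n) {x : ℤ} {v : WithTop ℤ}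
    (h : Δ.ArcSide x v) : ∃ z : ℤ, v = z ∧ x < z ∧ z < x + n := by
  rcases h with rfl | ⟨a, b, h, h', -, -, z, hz, -, h1, h2⟩
  · exact ⟨x + 1, rfl, by omega, by omega⟩
  · exact ⟨z, hz, h1, h2⟩

/-- A line ending elsewhere would cross the one at `a` that has the opposite tag. -/
theorem eq_of_double {a c : ZMod n} (ha : ∀ ε, radius a ε ∈ Δ.diagonals) {ε : Bool}
    (hc : radius c ε ∈ Δ.diagonals) : c = a := by
  by_contra h
  exact Δ.not_crosses hc (ha (!ε)) ⟨h, by simp⟩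

theorem isSide_iff_of_double {a : ℤ} (ha : ∀ ε, radius (a : ZMod n) ε ∈ Δ.diagonals) :
    IsSide Δ.diagonals = fun x v => Δ.ArcSide x v ∨ ChordOrbit n a (a + n : ℤ) x v := by
  funext x v
  refine propext ⟨?_, ?_⟩
  · rintro (h | ⟨e, he, h⟩)
    · exact Or.inl (Or.inl h)
    · cases e with
      | arc => exact Or.inl (Or.inr ⟨_, _, _, _, he, h⟩)
      | radius c ε =>
        obtain rfl := Δ.eq_of_double ha he
        rw [drawnAs_radius_of_mem (ha _)] at h
        exact Or.inr h
  · rintro ((h | ⟨a, b, h1, h2, he, h⟩) | h)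
    · exact Or.inl h
    · exact Or.inr ⟨_, he, h⟩
    · exact Or.inr ⟨_, ha true, by rwa [drawnAs_radius_of_mem (ha _)]⟩

/-- An exchange in a monogon is a flip. -/
theorem isFlip_of_monogon (hn : 2 ≤ n) {Δ Δ' : Triangulation n} {a y : ℤ} {ε : Bool}
    (h : IsExchange Δ Δ' (radius (a : ZMod n) (!ε)) (radius (y : ZMod n) ε))
    (ha : radius (a : ZMod n) ε ∈ Δ.diagonals) (hay : a < y) (hya : y < a + n)
    (h1 : IsSide Δ.diagonals a y) (h2 : IsSide Δ.diagonals y (a + n : ℤ)) :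
    IsFlip Δ Δ' (radius (a : ZMod n) (!ε)) (radius (y : ZMod n) ε) := by
  have hn0 : n ≠ 0 := by omega
  have ha2 : ∀ ε, radius (a : ZMod n) ε ∈ Δ.diagonals := fun ε' => by
    by_cases hε : ε' = ε
    · rwa [hε]
    · rw [Bool.eq_not_iff.2 hε]
      exact h.mem
  have hS := Δ.isSide_iff_of_double ha2
  have hne : (y : ZMod n) ≠ a := fun h => by
    have := eq_of_intCast_eq h (by linarith) (by linarith)
    omega
  have hma' : radius (a : ZMod n) ε ∈ Δ'.diagonals := by
    rw [h.eq]
    exact Or.inr ⟨ha, by simp⟩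
  have hL : ∀ ε, DrawnAs Δ.diagonals (radius (a : ZMod n) ε) = ChordOrbit n a (a + n : ℤ) :=
    fun ε => drawnAs_radius_of_mem (ha2 _)
  have hA : DrawnAs Δ'.diagonals (radius (a : ZMod n) ε) = ChordOrbit n a ⊤ :=
    drawnAs_radius_of_notMem h.symm.notMem
  have hY : DrawnAs Δ'.diagonals (radius (y : ZMod n) ε) = ChordOrbit n y ⊤ := by
    refine drawnAs_radius_of_notMem ?_
    rw [h.eq]
    rintro (h3 | ⟨h3, -⟩)
    · simp at h3
    · exact hne (Δ.eq_of_double ha2 h3)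
  have harc : ∀ a b h1 h2, arc a b h1 h2 ∈ Δ'.diagonals ↔ arc a b h1 h2 ∈ Δ.diagonals := by
    intro a b h1 h2
    rw [h.eq]
    simp
  have hS' : IsSide Δ'.diagonals = Monogon.withLines n Δ.ArcSide a y := by
    funext x v
    refine propext ⟨?_, ?_⟩
    · rintro (h3 | ⟨e, he, h3⟩)
      · exact Or.inl (Or.inl h3)
      · cases e with
        | arc => exact Or.inl (Or.inr ⟨_, _, _, _, (harc _ _ _ _).1 he, h3⟩)
        | radius c ε' =>
          by_cases hc : radius c ε' = radius (y : ZMod n) ε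
          · rw [hc, hY] at h3
            exact Or.inr (Or.inr h3)
          · obtain ⟨h4, h5⟩ := (h.mem_and_ne_iff _).1 ⟨he, hc⟩
            obtain rfl := Δ.eq_of_double ha2 h4
            obtain rfl : ε' = ε := by
              by_contra hε
              exact h5 (by rw [Bool.eq_not_iff.2 hε])
            rw [hA] at h3
            exact Or.inr (Or.inl h3)
    · rintro ((h3 | ⟨a, b, h3, h4, he, h5⟩) | h3 | h3)
      · exact Or.inl h3
      · exact Or.inr ⟨_, (harc _ _ _ _).2 he, h5⟩
      · exact Or.inr ⟨_, hma', by rwa [hA]⟩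
      · exact Or.inr ⟨_, h.mem_right, by rwa [hY]⟩
  have nc := Δ.nonCrossing
  rw [hS] at h1 h2 nc
  have hM : Monogon n Δ.ArcSide a y := by
    refine ⟨hay, hya, fun x v h => h.short hn, h1.resolve_right ?_, h2.resolve_right ?_⟩
    · rintro ⟨k, hk, hk'⟩
      obtain rfl : k = 0 := eq_zero_of_mul_lt (n := n) (by linarith) (by linarith)
      norm_cast at hk'
      linarith
    · rintro ⟨k, hk, hk'⟩
      obtain rfl : k = 0 := eq_zero_of_mul_lt (n := n) (by linarith) (by linarith)
      linarith
  have key : ∀ b c h1 h2, arc b c h1 h2 ∈ Δ.diagonals → ∀ b' c' h1' h2',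
      arc b' c' h1' h2' ∈ Δ.diagonals → _ := fun b c h1 h2 he b' c' h1' h2' hf =>
    hM.arrowCount_flip (Δ.arcSide_shiftInvariant hn0) nc
      (isChordOrbit_drawnAs (Δ := Δ.diagonals) hn0 (arc b c h1 h2))
      (isChordOrbit_drawnAs (Δ := Δ.diagonals) hn0 (arc b' c' h1' h2'))
      (fun x y hxy => Or.inr ⟨_, _, _, _, he, hxy⟩) (fun x y hxy => Or.inr ⟨_, _, _, _, hf, hxy⟩)
      (hL ε) hS hS' hA hY
  have hcase : ∀ e ∈ Δ.diagonals, e ≠ radius (a : ZMod n) (!ε) →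
      e = radius (a : ZMod n) ε ∨ ∃ b c h1 h2, e = arc b c h1 h2 := by
    intro e he hea
    cases e with
    | arc => exact Or.inr ⟨_, _, _, _, rfl⟩
    | radius c ε' =>
      left
      obtain rfl := Δ.eq_of_double ha2 he
      by_contra hε
      exact hea (by rw [Bool.eq_not_iff.2 fun h : ε' = ε => hε (by rw [h])])
  -- Both lines at `a` are drawn as the same loop, so their arrows agree and there is none between
  -- them. Mutation at one of them therefore leaves the arrows of the other unchanged.
  have hLL : Δ.arrow (radius (a : ZMod n) (!ε)) = Δ.arrow (radius (a : ZMod n) ε) := by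
    funext e
    unfold Triangulation.arrow
    rw [hL, hL]
  have hLL' : ∀ e, Δ.arrow e (radius (a : ZMod n) (!ε)) = Δ.arrow e (radius (a : ZMod n) ε) := by
    intro e
    unfold Triangulation.arrow
    rw [hL, hL]
  have h0 : Δ.arrow (radius (a : ZMod n) ε) (radius (a : ZMod n) ε) = 0 := arrowCount_self _ _
  have hlines := hM.chordArrow_lines
  rw [← hS', ← hA, ← hY] at hlines
  refine ⟨h, ?_, ?_, ?_⟩
  · intro e he hed
    rw [hLL']
    rcases hcase e he hed with rfl | ⟨b, c, h1, h2, rfl⟩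
    · rw [h0]
      exact arrowCount_eq_zero hlines.1
    · exact (key _ _ _ _ he _ _ _ _ he).1.2.2.1
  · intro e he hed
    rw [hLL]
    rcases hcase e he hed with rfl | ⟨b, c, h1, h2, rfl⟩
    · rw [h0]
      exact arrowCount_eq_zero hlines.2
    · exact (key _ _ _ _ he _ _ _ _ he).1.2.2.2
  · intro e he hed f hf hfd
    rw [hLL, hLL']
    simp only [hLL']
    rcases hcase e he hed with rfl | ⟨b, c, h1, h2, rfl⟩ <;>
      rcases hcase f hf hfd with rfl | ⟨b', c', h1', h2', rfl⟩
    · rw [h0]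
      simpa using show Δ'.arrow _ _ = 0 from arrowCount_self _ _
    · rw [h0]
      have h5 := (key _ _ _ _ hf _ _ _ _ hf).1.2.1
      have h6 := arrowCount_eq_zero_or (IsSide Δ.diagonals)
        (DrawnAs Δ.diagonals (radius (a : ZMod n) ε)) (DrawnAs Δ.diagonals (arc b' c' h1' h2'))
      change Δ'.arrow (radius (a : ZMod n) ε) (arc b' c' h1' h2') = Δ.arrow _ _ at h5
      change Δ.arrow _ _ = 0 ∨ Δ.arrow _ _ = 0 at h6
      rw [h5]
      rcases h6 with h6 | h6 <;> rw [h6] <;> simp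
    · rw [h0]
      have h5 := (key _ _ _ _ he _ _ _ _ he).1.1
      have h6 := arrowCount_eq_zero_or (IsSide Δ.diagonals)
        (DrawnAs Δ.diagonals (radius (a : ZMod n) ε)) (DrawnAs Δ.diagonals (arc b c h1 h2))
      change Δ'.arrow (arc b c h1 h2) (radius (a : ZMod n) ε) = Δ.arrow _ _ at h5
      change Δ.arrow _ _ = 0 ∨ Δ.arrow _ _ = 0 at h6
      rw [h5]
      rcases h6 with h6 | h6 <;> rw [h6] <;> simp
    · exact (key _ _ _ _ he _ _ _ _ hf).2

/-- No arc avoiding the sides of the triangle `a < y < a + n` passes over `y`. -/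
theorem not_isLift_over {a y u v : ℤ}
    {e : Diagonal n} (he : e.IsLift u v) (huy : u < y) (hyv : y < v)
    (h1 : ¬ ChordsCross a y u v) (h2 : ¬ ChordsCross y (a + n : ℤ) u v) : False := by
  cases e with
  | radius c ε => exact WithTop.coe_ne_top he.2
  | arc b c h h' =>
    obtain ⟨-, z, hz, -, h5, h6⟩ := he
    norm_cast at hz
    subst hz
    have h7 : u ≤ a := by
      by_contra! h7
      exact h1 (Or.inl ⟨h7, mod_cast huy, mod_cast hyv⟩)
    have h8 : a + n ≤ v := by
      by_contra! h8
      exact h2 (Or.inr ⟨huy, mod_cast hyv, mod_cast h8⟩)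
    linarith

/-- The flip of one of two lines with the same border vertex. -/
theorem exists_flip_of_double (hn : 2 ≤ n) {a : ℤ} (ha : ∀ ε, radius (a : ZMod n) ε ∈ Δ.diagonals)
    (ε : Bool) : ∃ Δ' y, IsFlip Δ Δ' (radius (a : ZMod n) (!ε)) (radius y ε) := by
  have hn0 : n ≠ 0 := by omega
  -- The replacement ends at the third vertex of the triangle inside the loop and has the tag of the
  -- line that is kept.
  obtain ⟨y, hay, hya, h1, h2⟩ := Δ.exists_inner hn0 (isSide_loop ha) (by omega)
  have hne : (y : ZMod n) ≠ a := fun h => by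
    have := eq_of_intCast_eq h (by linarith) (by linarith)
    omega
  have hnm : radius (y : ZMod n) ε ∉ Δ.diagonals := fun h => hne (Δ.eq_of_double ha h)
  have hD := drawnAs_radius_of_mem (ha (!(!ε)))
  have hd1 : ¬ DrawnAs Δ.diagonals (radius (a : ZMod n) (!ε)) a y := by
    rw [hD]
    rintro ⟨k, hk, hk'⟩
    obtain rfl : k = 0 := eq_zero_of_mul_lt (n := n) (by linarith) (by linarith)
    norm_cast at hk'
    linarith
  have hd2 : ¬ DrawnAs Δ.diagonals (radius (a : ZMod n) (!ε)) y (a + n : ℤ) := by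
    rw [hD]
    rintro ⟨k, hk, hk'⟩
    obtain rfl : k = 0 := eq_zero_of_mul_lt (n := n) (by linarith) (by linarith)
    linarith
  obtain ⟨Δ', hΔ'⟩ := Δ.exists_exchange (ha (!ε)) hnm (fun e he hed hcr => by
      obtain ⟨b, c, ε', h3, rfl, h5⟩ | ⟨u, v, h3, h4⟩ :=
        hcr.symm.exists_isLift hn0 (isLift_radius.2 (ChordOrbit.self _ _))
      · injection h3 with _ h6
        rw [← h6] at hed he
        exact hed (by rw [Δ.eq_of_double ha he])
      · rcases h4 with ⟨h5, h6, h7⟩ | ⟨h5, h6, h7⟩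
        · exact not_top_lt h7
        · obtain ⟨v, rfl⟩ := WithTop.ne_top_iff_exists.1 h7.ne
          exact not_isLift_over (a := a) h3 h5 (mod_cast h6)
            (h1.not_chordsCross (fun d hd _ => Δ.not_crosses hd he) h3)
            (h2.not_chordsCross (fun d hd _ => Δ.not_crosses hd he) h3)) (fun e he => by
      by_cases hm : e ∈ Δ.diagonals
      · exact Or.inl hm
      right
      obtain ⟨f, hf, hfe⟩ := Δ.exists_crosses hm
      obtain rfl : f = radius (a : ZMod n) (!ε) := by
        by_contra hfd
        exact he f hf hfd hfe
      obtain ⟨b, c, ε', h3, rfl, h5⟩ | ⟨u, v, h3, h4⟩ :=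
        hfe.exists_isLift hn0 (isLift_radius.2 (ChordOrbit.self _ _))
      · injection h3 with h7 h6
        subst h7 h6
        obtain ⟨z, hz1, hz2, rfl⟩ := ZMod.exists_intCast_eq hn0 c a
        have hza : z ≠ a := fun h => h5 (by rw [h])
        have hl : (radius (z : ZMod n) (!(!ε))).IsLift z ⊤ := ⟨rfl, rfl⟩
        rw [Bool.not_not] at *
        rcases lt_trichotomy z y with h8 | rfl | h8
        · exact (h1.not_chordsCross (fun d hd hdx => he d hd fun h => hd1 (h ▸ hdx)) hl
            (Or.inl ⟨by omega, mod_cast h8, WithTop.coe_lt_top _⟩)).elim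
        · rfl
        · exact (h2.not_chordsCross (fun d hd hdx => he d hd fun h => hd2 (h ▸ hdx)) hl
            (Or.inl ⟨h8, mod_cast hz2, WithTop.coe_lt_top _⟩)).elim
      · exact (he _ (ha ε) (by simp)
          (crosses_of_isLift (isLift_radius.2 (ChordOrbit.self _ _)) h3 h4)).elim)
  exact ⟨Δ', y, isFlip_of_monogon hn hΔ' (ha ε) hay hya h1 h2⟩

/-- The flip of one of two lines with the same tag, when there is no third line. -/
theorem exists_flip_of_two_lines (hn : 2 ≤ n) {a y : ℤ} {ε : Bool} (hay : a < y) (hya : y < a + n)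
    (ha : IsSide Δ.diagonals a ⊤) (hy : radius (y : ZMod n) ε ∈ Δ.diagonals)
    (hy' : radius (y : ZMod n) (!ε) ∉ Δ.diagonals)
    (h1 : IsSide Δ.diagonals a y) (h2 : IsSide Δ.diagonals y (a + n : ℤ)) :
    ∃ Δ' d', IsFlip Δ Δ' (radius (y : ZMod n) ε) d' := by
  have hn0 : n ≠ 0 := by omega
  have hne : (y : ZMod n) ≠ a := fun h => by
    have := eq_of_intCast_eq h (by linarith) (by linarith)
    omega
  obtain ⟨ha1, ha2⟩ : radius (a : ZMod n) ε ∈ Δ.diagonals ∧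
      radius (a : ZMod n) (!ε) ∉ Δ.diagonals := by
    rcases ha.cases with h | ⟨z, -, -, h, -⟩ | ⟨-, ε', h3, h4⟩ | ⟨h, -⟩
    · exact (WithTop.top_ne_coe h).elim
    · exact (WithTop.top_ne_coe h).elim
    · obtain rfl : ε' = ε := by
        by_contra h
        exact Δ.not_crosses h3 hy ⟨hne.symm, h⟩
      exact ⟨h3, h4⟩
    · exact (WithTop.top_ne_coe h).elim
  have hD := drawnAs_radius_of_notMem hy'
  have hd : ∀ x z : ℤ, ¬ DrawnAs Δ.diagonals (radius (y : ZMod n) ε) x z := by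
    rw [hD]
    rintro x z ⟨k, hk, hk'⟩
    exact WithTop.coe_ne_top hk'
  obtain ⟨Δ', hΔ'⟩ := Δ.exists_exchange (d' := radius (a : ZMod n) (!ε)) hy ha2
    (fun e he hed hcr => by
      obtain ⟨b, c, ε', h3, rfl, h5⟩ | ⟨u, v, h3, h4⟩ :=
        hcr.symm.exists_isLift hn0 (isLift_radius.2 (ChordOrbit.self _ _))
      · injection h3 with h7 h6
        subst h7 h6
        rw [Bool.not_not] at *
        obtain ⟨z, hz1, hz2, rfl⟩ := ZMod.exists_intCast_eq hn0 c a
        have hza : z ≠ a := fun h => h5 (by rw [h])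
        have hl : (radius (z : ZMod n) ε).IsLift z ⊤ := ⟨rfl, rfl⟩
        rcases lt_trichotomy z y with h8 | rfl | h8
        · exact (h1.not_chordsCross (fun d hd _ => Δ.not_crosses hd he) hl
            (Or.inl ⟨by omega, mod_cast h8, WithTop.coe_lt_top _⟩)).elim
        · exact hed rfl
        · exact (h2.not_chordsCross (fun d hd _ => Δ.not_crosses hd he) hl
            (Or.inl ⟨h8, mod_cast hz2, WithTop.coe_lt_top _⟩)).elim
      · exact (Δ.not_crosses ha1 he
          (crosses_of_isLift (isLift_radius.2 (ChordOrbit.self _ _)) h3 h4)).elim) (fun e he => by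
      by_cases hm : e ∈ Δ.diagonals
      · exact Or.inl hm
      right
      obtain ⟨f, hf, hfe⟩ := Δ.exists_crosses hm
      obtain rfl : f = radius (y : ZMod n) ε := by
        by_contra hfd
        exact he f hf hfd hfe
      obtain ⟨b, c, ε', h3, rfl, h5⟩ | ⟨u, v, h3, h4⟩ :=
        hfe.exists_isLift hn0 (isLift_radius.2 (ChordOrbit.self _ _))
      · injection h3 with h7 h6
        subst h7 h6
        by_contra hc
        exact he _ ha1 (by simp [hne.symm]) ⟨fun h => hc (by rw [h]), by simp⟩
      · rcases h4 with ⟨h5, h6, h7⟩ | ⟨h5, h6, h7⟩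
        · exact (not_top_lt h7).elim
        · obtain ⟨v, rfl⟩ := WithTop.ne_top_iff_exists.1 h7.ne
          exact (not_isLift_over (a := a) h3 h5 (mod_cast h6)
            (h1.not_chordsCross (fun d hd' hdx => he d hd' fun h => hd _ _ (h ▸ hdx)) h3)
            (h2.not_chordsCross (fun d hd' hdx => he d hd' fun h => hd _ _ (h ▸ hdx)) h3)).elim)
  have hside : ∀ x z : ℤ, IsSide Δ.diagonals x z → z < x + n → IsSide Δ'.diagonals x z := by
    intro x z hxz hlt
    rcases hxz.cases with h | ⟨t, h3, h4, h, h5⟩ | ⟨h, -⟩ | ⟨h, -⟩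
    · exact Or.inl h
    · rw [h]
      refine isSide_ofChord (h := h3) (h' := h4) ?_
      rw [hΔ'.eq]
      exact Or.inr ⟨h5, by simp [ofChord]⟩
    · exact (WithTop.coe_ne_top h).elim
    · norm_cast at h
      omega
  refine ⟨Δ', _, (isFlip_of_monogon hn hΔ'.symm ?_ hay hya (hside _ _ h1 hya)
    (hside _ _ h2 (by linarith))).symm⟩
  rw [hΔ'.eq]
  exact Or.inr ⟨ha1, by simp [hne.symm]⟩

end Triangulation

/-! ### Existence of flips, and reduction to wheels. -/

namespace Triangulation

variable {n : ℕ} (Δ : Triangulation n)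

/-- Every diagonal of a triangulation can be flipped. -/
theorem exists_flip (hn : 2 ≤ n) {d : Diagonal n} (hd : d ∈ Δ.diagonals) :
    ∃ Δ' d', IsFlip Δ Δ' d d' := by
  have hn0 : n ≠ 0 := by omega
  cases d with
  | arc a b h h' =>
    obtain ⟨x, rfl⟩ := ZMod.intCast_surjective a
    obtain ⟨z, h1, h2, h3⟩ := exists_ofChord hn0 _ b h h' x rfl
    rw [h3] at hd ⊢
    have hside := isSide_ofChord hd
    obtain ⟨y, hxy, hyz, h4, h5⟩ := Δ.exists_inner hn0 hside h1
    -- The two triangles at the arc form a quadrilateral. The arc is its diagonal `(p, r)` or `(q,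
    -- s)`, depending on the end beyond which the outer vertex lies.
    rcases Δ.exists_outer hn0 hside h2 with ⟨w, h6, h7, h8⟩ | ⟨w, h6, h7, h8⟩
    · obtain ⟨Δ', d', h9, -⟩ := Δ.exists_flip_pr hn0 (q := y) ⟨hxy, hyz, h6, h2, h4, h5, h8, h7⟩ hd
      exact ⟨Δ', d', h9⟩
    · have h9 := isSide_shortChords hn0 _ _ h8
      exact Δ.exists_flip_qs hn0 ⟨h6, hxy, mod_cast hyz, by linarith, h7, h4, h5, h8⟩ hd
        ((isLift_ofChord h1 h2).2 (ChordOrbit.self _ _)) (drawnAs_ofChord h1 h2)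
  | radius a ε =>
    obtain ⟨x, rfl⟩ := ZMod.intCast_surjective a
    by_cases hm : radius (x : ZMod n) (!ε) ∈ Δ.diagonals
    · have := Δ.exists_flip_of_double hn (a := x) (fun ε' => by
        by_cases hε : ε' = ε
        · rwa [hε]
        · rwa [Bool.eq_not_iff.2 hε]) (!ε)
      rw [Bool.not_not] at this
      obtain ⟨Δ', y, h⟩ := this
      exact ⟨Δ', _, h⟩
    · have hx := isSide_top hd hm
      obtain ⟨p, h1, h2, h3, h4, h5⟩ := Δ.exists_prev_line hn0 hx
      obtain ⟨r, h6, h7, h8, h9, h10⟩ := Δ.exists_next_line hn0 hx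
      have h11 : IsSide Δ.diagonals (p + n) ⊤ := by
        have := isSide_shiftInvariant hn0 _ _ 1 h3
        rwa [one_mul] at this
      -- There is also a line at `p + n`, so the next line after `x` comes no later. Equality means
      -- that there are just two lines up to translation, and then the partner is a double line
      -- instead of an arc.
      have h12 : r ≤ p + n := by
        by_contra! h12
        exact h10 _ h2 h12 h11
      rcases h12.eq_or_lt with rfl | h12
      · exact Δ.exists_flip_of_two_lines hn h1 h2 h3 hd hm h4 h9
      · exact Δ.exists_flip_qs hn0 ⟨h1, h6, WithTop.coe_lt_top _, h12, h4, h9, h8, h3⟩ hd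
          ⟨rfl, rfl⟩ (drawnAs_radius_of_notMem hm)

/-- The border vertices joined to the puncture. -/
def lineEnds : Set (ZMod n) := {c | ∃ ε, radius c ε ∈ Δ.diagonals}

theorem isSide_top_of_mem (h : ∀ a : ZMod n, ∃ ε, radius a ε ∉ Δ.diagonals) {x : ℤ} {ε : Bool}
    (hx : radius (x : ZMod n) ε ∈ Δ.diagonals) : IsSide Δ.diagonals x ⊤ := by
  refine isSide_top hx fun hx' => ?_
  obtain ⟨ε', h'⟩ := h x
  by_cases hε : ε' = ε
  · exact h' (by rwa [hε])
  · exact h' (by rwa [Bool.eq_not_iff.2 hε])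

/-- Unless all border vertices are joined to the puncture, there are two consecutive lines to the
puncture whose endpoints are joined by an arc. -/
theorem exists_consecutive_lines (hn : 2 ≤ n) (hd : ∀ a : ZMod n, ∃ ε, radius a ε ∉ Δ.diagonals)
    (h : ¬ ∀ x : ℤ, IsSide Δ.diagonals x ⊤) :
    ∃ (p r : ℤ) (h1 : p + 2 ≤ r) (h2 : r < p + n), ofChord p r h1 h2 ∈ Δ.diagonals ∧
      IsSide Δ.diagonals p ⊤ ∧ IsSide Δ.diagonals r ⊤ ∧
      ∀ m, p < m → m < r → ¬ IsSide Δ.diagonals m ⊤ := by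
  have hn0 : n ≠ 0 := by omega
  obtain ⟨p, hp, hp'⟩ : ∃ p : ℤ, IsSide Δ.diagonals p ⊤ ∧ ¬ IsSide Δ.diagonals (p + 1) ⊤ := by
    by_contra! hall
    obtain ⟨x, ε, hx⟩ := Δ.exists_radius hn0
    have h1 : ∀ k : ℕ, IsSide Δ.diagonals (x + k) ⊤ := by
      intro k
      induction k with
      | zero => simpa using Δ.isSide_top_of_mem hd hx
      | succ k ih => simpa [add_assoc] using hall _ ih
    refine h fun y => ?_
    obtain ⟨z, hz1, hz2, hz3⟩ := ZMod.exists_intCast_eq hn0 (y : ZMod n) x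
    obtain ⟨k, rfl⟩ := ZMod.intCast_eq_iff_exists.1 hz3
    have h2 := h1 (y + k * n - x).toNat
    rw [Int.toNat_of_nonneg (by linarith), add_sub_cancel] at h2
    exact ((isSide_shiftInvariant hn0).iff y ⊤ k).1 h2
  obtain ⟨r, h1, h2, h3, h4, h5⟩ := Δ.exists_next_line hn0 hp
  have h6 : p + 2 ≤ r := by
    by_contra! h6
    obtain rfl : r = p + 1 := by omega
    exact hp' h3
  refine ⟨p, r, h6, h2, ?_, hp, h3, h5⟩
  rcases h4.cases with h | ⟨z, h7, h8, h, h9⟩ | ⟨h, -⟩ | ⟨h, -⟩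
  · norm_cast at h
    omega
  · norm_cast at h
    subst h
    exact h9
  · exact (WithTop.coe_ne_top h).elim
  · norm_cast at h
    omega

/-- Unless all border vertices are joined to the puncture, some flip increases their number. -/
theorem exists_flip_lineEnds (hn : 2 ≤ n) (h : ¬ ∀ x : ℤ, IsSide Δ.diagonals x ⊤) :
    ∃ Δ' d d', IsFlip Δ Δ' d d' ∧ Δ.lineEnds ⊂ Δ'.lineEnds := by
  have hn0 : n ≠ 0 := by omega
  by_cases hdouble : ∃ a : ZMod n, ∀ ε, radius a ε ∈ Δ.diagonals
  · obtain ⟨a, ha⟩ := hdouble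
    obtain ⟨a, rfl⟩ := ZMod.intCast_surjective a
    obtain ⟨Δ', y, hf⟩ := Δ.exists_flip_of_double hn ha true
    refine ⟨Δ', _, _, hf, Set.ssubset_iff_exists.2 ⟨?_, y, ⟨_, hf.mem_right⟩, ?_⟩⟩
    · rintro c ⟨ε, hc⟩
      obtain rfl := Δ.eq_of_double ha hc
      refine ⟨true, ?_⟩
      rw [hf.eq]
      exact Or.inr ⟨ha _, by simp⟩
    · rintro ⟨ε, hc⟩
      obtain rfl := Δ.eq_of_double ha hc
      exact hf.notMem (ha _)
  · push Not at hdouble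
    obtain ⟨p, r, h6, h2, hd, hp, h3, h5⟩ := Δ.exists_consecutive_lines hn hdouble h
    have h4 := isSide_ofChord hd
    obtain ⟨q, h7, h8, h9, h10⟩ := Δ.exists_inner hn0 h4 h6
    -- The arc separates its inner vertex `q` from the puncture. Its replacement is a line at `q`,
    -- and no existing line is lost.
    obtain ⟨Δ', d', hf, hl⟩ := Δ.exists_flip_pr hn0
      ⟨h7, h8, WithTop.coe_lt_top _, h2, h9, h10, h3, hp⟩ hd
    obtain ⟨ε, rfl⟩ := eq_radius_of_isLift hl
    refine ⟨Δ', _, _, hf, Set.ssubset_iff_exists.2 ⟨?_, q, ⟨_, hf.mem_right⟩, ?_⟩⟩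
    · rintro c ⟨ε, hc⟩
      refine ⟨ε, ?_⟩
      rw [hf.eq]
      exact Or.inr ⟨hc, by simp [ofChord]⟩
    · rintro ⟨ε, hc⟩
      exact h5 q h7 h8 (Δ.isSide_top_of_mem hdouble hc)

/-- A property that can be pulled back along flips, and which holds for triangulations all of whose
diagonals end at the puncture, holds for all triangulations. -/
theorem flip_induction (hn : 2 ≤ n) {P : Triangulation n → Prop}
    (hP : ∀ Δ Δ' d d', IsFlip Δ Δ' d d' → P Δ' → P Δ)
    (h0 : ∀ Δ : Triangulation n, (∀ x : ℤ, IsSide Δ.diagonals x ⊤) → P Δ) (Δ : Triangulation n) :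
    P Δ := by
  have : NeZero n := ⟨by omega⟩
  have hfin : ∀ s : Set (ZMod n), s.Finite := fun s => Set.toFinite s
  generalize hm : (Δ.lineEndsᶜ).ncard = m
  induction m using Nat.strong_induction_on generalizing Δ with
  | _ m ih =>
    by_cases h : ∀ x : ℤ, IsSide Δ.diagonals x ⊤
    · exact h0 Δ h
    · obtain ⟨Δ', d, d', hf, hss⟩ := Δ.exists_flip_lineEnds hn h
      refine hP _ _ _ _ hf (ih _ ?_ Δ' rfl)
      rw [← hm]
      exact Set.ncard_lt_ncard (compl_lt_compl_iff_lt.2 hss) (hfin _)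

/-! ### Labelled triangulations. -/

/-- The map `g` identifies the quiver `Q` with the quiver of `Δ`. -/
structure IsLabelling {V : Type} (Q : ClusterQuiver V) (Δ : Triangulation n)
    (g : V → Diagonal n) : Prop where
  injective : Function.Injective g
  range : Set.range g = Δ.diagonals
  arrow : ∀ i j, Δ.arrow (g i) (g j) = Q.arrows i j

theorem IsLabelling.mem {V : Type} {Q : ClusterQuiver V} {Δ : Triangulation n}
    {g : V → Diagonal n} (h : IsLabelling Q Δ g) (i : V) : g i ∈ Δ.diagonals := by
  rw [← h.range]
  exact Set.mem_range_self i

/-- Since mutation keeps the vertex set, the label `k` simply passes to the new diagonal. This is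
how flips and mutations run in parallel in both halves of the theorem. -/
theorem IsLabelling.mutate {V : Type} [DecidableEq V] {Q : ClusterQuiver V}
    {Δ Δ' : Triangulation n} {g : V → Diagonal n} (h : IsLabelling Q Δ g) {k : V} {d' : Diagonal n}
    (hf : IsFlip Δ Δ' (g k) d') : IsLabelling (Q.mutate k) Δ' (Function.update g k d') := by
  have hne : ∀ i, g i ≠ d' := fun i hi => hf.notMem (hi ▸ h.mem i)
  have hnk : ∀ i, i ≠ k → g i ≠ g k := fun i hi => fun hi' => hi (h.injective hi')
  refine ⟨?_, ?_, ?_⟩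
  · intro i j hij
    by_cases hi : i = k <;> by_cases hj : j = k
    · rw [hi, hj]
    · subst hi
      rw [Function.update_self, Function.update_of_ne hj] at hij
      exact (hne _ hij.symm).elim
    · subst hj
      rw [Function.update_self, Function.update_of_ne hi] at hij
      exact (hne _ hij).elim
    · rw [Function.update_of_ne hi, Function.update_of_ne hj] at hij
      exact h.injective hij
  · ext x
    rw [hf.eq, ← h.range, Set.mem_insert_iff, Set.mem_sdiff, Set.mem_singleton_iff]
    constructor
    · rintro ⟨i, rfl⟩
      by_cases hi : i = k
      · left
        rw [hi, Function.update_self]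
      · right
        rw [Function.update_of_ne hi]
        exact ⟨⟨i, rfl⟩, hnk i hi⟩
    · rintro (rfl | ⟨⟨i, rfl⟩, hi⟩)
      · exact ⟨k, Function.update_self ..⟩
      · exact ⟨i, Function.update_of_ne (fun h : i = k => hi (by rw [h])) ..⟩
  · intro i j
    by_cases hi : i = k <;> by_cases hj : j = k
    · rw [hi, hj, Function.update_self]
      refine (arrowCount_self _ _).trans ?_
      simp only [ClusterQuiver.mutate, true_or, if_true]
      rw [← h.arrow]
      exact (arrowCount_self _ _).symm
    · rw [hi, Function.update_self, Function.update_of_ne hj,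
        hf.arrow_left _ (h.mem j) (hnk j hj), h.arrow]
      simp [ClusterQuiver.mutate]
    · rw [hj, Function.update_self, Function.update_of_ne hi,
        hf.arrow_right _ (h.mem i) (hnk i hi), h.arrow]
      simp [ClusterQuiver.mutate]
    · rw [Function.update_of_ne hi, Function.update_of_ne hj,
        hf.arrow _ (h.mem i) (hnk i hi) _ (h.mem j) (hnk j hj)]
      simp [ClusterQuiver.mutate, hi, hj, h.arrow]

end Triangulation

/-! ### Symmetries of the punctured polygon. -/

namespace Diagonal

variable {n : ℕ}

theorem IsLift.rotate {d : Diagonal n} {x : ℤ} {y : WithTop ℤ} (h : d.IsLift x y) (m : ℤ) :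
    (d.rotate (m : ZMod n)).IsLift (x + m) (y + (m : WithTop ℤ)) := by
  have key : ∀ (e : Diagonal n) u v, DrawnAs ∅ e u v ↔ e.IsLift u v := by
    intro e u v
    cases e with
    | arc => exact Iff.rfl
    | radius c ε => simp [DrawnAs]
  have := DrawnAs.rotate m ∅ d x y ((key _ _ _).2 h)
  rwa [Set.image_empty, key] at this

theorem Crosses.rotate (hn : n ≠ 0) {d e : Diagonal n} (h : d.Crosses e) (k : ZMod n) :
    (d.rotate k).Crosses (e.rotate k) := by
  obtain ⟨m, rfl⟩ := ZMod.intCast_surjective k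
  obtain ⟨x, y, hxy⟩ : ∃ x y, d.IsLift x y := by
    obtain ⟨x, y, hxy⟩ := isChordOrbit_isLift hn d
    exact ⟨x, y, by rw [hxy]; exact ChordOrbit.self _ _⟩
  obtain ⟨a, c, ε, rfl, rfl, hac⟩ | ⟨u, v, h1, h2⟩ := h.exists_isLift hn hxy
  · exact ⟨fun h => hac (add_right_cancel h), by simp⟩
  · exact crosses_of_isLift (hxy.rotate m) (h1.rotate m) (h2.shift m)

theorem Crosses.invert {d e : Diagonal n} (h : d.Crosses e) : d.invert.Crosses e.invert := by
  cases d <;> cases e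
  · exact h
  · exact h
  · exact h
  · exact ⟨h.1, fun h' => h.2 (by simpa using h')⟩

/-- A rotation, combined with the inversion of all tags if `b` holds. -/
def symmetry (k : ZMod n) (b : Bool) (d : Diagonal n) : Diagonal n :=
  rotate k (if b then invert d else d)

theorem invert_rotate (k : ZMod n) (d : Diagonal n) : invert (rotate k d) = rotate k (invert d) := by
  cases d <;> rfl

theorem symmetry_symmetry_neg (k : ZMod n) (b : Bool) (d : Diagonal n) :
    symmetry (-k) b (symmetry k b d) = d := by
  cases b
  · simp [symmetry, rotate_rotate_neg]
  · simp [symmetry, invert_rotate, rotate_rotate_neg, invert_invert]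

theorem symmetry_neg_symmetry (k : ZMod n) (b : Bool) (d : Diagonal n) :
    symmetry k b (symmetry (-k) b d) = d := by
  have := symmetry_symmetry_neg (-k) b d
  rwa [neg_neg] at this

theorem Crosses.symmetry (hn : n ≠ 0) {d e : Diagonal n} (h : d.Crosses e) (k : ZMod n) (b : Bool) :
    (d.symmetry k b).Crosses (e.symmetry k b) := by
  cases b
  · exact h.rotate hn k
  · exact h.invert.rotate hn k

end Diagonal

/-! ### Rigidity passes back along flips. -/

namespace Triangulation

variable {n : ℕ}

/-- The quiver of `Δ` determines `Δ` together with the labelling by its vertices, up to symmetry. -/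
def Rigid (Δ : Triangulation n) : Prop :=
  ∀ (V : Type) (Q : ClusterQuiver V) (Δ' : Triangulation n) (g g' : V → Diagonal n),
    IsLabelling Q Δ g → IsLabelling Q Δ' g' → ∃ k b, ∀ i, g' i = symmetry k b (g i)

/-- Flipping both triangulations at the same label gives labellings of the same mutated quiver, to
which rigidity of `Δ'` applies. The resulting symmetry matches all labels except possibly the
flipped one, and uniqueness of replacements settles that one. -/
theorem Rigid.of_isFlip (hn : 2 ≤ n) {Δ Δ' : Triangulation n} {d d' : Diagonal n}
    (hf : IsFlip Δ Δ' d d') (h : Rigid Δ') : Rigid Δ := by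
  classical
  have hn0 : n ≠ 0 := by omega
  intro V Q Δ₁ g g₁ hg hg₁
  obtain ⟨i₀, rfl⟩ : d ∈ Set.range g := by
    rw [hg.range]
    exact hf.mem
  obtain ⟨Δ₂, d₂, hf₂⟩ := Δ₁.exists_flip hn (hg₁.mem i₀)
  obtain ⟨k, b, hkb⟩ := h V _ Δ₂ _ _ (hg.mutate hf) (hg₁.mutate hf₂)
  have h1 : ∀ i, i ≠ i₀ → g₁ i = symmetry k b (g i) := by
    intro i hi
    have := hkb i
    rwa [Function.update_of_ne hi, Function.update_of_ne hi] at this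
  have h2 : d₂ = symmetry k b d' := by
    have := hkb i₀
    rwa [Function.update_self, Function.update_self] at this
  refine ⟨k, b, fun i => ?_⟩
  by_cases hi : i = i₀
  swap
  · exact h1 i hi
  subst hi
  set e := symmetry (-k) b (g₁ i) with he
  have he' : symmetry k b e = g₁ i := symmetry_neg_symmetry k b _
  have hmem := hf.toIsExchange.mem_and_ne_iff
  -- The diagonal `e`, moved back by the symmetry, crosses none of the diagonals shared by `Δ` and
  -- `Δ'`. So it belongs to `Δ'` or equals the old diagonal; the former contradicts injectivity of
  -- the labelling or the exchange itself.
  rcases hf.symm.unique e (fun x hx hxd hxe => by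
    obtain ⟨h3, h4⟩ := (hmem x).1 ⟨hx, hxd⟩
    rw [← hg.range] at h3
    obtain ⟨j, rfl⟩ := h3
    have h5 := hxe.symmetry hn0 k b
    rw [he', ← h1 j (fun h => h4 (h ▸ rfl))] at h5
    exact Δ₁.not_crosses (hg₁.mem j) (hg₁.mem i) h5) with h3 | h3
  · by_cases h4 : e = d'
    · rw [h4, ← h2] at he'
      exact (hf₂.notMem (he' ▸ hg₁.mem i)).elim
    · obtain ⟨h5, h6⟩ := (hmem e).1 ⟨h3, h4⟩
      rw [← hg.range] at h5
      obtain ⟨j, hj⟩ := h5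
      have hji : j ≠ i := fun h => h6 (by rw [← hj, h])
      rw [← hj, ← h1 j hji] at he'
      exact (hji (hg₁.injective he')).elim
  · rw [← h3, he']

end Triangulation

/-! ### Triangulations whose quiver is an oriented cycle. -/

section ChordArrow

variable {n : ℕ} {S : ℤ → WithTop ℤ → Prop}

/-- A line precedes an arc or loop only as the side `(y, ⊤)` followed by `(x, y)`. So the latter
ends where the line starts. -/
theorem chordArrow_top_coe {p u v : ℤ} (h : ChordArrow S (ChordOrbit n p ⊤) (ChordOrbit n u v)) :
    (v : ZMod n) = p := by
  obtain ⟨x, y, z, -, ⟨a, b⟩ | ⟨a, b⟩ | ⟨a, b⟩⟩ := h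
  · exact (WithTop.coe_ne_top (Monogon.chordOrbit_top.1 a).2).elim
  · obtain ⟨-, rfl⟩ := Monogon.chordOrbit_top.1 a
    obtain ⟨k, -, h⟩ := b
    exact (WithTop.top_ne_coe h).elim
  · obtain ⟨⟨k, rfl⟩, -⟩ := Monogon.chordOrbit_top.1 a
    obtain ⟨l, -, h⟩ := b
    norm_cast at h
    exact ZMod.intCast_eq_iff_exists.2 ⟨k - l, by linarith⟩

theorem chordArrow_coe_top {r u v : ℤ} (h : ChordArrow S (ChordOrbit n u v) (ChordOrbit n r ⊤)) :
    (u : ZMod n) = r := by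
  obtain ⟨x, y, z, -, ⟨a, b⟩ | ⟨a, b⟩ | ⟨a, b⟩⟩ := h
  · obtain ⟨⟨k, rfl⟩, -⟩ := Monogon.chordOrbit_top.1 b
    obtain ⟨l, h, -⟩ := a
    exact ZMod.intCast_eq_iff_exists.2 ⟨k - l, by linarith⟩
  · obtain ⟨-, rfl⟩ := Monogon.chordOrbit_top.1 b
    obtain ⟨k, -, h⟩ := a
    exact (WithTop.top_ne_coe h).elim
  · exact (WithTop.coe_ne_top (Monogon.chordOrbit_top.1 b).2).elim

/-- The successors of a line to the puncture. -/
theorem chordArrow_top_left {p : ℤ} {E : ℤ → WithTop ℤ → Prop} (hS : ShiftInvariant n S)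
    (hE : ShiftInvariant n E) (h : ChordArrow S (ChordOrbit n p ⊤) E) :
    (∃ y : ℤ, p < y ∧ S p y ∧ S y ⊤ ∧ E y ⊤) ∨ ∃ x : ℤ, x < p ∧ S x p ∧ S x ⊤ ∧ E x p := by
  obtain ⟨x, y, z, ⟨hxy, hyz, h1, h2, h3⟩, ⟨a, b⟩ | ⟨a, b⟩ | ⟨a, b⟩⟩ := h
  · exact (WithTop.coe_ne_top (Monogon.chordOrbit_top.1 a).2).elim
  · obtain ⟨⟨k, rfl⟩, rfl⟩ := Monogon.chordOrbit_top.1 a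
    obtain ⟨y, rfl⟩ : ∃ y', y = y' + k * n := ⟨y - k * n, by ring⟩
    exact Or.inl ⟨y, by linarith, (hS.iff _ _ k).1 (mod_cast h1), (hS.iff _ ⊤ k).1 h2,
      (hE.iff _ ⊤ k).1 b⟩
  · obtain ⟨⟨k, rfl⟩, rfl⟩ := Monogon.chordOrbit_top.1 a
    obtain ⟨x, rfl⟩ : ∃ x', x = x' + k * n := ⟨x - k * n, by ring⟩
    exact Or.inr ⟨x, by linarith, (hS.iff _ _ k).1 (mod_cast h1), (hS.iff _ ⊤ k).1 h3,
      (hE.iff _ _ k).1 (mod_cast b)⟩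

end ChordArrow

namespace Triangulation

variable {n : ℕ} (Δ : Triangulation n)

theorem not_drawnAs_border (hn : 2 ≤ n) {D : Set (Diagonal n)} {d : Diagonal n} {x : ℤ} :
    ¬ DrawnAs D d x (x + 1 : ℤ) := by
  cases d with
  | arc a b h h' =>
    rintro ⟨rfl, z, hz, rfl, -⟩
    norm_cast at hz
    subst hz
    exact h' (by push_cast; rfl)
  | radius c ε =>
    rintro (⟨-, -, h⟩ | ⟨-, -, h⟩)
    · exact WithTop.coe_ne_top h
    · norm_cast at h
      omega

theorem exists_drawnAs_top {x : ℤ} (h : IsSide Δ.diagonals x ⊤) :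
    ∃ ε, radius (x : ZMod n) ε ∈ Δ.diagonals ∧ radius (x : ZMod n) (!ε) ∉ Δ.diagonals ∧
      DrawnAs Δ.diagonals (radius (x : ZMod n) ε) = ChordOrbit n x ⊤ := by
  rcases h.cases with h | ⟨z, -, -, h, -⟩ | ⟨-, ε, h3, h4⟩ | ⟨h, -⟩
  · exact (WithTop.top_ne_coe h).elim
  · exact (WithTop.top_ne_coe h).elim
  · exact ⟨ε, h3, h4, drawnAs_radius_of_notMem h4⟩
  · exact (WithTop.top_ne_coe h).elim

/-- If all border vertices are joined to the puncture, then all diagonals end there and have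
the same tag. -/
theorem exists_eq_range_radius (hn : n ≠ 0) (h : ∀ x : ℤ, IsSide Δ.diagonals x ⊤) :
    ∃ ε, Δ.diagonals = Set.range fun c => radius c ε := by
  obtain ⟨ε, h1, h2, -⟩ := Δ.exists_drawnAs_top (h 0)
  have key : ∀ x : ℤ, radius (x : ZMod n) ε ∈ Δ.diagonals ∧ radius (x : ZMod n) (!ε) ∉ Δ.diagonals := by
    intro x
    obtain ⟨ε', h3, h4, -⟩ := Δ.exists_drawnAs_top (h x)
    obtain rfl : ε' = ε := by
      by_contra hε
      by_cases hx : (x : ZMod n) = (0 : ℤ)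
      · rw [hx, Bool.eq_not_iff.2 hε] at h3
        exact h2 h3
      · exact Δ.not_crosses h3 h1 ⟨hx, hε⟩
    exact ⟨h3, h4⟩
  refine ⟨ε, Set.eq_of_subset_of_subset ?_ ?_⟩
  · intro d hd
    cases d with
    | arc a b h3 h4 =>
      obtain ⟨x, rfl⟩ := ZMod.intCast_surjective a
      obtain ⟨z, h5, h6, h7⟩ := exists_ofChord hn _ b h3 h4 x rfl
      rw [h7] at hd
      exact (Δ.nonCrossing _ _ _ _ (isSide_ofChord hd) (h (x + 1)) (by linarith)
        (mod_cast (by linarith)) (WithTop.coe_lt_top _)).elim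
    | radius c ε' =>
      obtain ⟨x, rfl⟩ := ZMod.intCast_surjective c
      obtain rfl : ε' = ε := by
        by_contra hε
        rw [Bool.eq_not_iff.2 hε] at hd
        exact (key x).2 hd
      exact ⟨_, rfl⟩
  · rintro _ ⟨c, rfl⟩
    obtain ⟨x, rfl⟩ := ZMod.intCast_surjective c
    exact (key x).1

/-- The quiver of a triangulation all of whose diagonals end at the puncture is an oriented
cycle. -/
theorem arrow_radius (hn : 3 ≤ n) {ε : Bool}
    (h : Δ.diagonals = Set.range fun c => radius c ε) (a c : ZMod n) :
    Δ.arrow (radius a ε) (radius c ε) = if c = a + 1 then 1 else 0 := by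
  have hn0 : n ≠ 0 := by omega
  have hmem : ∀ c, radius c ε ∈ Δ.diagonals := fun c => by rw [h]; exact ⟨c, rfl⟩
  have hnm : ∀ c, radius c (!ε) ∉ Δ.diagonals := fun c => by
    rw [h]
    rintro ⟨c', hc'⟩
    simp at hc'
  have hside : ∀ x z : ℤ, IsSide Δ.diagonals x z → z = x + 1 := by
    intro x z hxz
    rcases hxz.cases with h' | ⟨t, h1, h2, -, h3⟩ | ⟨h', -⟩ | ⟨-, h'⟩
    · exact mod_cast h'
    · rw [h] at h3
      obtain ⟨c, hc⟩ := h3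
      simp [ofChord] at hc
    · exact (WithTop.coe_ne_top h').elim
    · exact (hnm _ (h' _)).elim
  have key : ∀ a c : ZMod n, ChordArrow (IsSide Δ.diagonals) (DrawnAs Δ.diagonals (radius a ε))
      (DrawnAs Δ.diagonals (radius c ε)) ↔ c = a + 1 := by
    intro a c
    obtain ⟨x, rfl⟩ := ZMod.intCast_surjective a
    obtain ⟨z, rfl⟩ := ZMod.intCast_surjective c
    rw [drawnAs_radius_of_notMem (hnm _), drawnAs_radius_of_notMem (hnm _)]
    constructor
    · intro h'
      rcases chordArrow_top_left (isSide_shiftInvariant hn0) (ChordOrbit.shiftInvariant _ _) h' with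
        ⟨y, h1, h2, h3, h4⟩ | ⟨y, h1, h2, h3, h4⟩
      · obtain rfl := hside _ _ h2
        obtain ⟨hk, -⟩ := Monogon.chordOrbit_top.1 h4
        rw [← ZMod.intCast_eq_iff_exists] at hk
        rw [← hk]
        push_cast
        rfl
      · exact (WithTop.coe_ne_top (Monogon.chordOrbit_top.1 h4).2).elim
    · intro h'
      have h1 : ∀ y : ℤ, IsSide Δ.diagonals y ⊤ := fun y => isSide_top (hmem y) (hnm y)
      refine ⟨x, x + 1, ⊤, ⟨by linarith, WithTop.coe_lt_top _, Or.inl rfl, h1 _, h1 _⟩,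
        Or.inr (Or.inl ⟨ChordOrbit.self _ _, Monogon.chordOrbit_top.2 ⟨?_, rfl⟩⟩)⟩
      rw [← ZMod.intCast_eq_iff_exists, h']
      push_cast
      rfl
  refine (arrowCount_congr (key a c) (key c a)).trans ?_
  by_cases hc : c = a + 1
  · rw [if_pos hc, if_pos]
    refine ⟨hc, fun ha => ?_⟩
    rw [hc] at ha
    have h2 : ((2 : ℕ) : ZMod n) = 0 := by
      push_cast
      linear_combination -ha
    rw [ZMod.natCast_eq_zero_iff] at h2
    exact absurd (Nat.le_of_dvd (by norm_num) h2) (by omega)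
  · rw [if_neg hc, if_neg (fun h => hc h.1)]

/-- Only triangulations all of whose diagonals end at the puncture have an oriented `n`-cycle as
quiver. -/
theorem isSide_top_of_cycle (hn : 5 ≤ n) {u : ZMod n → Diagonal n} (hinj : Function.Injective u)
    (hrange : Set.range u = Δ.diagonals)
    (harrow : ∀ i j, Δ.arrow (u i) (u j) = if j = i + 1 then 1 else 0) (x : ℤ) :
    IsSide Δ.diagonals x ⊤ := by
  have hn0 : n ≠ 0 := by omega
  have hmem : ∀ d ∈ Δ.diagonals, ∃ i, u i = d := fun d hd => by rwa [← hrange] at hd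
  have hsucc : ∀ d e i, u i = d → e ∈ Δ.diagonals →
      ChordArrow (IsSide Δ.diagonals) (DrawnAs Δ.diagonals d) (DrawnAs Δ.diagonals e) →
      ¬ ChordArrow (IsSide Δ.diagonals) (DrawnAs Δ.diagonals e) (DrawnAs Δ.diagonals d) →
      u (i + 1) = e := by
    rintro d e i rfl he h1 h2
    obtain ⟨j, rfl⟩ := hmem e he
    have h3 := harrow i j
    unfold Triangulation.arrow arrowCount at h3
    rw [if_pos ⟨h1, h2⟩] at h3
    by_cases hj : j = i + 1
    · rw [hj]
    · rw [if_neg hj] at h3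
      omega
  -- This is where `5 ≤ n` enters: the cycle does not close after 3 or 4 steps.
  have hlt : ∀ m : ℕ, 0 < m → m < 5 → ∀ i : ZMod n, u (i + m) ≠ u i := by
    intro m hm hm' i hi
    have h2 := add_eq_left.1 (hinj hi)
    rw [ZMod.natCast_eq_zero_iff] at h2
    exact absurd (Nat.le_of_dvd hm h2) (by omega)
  -- Two lines at one vertex have the same successors, whereas different vertices of the cycle have
  -- different ones.
  have hdouble : ∀ a : ZMod n, ∃ ε, radius a ε ∉ Δ.diagonals := by
    by_contra! hd
    obtain ⟨a, ha⟩ := hd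
    obtain ⟨i, hi⟩ := hmem _ (ha true)
    obtain ⟨j, hj⟩ := hmem _ (ha false)
    have h1 := harrow i (i + 1)
    have h2 := harrow j (i + 1)
    obtain ⟨x, rfl⟩ := ZMod.intCast_surjective a
    unfold Triangulation.arrow at h1 h2
    rw [hi, drawnAs_radius_of_mem (ha _), if_pos rfl] at h1
    rw [hj, drawnAs_radius_of_mem (ha _), h1] at h2
    by_cases hij : i + 1 = j + 1
    · rw [add_right_cancel hij, hj] at hi
      simp at hi
    · rw [if_neg hij] at h2
      omega
  by_contra hx
  obtain ⟨p, r, hpr, hrp, hD, hp, hr, hbetween⟩ :=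
    Δ.exists_consecutive_lines (by omega) hdouble fun h => hx (h x)
  have hS := isSide_shiftInvariant (Δ := Δ.diagonals) hn0
  obtain ⟨ε, hP, -, hP'⟩ := Δ.exists_drawnAs_top hp
  obtain ⟨ε', hR, -, hR'⟩ := Δ.exists_drawnAs_top hr
  have hD' := drawnAs_ofChord (Δ := Δ.diagonals) hpr hrp
  have hpr' := isSide_ofChord hD
  have hne : (r : ZMod n) ≠ p := fun h => by
    have := eq_of_intCast_eq h (by linarith) (by linarith)
    omega
  have hpn : IsSide Δ.diagonals (p + n) ⊤ := by
    have := hS _ _ 1 hp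
    rwa [one_mul] at this
  have oP : ChordOrbit n p ⊤ (p + n) ⊤ := ⟨1, by ring, rfl⟩
  have tp := WithTop.coe_lt_top p
  have tr := WithTop.coe_lt_top r
  have hDP : ChordArrow (IsSide Δ.diagonals) (ChordOrbit n p r) (ChordOrbit n p ⊤) :=
    ⟨p, r, ⊤, ⟨by linarith, tr, hpr', hr, hp⟩, Or.inl ⟨ChordOrbit.self _ _, ChordOrbit.self _ _⟩⟩
  have hPR : ChordArrow (IsSide Δ.diagonals) (ChordOrbit n p ⊤) (ChordOrbit n r ⊤) :=
    ⟨p, r, ⊤, ⟨by linarith, tr, hpr', hr, hp⟩,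
      Or.inr (Or.inl ⟨ChordOrbit.self _ _, ChordOrbit.self _ _⟩)⟩
  have hRD : ChordArrow (IsSide Δ.diagonals) (ChordOrbit n r ⊤) (ChordOrbit n p r) :=
    ⟨p, r, ⊤, ⟨by linarith, tr, hpr', hr, hp⟩,
      Or.inr (Or.inr ⟨ChordOrbit.self _ _, ChordOrbit.self _ _⟩)⟩
  obtain ⟨i, hi⟩ := hmem _ hD
  have h1 := hsucc _ _ i hi hP (by rwa [hD', hP'])
    (by rw [hD', hP']; exact fun h => hne (chordArrow_top_coe h))
  -- The arc `(p, r)` and the lines at `p` and `r` form an oriented triangle. Its arrow from the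
  -- line at `p` to the line at `r` is cancelled just if there is a second triangle `r < p + n < ⊤`.
  by_cases hrpn : IsSide Δ.diagonals r (p + n : ℤ)
  · have tpn := WithTop.coe_lt_top (p + n : ℤ)
    have hRP : ChordArrow (IsSide Δ.diagonals) (ChordOrbit n r ⊤) (ChordOrbit n p ⊤) :=
      ⟨r, p + n, ⊤, ⟨hrp, tpn, hrpn, hpn, hr⟩, Or.inr (Or.inl ⟨ChordOrbit.self _ _, oP⟩)⟩
    rcases hrpn.cases with hb | ⟨z, h3, h4, hz, hE⟩ | ⟨h, -⟩ | ⟨h, -⟩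
    -- If the side `(r, p + n)` is a border edge, the line at `p` keeps no successor: its only
    -- candidate is the line at `r`, and that arrow is cancelled.
    · norm_cast at hb
      have h2 := harrow (i + 1) (i + 1 + 1)
      rw [if_pos rfl] at h2
      unfold Triangulation.arrow arrowCount at h2
      generalize he : u (i + 1 + 1) = e at h2
      rw [h1, hP'] at h2
      obtain ⟨h3, h4⟩ : ChordArrow (IsSide Δ.diagonals) (ChordOrbit n p ⊤) (DrawnAs Δ.diagonals e) ∧
          ¬ ChordArrow (IsSide Δ.diagonals) (DrawnAs Δ.diagonals e) (ChordOrbit n p ⊤) := by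
        by_contra h
        rw [if_neg h] at h2
        omega
      have hE := isChordOrbit_drawnAs (Δ := Δ.diagonals) hn0 e
      rcases chordArrow_top_left hS hE.shiftInvariant h3 with
        ⟨y, h5, h6, h7, h8⟩ | ⟨y, h5, h6, h7, h8⟩
      · have h9 := isSide_shortChords hn0 _ _ h6
        have h10 : r ≤ y := by
          by_contra! h10
          exact hbetween y h5 h10 h7
        by_cases h11 : y = r
        · subst h11
          obtain ⟨a, b, hab⟩ := hE
          rw [hab] at h8
          rw [hab, h8.eq] at h4
          exact h4 hRP
        · exact Δ.nonCrossing _ _ _ _ h6 hr (by linarith) (mod_cast (by omega))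
            (WithTop.coe_lt_top _)
      · have h9 := isSide_shortChords hn0 _ _ h6
        have h7' : IsSide Δ.diagonals (y + n) ⊤ := by
          have := hS _ _ 1 h7
          rwa [one_mul] at this
        by_cases h10 : y + n = r
        · obtain rfl : p = y + 1 := by linarith
          exact not_drawnAs_border (by omega) h8
        · by_cases h11 : y + n = p
          · have h6' := hS _ _ 1 h6
            rw [one_mul] at h6'
            norm_cast at h6'
            rw [h11] at h6'
            exact Δ.nonCrossing _ _ _ _ h6' hr (by linarith) (mod_cast (by omega))
              (WithTop.coe_lt_top _)
          · exact hbetween (y + n) (by omega) (by omega) h7'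
    -- If it is an arc, there is a cycle of length four: the arc `(p, r)`, the line at `p`, the arc
    -- `(r, p + n)`, the line at `r`.
    · norm_cast at hz
      subst hz
      have hE' := drawnAs_ofChord (Δ := Δ.diagonals) h3 h4
      have hpr2 : ((p + n : ℤ) : ZMod n) = p := by simp
      have h5 := hsucc _ _ _ h1 hE (by
          rw [hE', hP']
          exact ⟨r, p + n, ⊤, ⟨hrp, tpn, hrpn, hpn, hr⟩, Or.inr (Or.inr ⟨oP, ChordOrbit.self _ _⟩)⟩)
        (by rw [hE', hP']; exact fun h => hne (chordArrow_coe_top h))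
      have h6 := hsucc _ _ _ h5 hR (by
          rw [hE', hR']
          exact ⟨r, p + n, ⊤, ⟨hrp, tpn, hrpn, hpn, hr⟩,
            Or.inl ⟨ChordOrbit.self _ _, ChordOrbit.self _ _⟩⟩)
        (by rw [hE', hR']; exact fun h => hne (hpr2 ▸ chordArrow_top_coe h).symm)
      have h7 := hsucc _ _ _ h6 hD (by rwa [hD', hR'])
        (by rw [hD', hR']; exact fun h => hne (chordArrow_coe_top h).symm)
      refine hlt 4 (by norm_num) (by norm_num) i ?_
      rw [hi, ← h7]
      congr 1
      push_cast
      ring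
    · exact (WithTop.coe_ne_top h).elim
    · norm_cast at h
      omega
  -- Without the second triangle nothing is cancelled, and the triangle itself is a cycle of length
  -- three.
  · have h5 := hsucc _ _ _ h1 hR (by rwa [hP', hR']) (by
      rw [hP', hR']
      intro h
      rcases chordArrow_top_left hS (ChordOrbit.shiftInvariant _ _) h with
        ⟨y, h5, h6, h7, h8⟩ | ⟨y, h5, h6, h7, h8⟩
      · obtain ⟨⟨k, rfl⟩, -⟩ := Monogon.chordOrbit_top.1 h8
        have h9 := isSide_shortChords hn0 _ _ h6
        have := eq_zero_of_mul_lt (n := n) (k := k - 1) (by linarith) (by linarith)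
        obtain rfl : k = 1 := by linarith
        rw [one_mul] at h6
        exact hrpn h6
      · exact WithTop.coe_ne_top (Monogon.chordOrbit_top.1 h8).2)
    have h7 := hsucc _ _ _ h5 hD (by rwa [hD', hR'])
      (by rw [hD', hR']; exact fun h => hne (chordArrow_coe_top h).symm)
    refine hlt 3 (by norm_num) (by norm_num) i ?_
    rw [hi, ← h7]
    congr 1
    push_cast
    ring

/-- Triangulations all of whose diagonals end at the puncture are rigid. -/
theorem rigid_of_isSide_top (hn : 5 ≤ n) (h : ∀ x : ℤ, IsSide Δ.diagonals x ⊤) : Rigid Δ := by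
  have hn0 : n ≠ 0 := by omega
  have : NeZero n := ⟨hn0⟩
  intro V Q Δ' g g' hg hg'
  obtain ⟨ε, hε⟩ := Δ.exists_eq_range_radius hn0 h
  have hex : ∀ c : ZMod n, ∃ i, g i = radius c ε := fun c => by
    have : radius c ε ∈ Set.range g := by
      rw [hg.range, hε]
      exact ⟨c, rfl⟩
    exact this
  choose f hf using hex
  have hfs : ∀ i, ∃ c, f c = i := by
    intro i
    have := hg.mem i
    rw [hε] at this
    obtain ⟨c, hc⟩ := this
    exact ⟨c, hg.injective ((hf c).trans hc)⟩
  have harrow : ∀ a c, Δ'.arrow (g' (f a)) (g' (f c)) = if c = a + 1 then 1 else 0 := by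
    intro a c
    rw [hg'.arrow, ← hg.arrow, hf, hf, Δ.arrow_radius (by omega) hε]
  have hinj : Function.Injective fun c => g' (f c) := by
    intro a c hac
    have := congrArg g (hg'.injective hac)
    rw [hf, hf] at this
    simpa using this
  have hside := Δ'.isSide_top_of_cycle hn hinj (by
    rw [← hg'.range]
    ext d
    constructor
    · rintro ⟨c, rfl⟩
      exact ⟨_, rfl⟩
    · rintro ⟨i, rfl⟩
      obtain ⟨c, rfl⟩ := hfs i
      exact ⟨c, rfl⟩) harrow
  obtain ⟨ε', hε'⟩ := Δ'.exists_eq_range_radius hn0 hside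
  have hex' : ∀ c, ∃ c', g' (f c) = radius c' ε' := fun c => by
    have := hg'.mem (f c)
    rw [hε'] at this
    obtain ⟨c', hc'⟩ := this
    exact ⟨c', hc'.symm⟩
  choose φ hφ using hex'
  -- An identification of two oriented `n`-cycles commutes with the successor, hence is a
  -- translation; this is the rotation sought.
  have hstep : ∀ c, φ (c + 1) = φ c + 1 := by
    intro c
    have h1 := harrow c (c + 1)
    rw [hφ, hφ, Δ'.arrow_radius (by omega) hε', if_pos rfl] at h1
    by_contra h2
    rw [if_neg h2] at h1
    omega
  have hk : ∀ k : ℕ, φ k = k + φ 0 := by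
    intro k
    induction k with
    | zero => simp
    | succ k ih =>
      push_cast
      rw [hstep, ih]
      ring
  refine ⟨φ 0, ε != ε', fun i => ?_⟩
  obtain ⟨c, rfl⟩ := hfs i
  have hc := hk c.val
  rw [ZMod.natCast_zmod_val] at hc
  rw [hφ, hf, hc]
  cases ε <;> cases ε' <;> rfl

/-- Every triangulation is determined, up to symmetry, by its quiver. -/
theorem rigid (hn : 5 ≤ n) (Δ : Triangulation n) : Rigid Δ :=
  flip_induction (by omega) (fun _ _ _ _ hf h => h.of_isFlip (by omega) hf)
    (fun Δ h => Δ.rigid_of_isSide_top hn h) Δ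

end Triangulation

/-! ### Orientations of the Dynkin diagram. -/

namespace ClusterQuiver

variable {n : ℕ}

/-- `i` is the neighbour of `j` in `dynkinD n` that is closer to the vertex `0`. -/
def IsParent (i j : Fin n) : Prop :=
  ((i : ℕ) + 1 = j ∧ (j : ℕ) + 1 < n) ∨ ((i : ℕ) + 3 = n ∧ (j : ℕ) + 1 = n)

theorem IsParent.lt {i j : Fin n} (h : IsParent i j) : (i : ℕ) < j := by
  unfold IsParent at h
  omega

theorem IsParent.eq {i i' j : Fin n} (h : IsParent i j) (h' : IsParent i' j) : i = i' := by
  unfold IsParent at h h'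
  ext
  omega

theorem adj_dynkinD {i j : Fin n} : (dynkinD n).Adj i j ↔ IsParent i j ∨ IsParent j i := by
  rw [dynkinD, SimpleGraph.fromRel_adj]
  refine and_iff_right_of_imp fun h => ?_
  rintro rfl
  exact h.elim (fun h => (IsParent.lt h).ne rfl) (fun h => (IsParent.lt h).ne rfl)

open Classical in
/-- The orientation of `dynkinD n` in which the edge joining `j` to its parent points to `j` iff
`σ j` holds. -/
noncomputable def orient (σ : Fin n → Bool) : ClusterQuiver (Fin n) where
  arrows i j := if (IsParent i j ∧ σ j = true) ∨ (IsParent j i ∧ σ i = false) then 1 else 0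
  no_two_cycle i j := by
    have h : ∀ i j : Fin n, IsParent i j → ¬ IsParent j i :=
      fun i j h h' => absurd h.lt h'.lt.asymm
    have h1 := h i j
    have h2 := h j i
    by_cases h3 : IsParent i j <;> by_cases h4 : IsParent j i <;> cases σ i <;> cases σ j <;>
      simp_all

/-- The diagram is a tree rooted at `0`, and parents are unique. An edge is therefore named by its
lower end, and an orientation is recorded by one Boolean for each vertex. -/
theorem IsOrientationOf.exists_orient {Q : ClusterQuiver (Fin n)}
    (h : Q.IsOrientationOf (dynkinD n)) : ∃ σ, Q = orient σ := by
  classical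
  refine ⟨fun j => decide (∃ i, IsParent i j ∧ Q.arrows i j = 1), ?_⟩
  ext i j
  obtain ⟨h1, h2⟩ := h i j
  rw [adj_dynkinD] at h1 h2
  by_cases hij : IsParent i j
  · have h3 : ¬ IsParent j i := fun h => absurd h.lt hij.lt.asymm
    have h4 := h1 (Or.inl hij)
    have h5 : (∃ i', IsParent i' j ∧ Q.arrows i' j = 1) ↔ Q.arrows i j = 1 :=
      ⟨fun ⟨i', h6, h7⟩ => hij.eq h6 ▸ h7, fun h => ⟨i, hij, h⟩⟩
    simp only [orient, hij, h3, h5, true_and, false_and, or_false, decide_eq_true_eq]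
    split_ifs <;> omega
  · by_cases hji : IsParent j i
    · have h4 := h1 (Or.inr hji)
      have h6 := Q.no_two_cycle i j
      have h5 : (∃ i', IsParent i' i ∧ Q.arrows i' i = 1) ↔ Q.arrows j i = 1 :=
        ⟨fun ⟨i', h6, h7⟩ => hji.eq h6 ▸ h7, fun h => ⟨j, hji, h⟩⟩
      simp only [orient, hij, hji, h5, true_and, false_and, false_or, decide_eq_false_iff_not]
      split_ifs <;> omega
    · simp [orient, hij, hji, h2]

/-- Mutation of an orientation at a sink or source. -/
theorem mutate_orient {σ τ : Fin n → Bool} {v : Fin n} {b : Bool}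
    (h1 : ∀ j, IsParent v j → σ j = b) (h2 : ∀ i, IsParent i v → σ v = !b)
    (h3 : ∀ j, (j = v ∨ IsParent v j) → τ j = !σ j)
    (h4 : ∀ j, ¬ (j = v ∨ IsParent v j) → τ j = σ j) : (orient σ).mutate v = orient τ := by
  ext i j
  -- The vertex `v` is a sink or a source, so no path runs through it and mutation only reverses its
  -- arrows.
  have hz : ∀ i j, (orient σ).arrows i v * (orient σ).arrows v j = 0 := by
    intro i j
    simp only [orient, mul_eq_zero, ite_eq_right_iff, one_ne_zero, imp_false]
    by_contra! h
    obtain ⟨h5, h6⟩ := h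
    cases b <;> grind
  by_cases hij : i = v ∨ j = v
  · simp only [mutate, hij, if_true]
    have h5 : ∀ i j : Fin n, IsParent i j → ¬ IsParent j i :=
      fun i j h h' => absurd h.lt h'.lt.asymm
    have h6 := h5 i j
    unfold orient
    dsimp only
    congr 1
    rcases hij with rfl | rfl
    · by_cases hv : IsParent i j
      · simp [hv, h6 hv, h3 j (Or.inr hv)]
      · simp [hv, h3 i (Or.inl rfl)]
    · by_cases hv : IsParent j i
      · simp [hv, h5 _ _ hv, h3 i (Or.inr hv)]
      · simp [hv, h3 j (Or.inl rfl)]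
  · simp only [mutate, hij, if_false, hz, add_zero]
    push Not at hij
    have h5 := (orient σ).no_two_cycle i j
    have h6 : (orient σ).arrows i j = (orient τ).arrows i j := by
      unfold orient
      dsimp only
      congr 1
      by_cases hp : IsParent i j
      · have h7 : ¬ IsParent j i := fun h => absurd h.lt hp.lt.asymm
        simp [hp, h7, h4 j (fun h => h.elim hij.2 fun h => hij.1 (hp.eq h))]
      · by_cases hp' : IsParent j i
        · simp [hp, hp', h4 i (fun h => h.elim hij.1 fun h => hij.2 (hp'.eq h))]
        · simp [hp, hp']
    omega

/-- Edges are corrected from the leaves towards the root: once everything from `m + 1` on agrees,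
the edge above `m` is adjusted at the expense of smaller indices only, which the induction
hypothesis can still change. -/
theorem orient_mutationEquivalent_of_eq (m : ℕ) : ∀ σ τ : Fin n → Bool,
    (∀ j : Fin n, m ≤ (j : ℕ) → σ j = τ j) → (orient σ).MutationEquivalent (orient τ) := by
  induction m with
  | zero =>
    intro σ τ h
    rw [funext fun j => h j (Nat.zero_le _)]
    exact Relation.ReflTransGen.refl
  | succ m ih =>
    intro σ τ h
    by_cases hm : ∀ j : Fin n, (j : ℕ) = m → σ j = τ j
    · exact ih _ _ fun j hj => hj.eq_or_lt.elim (fun h => hm j h.symm) (h j)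
    push Not at hm
    obtain ⟨v, rfl, hv⟩ := hm
    replace hv : τ v = !σ v := by
      rcases h1 : σ v <;> rcases h2 : τ v <;> simp_all
    have hlt := v.isLt
    by_cases hv1 : (v : ℕ) + 3 ≤ n
    · by_cases hv0 : (v : ℕ) = 0
      -- The root has no parent, so its value does not affect the orientation.
      · have hnp : ∀ i j, IsParent i j → σ j = τ j :=
          fun i j hij => h j (by have := hij.lt; omega)
        have : orient σ = orient τ := by
          ext i j
          by_cases hp : IsParent i j
          · have h7 : ¬ IsParent j i := fun h => absurd h.lt hp.lt.asymm
            simp [orient, hp, h7, hnp i j hp]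
          · by_cases hp' : IsParent j i
            · simp [orient, hp, hp', hnp j i hp']
            · simp [orient, hp, hp']
        rw [this]
        exact Relation.ReflTransGen.refl
      · obtain ⟨u, hu⟩ : ∃ u : Fin n, (u : ℕ) + 1 = v := ⟨⟨v - 1, by omega⟩, by dsimp only; omega⟩
        have huv : ∀ j, IsParent u j ↔ j = v := by
          intro j
          unfold IsParent
          rw [Fin.ext_iff]
          omega
        have hne : v ≠ u := fun h => by rw [h] at hu; omega
        -- The parent `u` has `v` as its only child. Setting its own value to `!σ v` makes it a sink
        -- or source, and mutation at `u` then reverses the edge to `v`.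
        refine (ih σ (Function.update σ u (!σ v)) fun j hj => ?_).trans
          (Relation.ReflTransGen.head (b := orient (Function.update (Function.update σ u (σ v)) v
            (!σ v))) ⟨u, ?_⟩ (ih _ _ fun j hj => ?_))
        · rw [Function.update_of_ne]
          rintro rfl
          omega
        · refine (mutate_orient (b := σ v) ?_ ?_ ?_ ?_).symm
          · intro j hj
            rw [(huv j).1 hj, Function.update_of_ne hne]
          · intro i _
            rw [Function.update_self]
          · rintro j (rfl | hj)
            · rw [Function.update_of_ne hne.symm, Function.update_self, Function.update_self,
                Bool.not_not]
            · rw [(huv j).1 hj, Function.update_self, Function.update_of_ne hne]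
          · intro j hj
            rw [huv] at hj
            push Not at hj
            rw [Function.update_of_ne hj.2, Function.update_of_ne hj.1, Function.update_of_ne hj.1]
        · by_cases hjv : j = v
          · rw [hjv, Function.update_self, hv]
          · have h1 : j ≠ u := by rintro rfl; omega
            rw [Function.update_of_ne hjv, Function.update_of_ne h1]
            exact h j (by rw [Fin.ext_iff] at hjv; omega)
    -- A leaf is always a sink or source, and mutation there reverses just its own edge.
    · have hnp : ∀ j, ¬ IsParent v j := by
        intro j
        unfold IsParent
        omega
      refine Relation.ReflTransGen.head (b := orient (Function.update σ v (!σ v))) ⟨v, ?_⟩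
        (ih _ _ fun j hj => ?_)
      · refine (mutate_orient (b := !σ v) ?_ ?_ ?_ ?_).symm
        · exact fun j hj => (hnp j hj).elim
        · simp
        · rintro j (rfl | hj)
          · rw [Function.update_self]
          · exact (hnp j hj).elim
        · intro j hj
          push Not at hj
          rw [Function.update_of_ne hj.1]
      · by_cases hjv : j = v
        · rw [hjv, Function.update_self, hv]
        · rw [Function.update_of_ne hjv]
          exact h j (by rw [Fin.ext_iff] at hjv; omega)

/-- Any two orientations of `dynkinD n` are mutation equivalent. -/
theorem orient_mutationEquivalent (σ τ : Fin n → Bool) :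
    (orient σ).MutationEquivalent (orient τ) :=
  orient_mutationEquivalent_of_eq n σ τ fun j hj => absurd j.isLt (not_lt.2 hj)

end ClusterQuiver

/-! ### The fan triangulation and its quiver. -/

namespace Diagonal

variable {n : ℕ}

/-- The diagonals of the fan triangulation with centre `0`: the arcs `M_{0,j}` and both lines
between `0` and the puncture. -/
def fan (n : ℕ) (i : Fin n) : Diagonal n :=
  if h : (i : ℕ) + 2 < n then ofChord 0 (i + 2 : ℤ) (by omega) (by omega)
  else radius ((0 : ℤ) : ZMod n) (decide ((i : ℕ) + 2 = n))

theorem fan_of_lt {i : Fin n} (h : (i : ℕ) + 2 < n) :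
    fan n i = ofChord 0 (i + 2 : ℤ) (by omega) (by omega) := dif_pos h

theorem fan_of_not_lt {i : Fin n} (h : ¬ (i : ℕ) + 2 < n) :
    fan n i = radius ((0 : ℤ) : ZMod n) (decide ((i : ℕ) + 2 = n)) := dif_neg h

theorem radius_mem_fan (hn : 2 ≤ n) (ε : Bool) :
    radius ((0 : ℤ) : ZMod n) ε ∈ Set.range (fan n) := by
  cases ε
  · refine ⟨⟨n - 1, by omega⟩, ?_⟩
    rw [fan_of_not_lt (by dsimp only; omega)]
    congr 1
    rw [decide_eq_false_iff_not]
    dsimp only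
    omega
  · refine ⟨⟨n - 2, by omega⟩, ?_⟩
    rw [fan_of_not_lt (by dsimp only; omega)]
    congr 1
    rw [decide_eq_true_iff]
    dsimp only
    omega

theorem ofChord_mem_fan {z : ℤ} (h : 0 + 2 ≤ z) (h' : z < 0 + n) :
    ofChord 0 z h h' ∈ Set.range (fan n) := by
  obtain ⟨j, rfl⟩ : ∃ j : ℕ, z = j + 2 := ⟨(z - 2).toNat, by omega⟩
  exact ⟨⟨j, by omega⟩, fan_of_lt (by dsimp only; omega)⟩

theorem fan_isLift {i : Fin n} {u : ℤ} {v : WithTop ℤ} (h : (fan n i).IsLift u v) :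
    (∃ k : ℤ, u = k * n) ∧ (v = ⊤ ∨ v < (u + n : ℤ)) := by
  by_cases hi : (i : ℕ) + 2 < n
  · rw [fan_of_lt hi, isLift_ofChord] at h
    obtain ⟨k, rfl, rfl⟩ := h
    refine ⟨⟨k, by ring⟩, Or.inr ?_⟩
    norm_cast
    omega
  · rw [fan_of_not_lt hi, isLift_radius, Monogon.chordOrbit_top] at h
    obtain ⟨⟨k, rfl⟩, rfl⟩ := h
    exact ⟨⟨k, by ring⟩, Or.inl rfl⟩

/-- All lifts start at multiples of `n` and the arcs are shorter than `n`, so no starting point lies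
strictly under an arc. The two lines have the same border vertex. -/
theorem fan_not_crosses (i j : Fin n) : ¬ (fan n i).Crosses (fan n j) := by
  have aux : ∀ (i j : Fin n) {u u' : ℤ} {v v' : WithTop ℤ}, (fan n i).IsLift u v →
      (fan n j).IsLift u' v' → u < u' → (u' : WithTop ℤ) < v → v < v' → False := by
    intro i j u u' v v' h h' h1 h2 h3
    obtain ⟨⟨k, rfl⟩, h4⟩ := fan_isLift h
    obtain ⟨⟨l, rfl⟩, -⟩ := fan_isLift h'
    rcases h4 with rfl | h4
    · exact not_top_lt h3
    · have h5 := h2.trans h4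
      norm_cast at h5
      have := eq_zero_of_mul_lt (n := n) (k := l - k) (by linarith) (by linarith)
      obtain rfl : l = k := by omega
      exact lt_irrefl _ h1
  intro h
  by_cases hi : (i : ℕ) + 2 < n
  · have h' := h
    rw [fan_of_lt hi] at h'
    obtain ⟨x, y, x', y', h1, h2, h3⟩ := crosses_arc_left.1 h'
    replace h1 : (fan n i).IsLift x y := by rwa [fan_of_lt hi]
    exact h3.elim (fun h => aux i j h1 h2 h.1 h.2.1 h.2.2)
      (fun h => aux j i h2 h1 h.1 h.2.1 h.2.2)
  by_cases hj : (j : ℕ) + 2 < n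
  · have h' := h
    rw [fan_of_lt hj] at h'
    obtain ⟨x, y, x', y', h1, h2, h3⟩ := crosses_arc_right.1 h'
    replace h2 : (fan n j).IsLift x' y' := by rwa [fan_of_lt hj]
    exact h3.elim (fun h => aux i j h1 h2 h.1 h.2.1 h.2.2)
      (fun h => aux j i h2 h1 h.1 h.2.1 h.2.2)
  rw [fan_of_not_lt hi, fan_of_not_lt hj] at h
  exact h.1 rfl

theorem fan_injective : Function.Injective (fan n) := by
  intro i j h
  by_cases hi : (i : ℕ) + 2 < n <;> by_cases hj : (j : ℕ) + 2 < n
  · have h1 : (fan n i).IsLift 0 (i + 2 : ℤ) := by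
      rw [fan_of_lt hi, isLift_ofChord]
      exact ChordOrbit.self _ _
    rw [h, fan_of_lt hj, isLift_ofChord] at h1
    obtain ⟨k, h2, h3⟩ := h1
    rw [zero_add] at h2
    rw [← h2] at h3
    norm_cast at h3
    ext
    omega
  · rw [fan_of_lt hi, fan_of_not_lt hj] at h
    simp [ofChord] at h
  · rw [fan_of_not_lt hi, fan_of_lt hj] at h
    simp [ofChord] at h
  · rw [fan_of_not_lt hi, fan_of_not_lt hj] at h
    injection h with _ h
    rw [decide_eq_decide] at h
    ext
    omega

end Diagonal

namespace Triangulation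

variable {n : ℕ}

/-- The fan triangulation with centre `0`. -/
def fan (hn : 2 ≤ n) : Triangulation n where
  diagonals := Set.range (Diagonal.fan n)
  maximal := by
    have hn0 : n ≠ 0 := by omega
    refine ⟨?_, fun T hT hle e he => ?_⟩
    · rintro _ ⟨i, rfl⟩ _ ⟨j, rfl⟩ -
      exact fan_not_crosses i j
    by_contra hne
    have hT' : ∀ d ∈ Set.range (Diagonal.fan n), ¬ d.Crosses e :=
      fun d hd => hT (hle hd) he fun h => hne (h ▸ hd)
    cases e with
    | radius a ε =>
      refine hT' _ (radius_mem_fan hn (!ε)) ⟨?_, by simp⟩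
      rintro rfl
      exact hne (radius_mem_fan hn ε)
    | arc a b h h' =>
      obtain ⟨x, hx0, hxn, hx⟩ := ZMod.exists_intCast_eq hn0 a 0
      obtain ⟨z, h1, h2, h3⟩ := exists_ofChord hn0 a b h h' x hx
      rw [h3] at hne hT'
      have hlift := (isLift_ofChord h1 h2).2 (ChordOrbit.self _ _)
      rcases hx0.eq_or_lt with rfl | hx0
      · exact hne (ofChord_mem_fan h1 h2)
      -- A chord starting at `x > 0` either ends by `n`, and then crosses the chord from `0` to `x +
      -- 1`, or passes over `n`, and then crosses the line there.
      by_cases hz : z ≤ n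
      · refine hT' _ (ofChord_mem_fan (z := x + 1) (by omega) (by omega))
          (crosses_of_isLift ((isLift_ofChord _ _).2 (ChordOrbit.self _ _)) hlift
            (Or.inl ⟨hx0, ?_, ?_⟩)) <;> norm_cast <;> omega
      · have h4 : (radius ((0 : ℤ) : ZMod n) true).IsLift n ⊤ := by
          rw [isLift_radius, Monogon.chordOrbit_top]
          exact ⟨⟨1, by simp⟩, rfl⟩
        refine hT' _ (radius_mem_fan hn true) (crosses_of_isLift h4 hlift
          (Or.inr ⟨by omega, ?_, WithTop.coe_lt_top _⟩))
        norm_cast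
        omega

/-- Both lines at `0` are drawn as the loop of length `n`. The minimum treats them together with the
arcs, the last two indices giving the same chord. -/
theorem drawnAs_fan (hn : 2 ≤ n) (i : Fin n) :
    DrawnAs (fan hn).diagonals (Diagonal.fan n i) = ChordOrbit n 0 (min (i + 2) n : ℤ) := by
  by_cases hi : (i : ℕ) + 2 < n
  · rw [fan_of_lt hi, drawnAs_ofChord, min_eq_left (by omega)]
  · rw [fan_of_not_lt hi, drawnAs_radius_of_mem (Δ := (fan hn).diagonals) (radius_mem_fan hn _), min_eq_right (by omega),
      zero_add]

theorem isSide_fan (hn : 2 ≤ n) {x : ℤ} {v : WithTop ℤ} (h : IsSide (fan hn).diagonals x v) :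
    v = (x + 1 : ℤ) ∨ ((∃ k : ℤ, x = k * n) ∧ ∃ z : ℤ, v = z ∧ z ≤ x + n) := by
  rcases h with h | ⟨_, ⟨i, rfl⟩, h⟩
  · exact Or.inl h
  · rw [drawnAs_fan] at h
    obtain ⟨k, rfl, rfl⟩ := h
    exact Or.inr ⟨⟨k, by ring⟩, _, rfl, by linarith [min_le_right ((i : ℤ) + 2) n]⟩

theorem isSide_fan_of_mem (hn : 2 ≤ n) {z : ℤ} (h : 1 ≤ z) (h' : z ≤ n) :
    IsSide (fan hn).diagonals 0 z := by
  rcases h.eq_or_lt with rfl | h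
  · exact Or.inl (by norm_num)
  rcases h'.eq_or_lt with rfl | h'
  · have := isSide_loop (x := 0) (radius_mem_fan hn)
    rwa [zero_add] at this
  · exact isSide_ofChord (ofChord_mem_fan (z := z) (by omega) (by omega))

/-- The triangles of the fan are the translates of `0 < a < a + 1`. Their arrows form a path; since
its last chord carries two diagonals, the path ends in the fork of `D_n`. -/
theorem chordArrow_fan (hn : 2 ≤ n) {a b : ℤ} (ha : 2 ≤ a) (ha' : a ≤ n) (hb : 2 ≤ b)
    (hb' : b ≤ n) :
    ChordArrow (IsSide (fan hn).diagonals) (ChordOrbit n 0 a) (ChordOrbit n 0 b) ↔ b = a + 1 := by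
  constructor
  · rintro ⟨x, y, z, ⟨hxy, hyz, h1, h2, h3⟩, ⟨⟨k, rfl, h4⟩, ⟨l, h5, rfl⟩⟩ | ⟨⟨k, h4, h6⟩, ⟨l, h5, h7⟩⟩ |
      ⟨⟨k, h4, h6⟩, ⟨l, h5, h7⟩⟩⟩
    · obtain rfl : k = l := by
        have := eq_zero_of_mul_lt (n := n) (k := k - l) (by linarith) (by linarith)
        omega
      norm_cast at h4 hyz
      rcases isSide_fan hn h2 with h6 | ⟨⟨m, h6⟩, -⟩
      · norm_cast at h6
        omega
      · have h8 := eq_zero_of_mul_lt (n := n) (k := m - k - 1) (by linarith) (by linarith)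
        obtain rfl : m = k + 1 := by omega
        linarith
    · subst h4 h5 h6
      norm_cast at hyz
      have := eq_zero_of_mul_lt (n := n) (k := l - k) (by linarith) (by linarith)
      obtain rfl : l = k := by omega
      exact absurd hxy (lt_irrefl _)
    · subst h4 h5 h6
      have h8 := isSide_shortChords (by omega) _ _ h3
      norm_cast at h7
      have := eq_zero_of_mul_lt (n := n) (k := k - l - 1) (by linarith) (by linarith)
      obtain rfl : k = l + 1 := by omega
      linarith
  · rintro rfl
    refine ⟨0, a, (a + 1 : ℤ), ⟨by omega, by norm_cast; omega, isSide_fan_of_mem hn (by omega) ha',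
      Or.inl rfl, isSide_fan_of_mem hn (by omega) hb'⟩, Or.inl ⟨ChordOrbit.self _ _,
      ChordOrbit.self _ _⟩⟩

open ClusterQuiver in
/-- The quiver of the fan triangulation is an orientation of `dynkinD n`. -/
theorem isLabelling_fan (hn : 3 ≤ n) :
    IsLabelling (orient fun _ => true) (fan (n := n) (by omega)) (Diagonal.fan n) where
  injective := fan_injective
  range := rfl
  arrow i j := by
    have hi := i.isLt
    have hj := j.isLt
    rw [arrow, drawnAs_fan, drawnAs_fan, arrowCount_congr
      (chordArrow_fan (by omega) (by omega) (by omega) (by omega) (by omega))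
      (chordArrow_fan (by omega) (by omega) (by omega) (by omega) (by omega))]
    unfold orient
    dsimp only
    congr 1
    simp only [and_true, reduceCtorEq, and_false, or_false, IsParent]
    refine propext ?_
    rcases min_cases ((i : ℤ) + 2) n with h | h <;> rcases min_cases ((j : ℤ) + 2) n with h' | h' <;>
      rw [h.1, h'.1] <;> omega

end Triangulation

/-! ### Finiteness, injectivity, and the image. -/

namespace Diagonal

variable {n : ℕ}

theorem finite (hn : n ≠ 0) : Finite (Diagonal n) := by
  have : NeZero n := ⟨hn⟩
  let f : Diagonal n → (ZMod n × ZMod n) ⊕ (ZMod n × Bool)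
    | arc a b _ _ => Sum.inl (a, b)
    | radius a ε => Sum.inr (a, ε)
  refine Finite.of_injective f ?_
  rintro (⟨a, b⟩ | ⟨a, ε⟩) (⟨c, d⟩ | ⟨c, ε'⟩) h <;> simp_all [f]

end Diagonal

namespace Triangulation

variable {n : ℕ}

theorem ext_diagonals {Δ Δ' : Triangulation n} (h : Δ.diagonals = Δ'.diagonals) : Δ = Δ' := by
  cases Δ
  cases Δ'
  cases h
  rfl

theorem exists_image {φ ψ : Diagonal n → Diagonal n} (h : ∀ d, φ (ψ d) = d)
    (hφ : ∀ d e : Diagonal n, d.Crosses e → (φ d).Crosses (φ e))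
    (hψ : ∀ d e : Diagonal n, d.Crosses e → (ψ d).Crosses (ψ e)) (Δ : Triangulation n)
    (h' : ∀ d, ψ (φ d) = d) : ∃ Δ' : Triangulation n, Δ'.diagonals = φ '' Δ.diagonals := by
  refine ⟨⟨φ '' Δ.diagonals, ?_, fun T hT hle e he => ?_⟩, rfl⟩
  · rintro _ ⟨d, hd, rfl⟩ _ ⟨e, he, rfl⟩ - hc
    have := hψ _ _ hc
    rw [h', h'] at this
    exact Δ.not_crosses hd he this
  · refine ⟨ψ e, ?_, h e⟩
    by_contra hne
    obtain ⟨d, hd, hc⟩ := Δ.exists_crosses hne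
    have h1 := hφ _ _ hc
    rw [h] at h1
    refine hT (hle ⟨d, hd, rfl⟩) he ?_ h1
    rintro rfl
    exact hne (by rwa [h'])

theorem exists_invert (Δ : Triangulation n) :
    ∃ Δ' : Triangulation n, Δ'.diagonals = invert '' Δ.diagonals :=
  exists_image invert_invert (fun _ _ h => h.invert) (fun _ _ h => h.invert) Δ invert_invert

theorem mk_eq_of_symmetry {Δ Δ' : Triangulation n} {k : ZMod n} {b : Bool}
    (h : Δ'.diagonals = symmetry k b '' Δ.diagonals) :
    Quot.mk RotationOrInversion Δ = Quot.mk RotationOrInversion Δ' := by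
  cases b
  · exact Quot.sound (Or.inl ⟨k, h⟩)
  · obtain ⟨Δ₁, h₁⟩ := Δ.exists_invert
    have h₂ : RotationOrInversion Δ Δ₁ := Or.inr h₁
    have h₃ : RotationOrInversion Δ₁ Δ' := Or.inl ⟨k, ?_⟩
    · exact (Quot.sound h₂).trans (Quot.sound h₃)
    rw [h, h₁, Set.image_image]
    rfl

theorem isLabelling_val (Δ : Triangulation n) : IsLabelling Δ.quiver Δ Subtype.val :=
  ⟨Subtype.val_injective, Subtype.range_val, fun _ _ => rfl⟩

theorem IsLabelling.epsilon_eq {V : Type} {Q : ClusterQuiver V} {Δ : Triangulation n}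
    {g : V → Diagonal n} (h : IsLabelling Q Δ g) : Δ.epsilon = Q.isoClass := by
  have hiso : Q.Isomorphic Δ.quiver :=
    ⟨(Equiv.ofInjective g h.injective).trans (Equiv.setCongr h.range), h.arrow⟩
  exact (Quotient.sound (s := ClusterQuiver.isoSetoid) (a := ⟨V, Q⟩) hiso).symm

theorem exists_isLabelling_of_epsilon_eq {V : Type} {Q : ClusterQuiver V} {Δ : Triangulation n}
    (h : Δ.epsilon = Q.isoClass) : ∃ g, IsLabelling Q Δ g := by
  obtain ⟨e, he⟩ := Quotient.exact (s := ClusterQuiver.isoSetoid) h.symm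
  refine ⟨fun i => (e i : Diagonal n), Subtype.val_injective.comp e.injective, ?_, he⟩
  rw [← Function.comp_def, Set.range_comp, e.range_eq_univ, Set.image_univ, Subtype.range_val]

/-- An isomorphism of the quivers labels the second triangulation by the diagonals of the first, and
rigidity makes this labelling a symmetry. -/
theorem epsilonTilde_injective (hn : 5 ≤ n) : Function.Injective (epsilonTilde n) := by
  rintro ⟨Δ⟩ ⟨Δ'⟩ h
  obtain ⟨g, hg⟩ := exists_isLabelling_of_epsilon_eq (Δ := Δ') (Q := Δ.quiver) h.symm
  obtain ⟨k, b, hkb⟩ := rigid hn Δ _ _ _ _ _ Δ.isLabelling_val hg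
  refine mk_eq_of_symmetry (k := k) (b := b) ?_
  rw [← hg.range, funext hkb]
  exact (Set.range_comp (symmetry k b) Subtype.val).trans (by rw [Subtype.range_val])

/-- Each mutation is realised by flipping the diagonal that carries its label. This yields
surjectivity. -/
theorem exists_isLabelling_of_mutationEquivalent {V : Type} [DecidableEq V] (hn : 2 ≤ n)
    {Q Q' : ClusterQuiver V} (h : Q.MutationEquivalent Q')
    (hQ : ∃ (Δ : Triangulation n) (g : _), IsLabelling Q Δ g) :
    ∃ (Δ : Triangulation n) (g : _), IsLabelling Q' Δ g := by
  induction h with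
  | refl => exact hQ
  | tail _ h ih =>
    obtain ⟨k, rfl⟩ := h
    obtain ⟨Δ, g, hg⟩ := ih
    obtain ⟨Δ', d', hf⟩ := Δ.exists_flip hn (hg.mem k)
    exact ⟨Δ', _, hg.mutate hf⟩

theorem epsilon_mem_of_isFlip {V : Type} [DecidableEq V] {Q : ClusterQuiver V}
    {Δ Δ' : Triangulation n} {d d' : Diagonal n} (hf : IsFlip Δ Δ' d d')
    (h : Δ.epsilon ∈ Q.mutationClass) : Δ'.epsilon ∈ Q.mutationClass := by
  obtain ⟨Q', hQ, hQ'⟩ := h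
  obtain ⟨g, hg⟩ := exists_isLabelling_of_epsilon_eq hQ'
  obtain ⟨k, rfl⟩ : d ∈ Set.range g := by
    rw [hg.range]
    exact hf.mem
  exact ⟨_, hQ.tail ⟨k, rfl⟩, (hg.mutate hf).epsilon_eq⟩

/-- Flips lead from `Δ₀` to a wheel and from a wheel to `Δ`. The two wheels agree up to the
inversion of all tags, under which the quiver is invariant. -/
theorem epsilon_mem_mutationClass {V : Type} [DecidableEq V] (hn : 2 ≤ n) {Q : ClusterQuiver V}
    {Δ₀ : Triangulation n} (h₀ : Δ₀.epsilon ∈ Q.mutationClass) (Δ : Triangulation n) :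
    Δ.epsilon ∈ Q.mutationClass := by
  have hn0 : n ≠ 0 := by omega
  obtain ⟨Δ₁, h1, h2⟩ : ∃ Δ₁ : Triangulation n, (∀ x : ℤ, IsSide Δ₁.diagonals x ⊤) ∧
      Δ₁.epsilon ∈ Q.mutationClass := by
    revert h₀
    exact flip_induction (P := fun Δ => Δ.epsilon ∈ Q.mutationClass → _) hn
      (fun _ _ _ _ hf ih h => ih (epsilon_mem_of_isFlip hf h)) (fun Δ₁ h1 h2 => ⟨Δ₁, h1, h2⟩) Δ₀
  refine flip_induction hn (fun _ _ _ _ hf h => epsilon_mem_of_isFlip hf.symm h) (fun Δ₂ h3 => ?_) Δ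
  obtain ⟨ε, hε⟩ := Δ₁.exists_eq_range_radius hn0 h1
  obtain ⟨ε', hε'⟩ := Δ₂.exists_eq_range_radius hn0 h3
  by_cases h : ε = ε'
  · rwa [ext_diagonals (hε'.trans (h ▸ hε.symm))]
  · rwa [← epsilon_eq_of_rotationOrInversion Δ₁ Δ₂ (Or.inr ?_)]
    rw [hε, hε', ← Set.range_comp]
    congr 1
    funext c
    exact congrArg (radius c) (Bool.eq_not_iff.2 (Ne.symm h))

end Triangulation

theorem mainTheorem2 (n : ℕ) (hn : 5 ≤ n) (Q : ClusterQuiver (Fin n))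
    (hQ : Q.IsOrientationOf (dynkinD n)) :
    Set.BijOn (Triangulation.epsilonTilde n) Set.univ Q.mutationClass ∧
      Q.mutationClass.Finite ∧
      Q.mutationClass.ncard = Nat.card (Triangulation.Classes n) := by
  have hn2 : 2 ≤ n := by omega
  obtain ⟨σ, rfl⟩ := hQ.exists_orient
  -- The fan realises one orientation. Flips along a mutation sequence to the given one provide a
  -- triangulation whose quiver is the given orientation itself.
  obtain ⟨Δ₀, g₀, hg₀⟩ := Triangulation.exists_isLabelling_of_mutationEquivalent hn2
    (ClusterQuiver.orient_mutationEquivalent _ σ)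
    ⟨_, _, Triangulation.isLabelling_fan (n := n) (by omega)⟩
  have hbij : Set.BijOn (Triangulation.epsilonTilde n) Set.univ
      (ClusterQuiver.orient σ).mutationClass := by
    refine ⟨?_, (Triangulation.epsilonTilde_injective hn).injOn, ?_⟩
    · rintro ⟨Δ⟩ -
      exact Triangulation.epsilon_mem_mutationClass hn2 (Δ₀ := Δ₀)
        ⟨_, Relation.ReflTransGen.refl, hg₀.epsilon_eq⟩ Δ
    · rintro _ ⟨Q', hQ', rfl⟩
      obtain ⟨Δ, g, hg⟩ :=
        Triangulation.exists_isLabelling_of_mutationEquivalent hn2 hQ' ⟨Δ₀, g₀, hg₀⟩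
      exact ⟨Quot.mk _ Δ, Set.mem_univ _, hg.epsilon_eq⟩
  have := Diagonal.finite (n := n) (by omega)
  have : Finite (Triangulation n) :=
    Finite.of_injective Triangulation.diagonals fun _ _ => Triangulation.ext_diagonals
  have : Finite (Triangulation.Classes n) := Quot.finite _
  refine ⟨hbij, ?_, ?_⟩
  · rw [← hbij.image_eq]
    exact Set.finite_univ.image _
  · rw [← hbij.image_eq, hbij.injOn.ncard_image, Set.ncard_univ]
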